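/- Let $\mathbb Z_+=\{0,1,2,\dots\}$, $\mathbb N=\{1,2,\dots\}$, and let $\lambda:\mathbb Z_+\to(0,\infty)$ satisfy $0<\inf_x\lambda(x)\le\sup_x\lambda(x)<\infty$. For $N\in\mathbb N$, let $\mathsf{GT}_N$ be the set of arrays $(x^n_k)_{1\le k\le n\le N}$ in $\mathbb Z_+$ with $x^n_1<\dots<x^n_n$ for every $n\le N$ and $x^{n+1}_k\le x^n_k<x^{n+1}_{k+1}$ for $1\le k\le n<N$; let $\mathsf{GT}_\infty$ be the set of infinite arrays $(x^n_k)_{1\le k\le n}$ all of whose truncations $\pi_N(x)=(x^n_k)_{1\le k\le n\le N}$ lie in $\mathsf{GT}_N$, with the $\sigma$-algebra generated by the coordinates. The push-block dynamics on $\mathsf{GT}_N$ is the continuous-time Markov jump process in which each particle carries an independent exponential clock of rate $\lambda(x)$, where $x$ is its current position. When the clock of the particle $x^n_k$ rings, nothing happens if $k<n$ and $x^{n-1}_k=x^n_k$ (blocking); otherwise the particle moves from $x^n_k$ to $x^n_k+1$, and, if after this move it is no longer strictly to the left of $x^{n+1}_{k+1}$, the latter also moves to the right by one instantaneously, and so on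 up the levels (pushing). That is, its generator is the bounded operator $L_Nf(x)=\sum_{1\le k\le n\le N}\lambda(x^n_k)\,[f(x^{(n,k)})-f(x)]$, where $x^{(n,k)}$ is the array after the ring. The densely packed initial condition is $x^n_k=k-1$. A process on $\mathsf{GT}_\infty$ is called a push-block process if its projection by $\pi_N$ is a push-block process on $\mathsf{GT}_N$ for every $N$. Then there is a family $(P_t)_{t\ge0}$ of probability measures on $\mathsf{GT}_\infty$ which is the evolution of the densely packed initial condition under the dynamics: for all $N$, all bounded $f:\mathsf{GT}_N\to\mathbb R$ and all $t\ge0$, $\int f\circ\pi_N\,dP_t=f(\text{densely packed})+\int_0^t\int (L_Nf)\circ\pi_N\,dP_s\,ds$; for every $N$ and $t$ the law at time $t$ of any push-block process on $\mathsf{GT}_N$ started from the densely packed pattern is $(\pi_N)_*P_t$; and $P_t$ is the law at time $t$ of any push-block process on $\mathsf{GT}_\infty$ started from the densely packed pattern. Let $\mathsf P^t_\infty$ be the point process on $\mathbb N\times\mathbb Z_+$ of the points $(n,x^n_k)$, $1\le k\le n$, with $x$ distributed according to $P_t$. For every $t\ge 0$, it is determinantal: for all $k\ge1$ and distinct points $z_i=(n_i,x_i)\in\mathbb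 N\times\mathbb Z_+$, $1\le i\le k$, $$\mathsf P^t_\infty(\text{there are particles at }z_1,\dots,z_k)=\det\left[\mathsf K_t(z_i,z_j)\right]_{i,j=1}^k,$$ where, with $\psi_x(w)=\prod_{k=0}^{x}\frac{\lambda(k)}{\lambda(k)-w}$ and $p_x(w)=\prod_{k=0}^{x-1}\frac{\lambda(k)-w}{\lambda(k)}$ (so $p_0\equiv 1$), $$\mathsf K_t(n_1,x_1;n_2,x_2)=\frac{\mathbf 1(n_2>n_1)}{\lambda(x_1)}\frac1{2\pi \mathrm i}\oint_{\mathsf C_\lambda}\psi_{x_1}(w)\frac{p_{x_2}(w)}{w^{n_2-n_1}}\,dw-\frac1{\lambda(x_1)}\frac1{(2\pi \mathrm i)^2}\oint_{\mathsf C_\lambda}dw\oint_{\mathsf C_0}du\,\psi_{x_1}(w)\,p_{x_2}(u)\,e^{-t(w-u)}\,\frac{w^{n_1-n_2}}{u^{n_2}}\,\frac{w^{n_2}-u^{n_2}}{w-u}.$$ Here $\mathsf C_\lambda$ is any piecewise $C^1$ closed contour with winding number one around $0$ and around each point $\lambda(x)$, $x\ge0$, and $\mathsf C_0$ is any piecewise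 $C^1$ closed contour with winding number one around $0$ that does not meet $\mathsf C_\lambda$ (for example a small counter-clockwise circle around $0$). -/

import Mathlib

open MeasureTheory ProbabilityTheory Filter Topology
open scoped NNReal

/-- The rate function is uniformly bounded away from `0` and `∞`. -/
def UniformlyBounded (lam : ℕ → ℝ) : Prop :=
  ∃ s M : ℝ, 0 < s ∧ ∀ x, s ≤ lam x ∧ lam x ≤ M

/-! ### Gelfand–Tsetlin patterns

An array is a function `x : ℕ → ℕ → ℕ`, where `x n k` is the position of the `k`-th particle on
level `n`, for `1 ≤ k ≤ n`; the entries with other indices are fixed to be `0`. -/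

/-- Interlacing arrays with levels `1, …, N`. -/
structure IsGT (N : ℕ) (x : ℕ → ℕ → ℕ) : Prop where
  support : ∀ n k, ¬ (1 ≤ k ∧ k ≤ n ∧ n ≤ N) → x n k = 0
  strict : ∀ n k, 1 ≤ k → k + 1 ≤ n → n ≤ N → x n k < x n (k + 1)
  interlace : ∀ n k, 1 ≤ k → k ≤ n → n + 1 ≤ N → x (n + 1) k ≤ x n k ∧ x n k < x (n + 1) (k + 1)

/-- Interlacing arrays with levels `1, 2, 3, …`. -/
structure IsGTInf (x : ℕ → ℕ → ℕ) : Prop where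
  support : ∀ n k, ¬ (1 ≤ k ∧ k ≤ n) → x n k = 0
  strict : ∀ n k, 1 ≤ k → k + 1 ≤ n → x n k < x n (k + 1)
  interlace : ∀ n k, 1 ≤ k → k ≤ n → x (n + 1) k ≤ x n k ∧ x n k < x (n + 1) (k + 1)

/-- Gelfand–Tsetlin patterns of length `N`. -/
def GT (N : ℕ) : Type := {x : ℕ → ℕ → ℕ // IsGT N x}

/-- Infinite Gelfand–Tsetlin patterns. -/
def GTInf : Type := {x : ℕ → ℕ → ℕ // IsGTInf x}

/-- `GT N` is countable and carries the discrete `σ`-algebra. -/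
instance (N : ℕ) : MeasurableSpace (GT N) := ⊤

/-- `GTInf` carries the `σ`-algebra generated by the coordinates. -/
instance : MeasurableSpace GTInf :=
  MeasurableSpace.comap Subtype.val (inferInstance : MeasurableSpace (ℕ → ℕ → ℕ))

/-- The projection keeping the levels `1, …, N`. -/
def GTInf.trunc (N : ℕ) (x : GTInf) : GT N :=
  ⟨fun n k => if n ≤ N then x.1 n k else 0, by
    refine ⟨fun n k h => ?_, fun n k h1 h2 h3 => ?_, fun n k h1 h2 h3 => ?_⟩
    · by_cases hn : n ≤ N
      · simpa [hn] using x.2.support n k (fun h' => h ⟨h'.1, h'.2, hn⟩)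
      · simp [hn]
    · simpa [h3] using x.2.strict n k h1 h2
    · simpa [h3, (by omega : n ≤ N)] using x.2.interlace n k h1 h2⟩

/-- The densely packed pattern: level `n` is `(0, 1, …, n - 1)`. -/
def densePacked (N : ℕ) : GT N :=
  ⟨fun n k => if 1 ≤ k ∧ k ≤ n ∧ n ≤ N then k - 1 else 0, by
    refine ⟨fun n k h => if_neg h, fun n k h1 h2 h3 => ?_, fun n k h1 h2 h3 => ?_⟩
    · rw [if_pos (by omega), if_pos (by omega)]; omega
    · rw [if_pos (by omega), if_pos (by omega), if_pos (by omega)]; omega⟩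

/-! ### The push-block dynamics -/

/-- The particles which move when particle `k` on level `n` jumps: this particle itself, and,
whenever particle `j` on level `m` moves and its new position `x m j + 1` is no longer strictly
below particle `j + 1` on level `m + 1`, also that particle. -/
inductive Moves (N : ℕ) (x : ℕ → ℕ → ℕ) (n k : ℕ) : ℕ → ℕ → Prop
  | self : Moves N x n k n k
  | push {m j : ℕ} : Moves N x n k m j → m + 1 ≤ N → ¬ (x m j + 1 < x (m + 1) (j + 1)) →
      Moves N x n k (m + 1) (j + 1)

/-- Particle `k` on level `n` is blocked by particle `k` on level `n - 1` (which exists if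
`k < n`). -/
def Blocked (x : ℕ → ℕ → ℕ) (n k : ℕ) : Prop := k < n ∧ x (n - 1) k = x n k

open Classical in
/-- The array after an unblocked jump of particle `k` on level `n`. -/
noncomputable def pushArray (N : ℕ) (x : ℕ → ℕ → ℕ) (n k : ℕ) : ℕ → ℕ → ℕ :=
  fun m j => if Moves N x n k m j then x m j + 1 else x m j

theorem Moves.range {N : ℕ} {x : ℕ → ℕ → ℕ} {n k m j : ℕ} (hk : 1 ≤ k) (hkn : k ≤ n) (hn : n ≤ N)
    (h : Moves N x n k m j) : 1 ≤ j ∧ j ≤ m ∧ m ≤ N := by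
  induction h with
  | self => exact ⟨hk, hkn, hn⟩
  | push _ h2 _ ih => omega

theorem Moves.not_blocked {N : ℕ} {x : ℕ → ℕ → ℕ} (hx : IsGT N x) {n k m j : ℕ} (hk : 1 ≤ k)
    (hkn : k ≤ n) (hn : n ≤ N) (hb : ¬ Blocked x n k) (h : Moves N x n k m j) :
    j < m → x m j < x (m - 1) j := by
  induction h with
  | self =>
    intro hlt
    have h1 := (hx.interlace (n - 1) k hk (by omega) (by omega)).1
    rw [Nat.sub_add_cancel (by omega)] at h1
    exact lt_of_le_of_ne h1 fun e => hb ⟨hlt, e.symm⟩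
  | @push m j h1 h2 h3 ih =>
    intro hlt
    have hr := h1.range hk hkn hn
    have h4 := ih (by omega)
    have h5 := (hx.interlace (m - 1) j hr.1 (by omega) (by omega)).2
    rw [Nat.sub_add_cancel (by omega)] at h5
    simp only [Nat.add_sub_cancel]
    omega

/-- The push-block rule preserves the interlacing. -/
theorem isGT_pushArray {N : ℕ} {x : ℕ → ℕ → ℕ} (hx : IsGT N x) {n k : ℕ} (hk : 1 ≤ k)
    (hkn : k ≤ n) (hn : n ≤ N) (hb : ¬ Blocked x n k) : IsGT N (pushArray N x n k) := by
  have key : ∀ m j, 1 ≤ j → j ≤ m → m + 1 ≤ N →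
      pushArray N x n k (m + 1) j ≤ pushArray N x n k m j ∧
        pushArray N x n k m j < pushArray N x n k (m + 1) (j + 1) := by
    intro m j hj hjm hm
    have hi := hx.interlace m j hj hjm hm
    constructor
    · by_cases h1 : Moves N x n k (m + 1) j
      · have h2 := h1.not_blocked hx hk hkn hn hb (by omega)
        simp only [Nat.add_sub_cancel] at h2
        simp only [pushArray, if_pos h1]
        split_ifs <;> omega
      · simp only [pushArray, if_neg h1]
        split_ifs <;> omega
    · by_cases h1 : Moves N x n k m j
      · by_cases h2 : Moves N x n k (m + 1) (j + 1)
        · simp only [pushArray, if_pos h1, if_pos h2]; omega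
        · have h3 : x m j + 1 < x (m + 1) (j + 1) := by
            by_contra h3
            exact h2 (h1.push hm h3)
          simpa only [pushArray, if_pos h1, if_neg h2] using h3
      · simp only [pushArray, if_neg h1]
        split_ifs <;> omega
  refine ⟨fun m j h => ?_, fun m j h1 h2 h3 => ?_, key⟩
  · have : ¬ Moves N x n k m j := fun h' => h (h'.range hk hkn hn)
    simpa only [pushArray, if_neg this] using hx.support m j h
  · obtain ⟨m, rfl⟩ : ∃ m', m = m' + 1 := ⟨m - 1, by omega⟩
    have := key m j h1 (by omega) h3
    omega

open Classical in
/-- The pattern after the clock of particle `k` on level `n` has rung. -/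
noncomputable def GT.ring {N : ℕ} (x : GT N) (n k : ℕ) : GT N :=
  if h : (1 ≤ k ∧ k ≤ n ∧ n ≤ N) ∧ ¬ Blocked x.1 n k then
    ⟨pushArray N x.1 n k, isGT_pushArray x.2 h.1.1 h.1.2.1 h.1.2.2 h.2⟩
  else x

/-- The generator of the push-block dynamics on `GT N`: the clock of each particle rings with rate
`lam` evaluated at the current position of the particle. -/
noncomputable def generator (lam : ℕ → ℝ) (N : ℕ) (f : GT N → ℝ) (x : GT N) : ℝ :=
  ∑ n ∈ Finset.Icc 1 N, ∑ k ∈ Finset.Icc 1 n, lam (x.1 n k) * (f (x.ring n k) - f x)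

/-- `X` is a push-block process on `GT N` started from the densely packed pattern: a
right-continuous jump process, which is Markov with the above (bounded) generator with respect to
the filtration `ℱ`, in the sense of the martingale problem. -/
structure IsPushBlockProcess (lam : ℕ → ℝ) (N : ℕ) {Ω : Type*} [mΩ : MeasurableSpace Ω]
    (μ : Measure Ω) (ℱ : Filtration ℝ≥0 mΩ) (X : ℝ≥0 → Ω → GT N) : Prop where
  adapted : ∀ t, Measurable[ℱ t] (X t)
  right_continuous : ∀ ω t, ∀ᶠ s in 𝓝[≥] t, X s ω = X t ω
  start : ∀ᵐ ω ∂μ, X 0 ω = densePacked N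
  martingale : ∀ f : GT N → ℝ, (∃ C, ∀ x, |f x| ≤ C) →
    Martingale (fun (t : ℝ≥0) ω =>
      f (X t ω) - ∫ s in (0 : ℝ)..t, generator lam N f (X s.toNNReal ω)) ℱ μ

/-- `X` is a push-block process on `GTInf` started from the densely packed pattern: its
projections to all `GT N` are push-block processes. -/
def IsPushBlockProcessInf (lam : ℕ → ℝ) {Ω : Type*} [mΩ : MeasurableSpace Ω]
    (μ : Measure Ω) (ℱ : Filtration ℝ≥0 mΩ) (X : ℝ≥0 → Ω → GTInf) : Prop :=
  ∀ N, IsPushBlockProcess lam N μ ℱ (fun t ω => (X t ω).trunc N)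

/-- The evolution (Kolmogorov forward) equation of the push-block dynamics, from the densely packed
pattern, for a family of laws on `GTInf`. -/
def SolvesForwardEquation (lam : ℕ → ℝ) (P : ℝ≥0 → Measure GTInf) : Prop :=
  ∀ (N : ℕ) (f : GT N → ℝ), (∃ C, ∀ x, |f x| ≤ C) → ∀ t : ℝ≥0,
    ∫ x, f (x.trunc N) ∂(P t) = f (densePacked N) +
      ∫ s in (0 : ℝ)..t, ∫ x, generator lam N f (x.trunc N) ∂(P s.toNNReal)

/-- The particle configuration of a pattern: the set of pairs (level, position). -/
def GTInf.particles (x : GTInf) : Set (ℕ × ℕ) :=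
  {z | ∃ k, 1 ≤ k ∧ k ≤ z.1 ∧ x.1 z.1 k = z.2}

/-! ### Contours and the kernel -/

/-- A closed, piecewise continuously differentiable curve, parametrised by `[0, 1]` (in place of
piecewise continuity of the derivative only its integrability is asked for). -/
structure IsContour (γ : ℝ → ℂ) : Prop where
  continuousOn : ContinuousOn γ (Set.Icc 0 1)
  closed : γ 0 = γ 1
  differentiable : ∃ S : Set ℝ, S.Finite ∧ ∀ s ∈ Set.Ioo (0 : ℝ) 1 \ S, DifferentiableAt ℝ γ s
  integrable : IntervalIntegrable (deriv γ) volume 0 1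

/-- `∮_γ f(w) dw`. -/
noncomputable def contourIntegral (γ : ℝ → ℂ) (f : ℂ → ℂ) : ℂ :=
  ∫ s in (0 : ℝ)..1, f (γ s) * deriv γ s

/-- `γ` goes around `z` once, counter-clockwise (its winding number is one). -/
def Encircles (γ : ℝ → ℂ) (z : ℂ) : Prop :=
  z ∉ γ '' Set.Icc 0 1 ∧
    (2 * Real.pi * Complex.I)⁻¹ * contourIntegral γ (fun w => (w - z)⁻¹) = 1

/-- `C` is a contour around `0` and all the points `lam x`, and `C₀` is a contour around `0` which
does not meet `C` (for instance a small circle). -/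
structure AdmissibleContours (lam : ℕ → ℝ) (C C₀ : ℝ → ℂ) : Prop where
  isContour : IsContour C
  encircles_zero : Encircles C 0
  encircles : ∀ x, Encircles C (lam x)
  isContour₀ : IsContour C₀
  encircles₀ : Encircles C₀ 0
  disjoint : Disjoint (C '' Set.Icc 0 1) (C₀ '' Set.Icc 0 1)

/-- `ψ_x(w) = ∏_{k=0}^{x} λ(k) / (λ(k) - w)`. -/
noncomputable def psi (lam : ℕ → ℝ) (x : ℕ) (w : ℂ) : ℂ :=
  ∏ k ∈ Finset.range (x + 1), (lam k : ℂ) / (lam k - w)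

/-- `p_x(w) = ∏_{k=0}^{x-1} (λ(k) - w) / λ(k)`. -/
noncomputable def pPoly (lam : ℕ → ℝ) (x : ℕ) (w : ℂ) : ℂ :=
  ∏ k ∈ Finset.range x, ((lam k : ℂ) - w) / lam k

/-- The correlation kernel `K_t(n₁, x₁; n₂, x₂)`, with `z₁ = (n₁, x₁)` and `z₂ = (n₂, x₂)`. -/
noncomputable def corrKernel (lam : ℕ → ℝ) (C C₀ : ℝ → ℂ) (t : ℝ) (z₁ z₂ : ℕ × ℕ) : ℂ :=
  (if z₁.1 < z₂.1 then
    1 / (lam z₁.2 : ℂ) * (1 / (2 * Real.pi * Complex.I)) *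
      contourIntegral C (fun w => psi lam z₁.2 w * (pPoly lam z₂.2 w / w ^ (z₂.1 - z₁.1)))
  else 0) -
  1 / (lam z₁.2 : ℂ) * (1 / (2 * Real.pi * Complex.I) ^ 2) *
    contourIntegral C (fun w => contourIntegral C₀ (fun u =>
      psi lam z₁.2 w * pPoly lam z₂.2 u * Complex.exp (-(t : ℂ) * (w - u)) *
        (w ^ ((z₁.1 : ℤ) - (z₂.1 : ℤ)) / u ^ z₂.1) *
        ((w ^ z₂.1 - u ^ z₂.1) / (w - u))))

/-! ### Contour integrals -/

/-! The law on `GT N` at time `t` is explicit (`gtDensity`): the product of `1 / λ` over all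
particles, times the determinant over the top row of functions `φ_m` (`birthFun`), `m = 0, …, N -
1`. The rest of the argument shows that this guess solves the forward equation, and computes its
generating function.

Dynamics. An incoming transition of a pattern is encoded by the last particle that moved
(`sum_incoming`). Along a push chain each particle lands where the next one stood, so the jump rate
times the product of inverse rates telescopes to the rate of the last mover
(`IsPush.invRateProd_eq`). Gains from the lower levels then cancel against losses from unblocked
particles (`sum_removable_add_top`). What remains is a sum over the top row, which is the time
derivative of the determinant, since each `φ_m` solves a pure birth equation with rates `λ`
(`birthFun_succ`, `hasDerivAt_birthFun`).

Correlations. Tilt the weight of each chosen point by `1 + s`. Summing over the levels below the top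
gives a determinant of functions `A` (`sum_gtFiber`), because a sum over interlacing rows is a
difference of neighbouring columns. Cauchy–Binet for the top row then turns the generating function
into the determinant of pairings of `A` with `φ`. Untilted, `A` consists of the Taylor coefficients
of `p_x(u) e^{tu}`, which are biorthogonal to `φ` (`tendsto_taylorCoeff_mul_birthFun`). The tilt
adds sources at the chosen points, propagated upwards by a strictly triangular kernel `T`
(`rowFun_tiltedWeight`): `A = c + s A T`. Hence the generating function is `det (1 + s A γ) = det (1
+ s (γ c - T))` by `det_one_add_of_eq_add`, and `γ c - T` is the kernel of the theorem once its
double integral is separated by a geometric sum (`corrKernel_eq`). With no points chosen this says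
that the total mass is one. Rescaling and letting `s → ∞` isolates the event that all points are
occupied.

From density to process. A transition increases the sum of the coordinates, so the forward equation
is triangular. This gives positivity of the density and uniqueness among probability solutions.
Uniqueness identifies the law of every push-block process and makes the laws for different `N`
consistent; an Ionescu-Tulcea construction then produces the measure on infinite patterns.

All contours are reduced to circles around the origin, because the integrands have finitely many
poles, all encircled once. -/

theorem IsContour.intervalIntegrable {γ : ℝ → ℂ} (hγ : IsContour γ) {f : ℂ → ℂ}
    (hf : ContinuousOn f (γ '' Set.Icc 0 1)) :
    IntervalIntegrable (fun s => f (γ s) * deriv γ s) volume 0 1 := by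
  refine hγ.integrable.continuousOn_mul ?_
  rw [Set.uIcc_of_le zero_le_one]
  exact hf.comp hγ.continuousOn (Set.mapsTo_image _ _)

theorem contourIntegral_congr {γ : ℝ → ℂ} {f g : ℂ → ℂ}
    (h : ∀ w ∈ γ '' Set.Icc 0 1, f w = g w) : contourIntegral γ f = contourIntegral γ g := by
  refine intervalIntegral.integral_congr fun s hs => ?_
  rw [Set.uIcc_of_le zero_le_one] at hs
  simp only [h _ (Set.mem_image_of_mem γ hs)]

theorem IsContour.integral_add {γ : ℝ → ℂ} (hγ : IsContour γ) {f g : ℂ → ℂ}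
    (hf : ContinuousOn f (γ '' Set.Icc 0 1)) (hg : ContinuousOn g (γ '' Set.Icc 0 1)) :
    contourIntegral γ (fun w => f w + g w) = contourIntegral γ f + contourIntegral γ g := by
  rw [contourIntegral, contourIntegral, contourIntegral,
    ← intervalIntegral.integral_add (hγ.intervalIntegrable hf) (hγ.intervalIntegrable hg)]
  simp only [add_mul]

theorem contourIntegral_const_mul (γ : ℝ → ℂ) (c : ℂ) (f : ℂ → ℂ) :
    contourIntegral γ (fun w => c * f w) = c * contourIntegral γ f := by
  rw [contourIntegral, contourIntegral, ← intervalIntegral.integral_const_mul]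
  simp only [mul_assoc]

theorem IsContour.integral_sum {γ : ℝ → ℂ} (hγ : IsContour γ) {ι : Type*} (s : Finset ι)
    {f : ι → ℂ → ℂ} (hf : ∀ i ∈ s, ContinuousOn (f i) (γ '' Set.Icc 0 1)) :
    contourIntegral γ (fun w => ∑ i ∈ s, f i w) = ∑ i ∈ s, contourIntegral γ (f i) := by
  simp only [contourIntegral, Finset.sum_mul]
  exact intervalIntegral.integral_finsetSum fun i hi => hγ.intervalIntegrable (hf i hi)

theorem IsContour.integral_sum_const_mul {γ : ℝ → ℂ} (hγ : IsContour γ) {ι : Type*} (s : Finset ι)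
    (c : ι → ℂ) {f : ι → ℂ → ℂ} (hf : ∀ i ∈ s, ContinuousOn (f i) (γ '' Set.Icc 0 1)) :
    contourIntegral γ (fun w => ∑ i ∈ s, c i * f i w) = ∑ i ∈ s, c i * contourIntegral γ (f i) := by
  simp only [← contourIntegral_const_mul]
  exact hγ.integral_sum s fun i hi => continuousOn_const.mul (hf i hi)

/-- The fundamental theorem of calculus along the curve, which tolerates the finitely many corners.
It is the only integration theorem used on general contours. -/
theorem IsContour.integral_eq_zero_of_hasDerivAt {γ : ℝ → ℂ} (hγ : IsContour γ) {F f : ℂ → ℂ}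
    (hF : ∀ w ∈ γ '' Set.Icc 0 1, HasDerivAt F (f w) w) (hf : ContinuousOn f (γ '' Set.Icc 0 1)) :
    contourIntegral γ f = 0 := by
  obtain ⟨S, hS, hd⟩ := hγ.differentiable
  have h := integral_eq_of_hasDerivAt_off_countable_of_le (fun s => F (γ s))
    (fun s => f (γ s) * deriv γ s) zero_le_one hS.countable ?_ ?_ (hγ.intervalIntegrable hf)
  · rw [contourIntegral, h, hγ.closed, sub_self]
  · have : ContinuousOn F (γ '' Set.Icc 0 1) := fun w hw => (hF w hw).continuousAt.continuousWithinAt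
    exact this.comp hγ.continuousOn (Set.mapsTo_image _ _)
  · intro s hs
    have h1 := hF (γ s) (Set.mem_image_of_mem γ (Set.Ioo_subset_Icc_self hs.1))
    exact h1.comp_of_eq s (hd s hs).hasDerivAt rfl |>.congr_deriv (by ring)

theorem IsContour.integral_entire {γ : ℝ → ℂ} (hγ : IsContour γ) {f : ℂ → ℂ}
    (hf : Differentiable ℂ f) : contourIntegral γ f = 0 := by
  obtain ⟨F, hF⟩ := hf.isExactOn_univ
  exact hγ.integral_eq_zero_of_hasDerivAt (fun w _ => hF w (Set.mem_univ w))
    hf.continuous.continuousOn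

theorem Encircles.integral_inv {γ : ℝ → ℂ} {z : ℂ} (h : Encircles γ z) :
    contourIntegral γ (fun w => (w - z)⁻¹) = 2 * Real.pi * Complex.I := by
  have := h.2
  rwa [inv_mul_eq_iff_eq_mul₀ Complex.two_pi_I_ne_zero, mul_one] at this

theorem continuousOn_prod_inv {γ : ℝ → ℂ} {L : List ℂ} (hL : ∀ a ∈ L, a ∉ γ '' Set.Icc 0 1) :
    ContinuousOn (fun w => (L.map fun a => (w - a)⁻¹).prod) (γ '' Set.Icc 0 1) := by
  induction L with
  | nil => simpa using continuousOn_const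
  | cons a L ih =>
    simp only [List.map_cons, List.prod_cons]
    refine ContinuousOn.mul ?_ (ih fun b hb => hL b (List.mem_cons_of_mem _ hb))
    refine ContinuousOn.inv₀ (by fun_prop) fun w hw h => ?_
    rw [sub_eq_zero] at h
    exact hL a List.mem_cons_self (h ▸ hw)

theorem IsContour.integral_sub_inv_pow {γ : ℝ → ℂ} (hγ : IsContour γ) {a : ℂ}
    (ha : a ∉ γ '' Set.Icc 0 1) (n : ℕ) :
    contourIntegral γ (fun w => ((w - a)⁻¹) ^ (n + 2)) = 0 := by
  have hne : ∀ w ∈ γ '' Set.Icc 0 1, w - a ≠ 0 := fun w hw h =>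
    ha (sub_eq_zero.1 h ▸ hw)
  refine hγ.integral_eq_zero_of_hasDerivAt
    (F := fun w => -((n : ℂ) + 1)⁻¹ * ((w - a)⁻¹) ^ (n + 1)) (fun w hw => ?_) ?_
  · have h0 : ((n : ℂ) + 1) ≠ 0 := by exact_mod_cast Nat.succ_ne_zero n
    have h1 := ((((hasDerivAt_id w).sub_const a).inv (hne w hw)).pow (n + 1)).const_mul
      (-((n : ℂ) + 1)⁻¹)
    refine h1.congr_deriv ?_
    have := hne w hw
    simp only [id, Nat.add_sub_cancel, Nat.cast_add, Nat.cast_one, Pi.inv_apply, pow_add]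
    generalize (w - a)⁻¹ ^ n = q
    field_simp
  · refine ContinuousOn.pow (ContinuousOn.inv₀ (by fun_prop) hne) _

/-- The integral of a function with finitely many poles is the same for all contours which go
around these poles once. -/
theorem contourIntegral_prod_inv_eq {γ γ' : ℝ → ℂ} (hγ : IsContour γ) (hγ' : IsContour γ') (n : ℕ) :
    ∀ (L : List ℂ), L.length = n → (∀ a ∈ L, Encircles γ a) → (∀ a ∈ L, Encircles γ' a) →
    ∀ E : ℂ → ℂ, Differentiable ℂ E →
      contourIntegral γ (fun w => E w * (L.map fun a => (w - a)⁻¹).prod) =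
        contourIntegral γ' (fun w => E w * (L.map fun a => (w - a)⁻¹).prod) := by
  induction n using Nat.strong_induction_on with
  | _ n ih =>
  intro L hn h1 h2 E hE
  rcases L with _ | ⟨a, L⟩
  · simp [hγ.integral_entire hE, hγ'.integral_entire hE]
  have hLn : L.length < n := by simp at hn; omega
  -- Writing `E w = E a + (w - a) * dslope E a w` splits off a constant numerator; the other term
  -- has one pole fewer and again an entire numerator.
  have key : ∀ {η : ℝ → ℂ}, IsContour η → (∀ b ∈ a :: L, Encircles η b) →
      contourIntegral η (fun w => E w * ((a :: L).map fun a => (w - a)⁻¹).prod) =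
        E a * contourIntegral η (fun w => ((a :: L).map fun a => (w - a)⁻¹).prod) +
        contourIntegral η (fun w => dslope E a w * (L.map fun a => (w - a)⁻¹).prod) := by
    intro η hη h
    rw [← contourIntegral_const_mul, ← hη.integral_add]
    · refine contourIntegral_congr fun w hw => ?_
      have hwa : w - a ≠ 0 := fun h' =>
        (h a List.mem_cons_self).1 (sub_eq_zero.1 h' ▸ hw)
      have h3 : E w = E a + (w - a) * dslope E a w := by
        have := sub_smul_dslope E a w
        rw [smul_eq_mul] at this
        rw [this]; ring
      rw [h3]
      simp only [List.map_cons, List.prod_cons]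
      field_simp
    · exact continuousOn_const.mul (continuousOn_prod_inv fun b hb => (h b hb).1)
    · refine ContinuousOn.mul ?_ (continuousOn_prod_inv fun b hb =>
        (h b (List.mem_cons_of_mem _ hb)).1)
      exact (((Complex.differentiableOn_dslope (univ_mem : Set.univ ∈ 𝓝 a)).2
        hE.differentiableOn).continuousOn).mono (Set.subset_univ _)
  rw [key hγ h1, key hγ' h2]
  congr 1
  swap
  · refine ih L.length hLn L rfl (fun b hb => h1 b (List.mem_cons_of_mem _ hb))
      (fun b hb => h2 b (List.mem_cons_of_mem _ hb)) _ ?_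
    rw [← differentiableOn_univ]
    exact (Complex.differentiableOn_dslope univ_mem).2 hE.differentiableOn
  congr 1
  -- With a constant numerator and a single pole point, order one is the winding number and higher
  -- orders have a primitive. Two distinct pole points are handled by partial fractions.
  by_cases hall : ∀ b ∈ L, b = a
  · have hL : L = List.replicate L.length a := List.eq_replicate_iff.2 ⟨rfl, hall⟩
    rcases hl : L.length with _ | m
    · have : L = [] := List.length_eq_zero_iff.1 hl
      subst this
      simp only [List.map_cons, List.map_nil, List.prod_cons, List.prod_nil, mul_one]
      rw [(h1 a List.mem_cons_self).integral_inv, (h2 a List.mem_cons_self).integral_inv]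
    · have h3 : ∀ w : ℂ, ((a :: L).map fun a => (w - a)⁻¹).prod = ((w - a)⁻¹) ^ (m + 2) := by
        intro w
        rw [hL, hl]
        simp only [List.map_cons, List.map_replicate, List.prod_cons, List.prod_replicate]
        rw [← pow_succ']
      simp only [h3]
      rw [hγ.integral_sub_inv_pow (h1 a List.mem_cons_self).1,
        hγ'.integral_sub_inv_pow (h2 a List.mem_cons_self).1]
  · push Not at hall
    obtain ⟨b, hb, hba⟩ := hall
    have hperm : L.Perm (b :: L.erase b) := List.perm_cons_erase hb
    have hlen : (L.erase b).length + 1 = L.length := by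
      simpa using hperm.length_eq.symm
    have hab : a - b ≠ 0 := sub_ne_zero.2 hba.symm
    -- Partial fractions, `1 / ((w - a) (w - b)) = (a - b)⁻¹ (1 / (w - a) - 1 / (w - b))`: both
    -- terms have fewer poles.
    have key2 : ∀ {η : ℝ → ℂ}, IsContour η → (∀ b ∈ a :: L, Encircles η b) →
        contourIntegral η (fun w => ((a :: L).map fun a => (w - a)⁻¹).prod) =
        contourIntegral η (fun w => (a - b)⁻¹ * ((a :: L.erase b).map fun a => (w - a)⁻¹).prod) +
        contourIntegral η (fun w => -(a - b)⁻¹ * (L.map fun a => (w - a)⁻¹).prod) := by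
      intro η hη h
      rw [← hη.integral_add]
      · refine contourIntegral_congr fun w hw => ?_
        have hwa : w - a ≠ 0 := fun h' =>
          (h a List.mem_cons_self).1 (sub_eq_zero.1 h' ▸ hw)
        have hwb : w - b ≠ 0 := fun h' =>
          (h b (List.mem_cons_of_mem _ hb)).1 (sub_eq_zero.1 h' ▸ hw)
        have h3 : (L.map fun a => (w - a)⁻¹).prod =
            (w - b)⁻¹ * ((L.erase b).map fun a => (w - a)⁻¹).prod := by
          rw [(hperm.map fun a => (w - a)⁻¹).prod_eq, List.map_cons, List.prod_cons]
        simp only [List.map_cons, List.prod_cons, h3]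
        field_simp
        ring
      · refine continuousOn_const.mul (continuousOn_prod_inv fun c hc => (h c ?_).1)
        rcases List.mem_cons.1 hc with rfl | hc
        · exact List.mem_cons_self
        · exact List.mem_cons_of_mem _ (List.mem_of_mem_erase hc)
      · exact continuousOn_const.mul (continuousOn_prod_inv fun c hc =>
          (h c (List.mem_cons_of_mem _ hc)).1)
    have hsub : ∀ c ∈ a :: L.erase b, c ∈ a :: L := fun c hc => by
      rcases List.mem_cons.1 hc with rfl | hc
      · exact List.mem_cons_self
      · exact List.mem_cons_of_mem _ (List.mem_of_mem_erase hc)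
    rw [key2 hγ h1, key2 hγ' h2]
    congr 1
    · exact ih _ (by simp at hn ⊢; omega) _ rfl (fun c hc => h1 c (hsub c hc))
        (fun c hc => h2 c (hsub c hc)) _ (differentiable_const _)
    · exact ih _ hLn L rfl (fun c hc => h1 c (List.mem_cons_of_mem _ hc))
        (fun c hc => h2 c (List.mem_cons_of_mem _ hc)) _ (differentiable_const _)

/-- The circle of radius `R` around the origin. -/
noncomputable def circleContour (R : ℝ) (s : ℝ) : ℂ := circleMap 0 R (2 * Real.pi * s)

theorem hasDerivAt_circleContour (R s : ℝ) :
    HasDerivAt (circleContour R) ((2 * Real.pi : ℝ) * deriv (circleMap 0 R) (2 * Real.pi * s)) s := by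
  have h := (differentiable_circleMap 0 R (2 * Real.pi * s)).hasDerivAt.scomp s
    ((hasDerivAt_id s).const_mul (2 * Real.pi))
  have e : circleContour R = fun s => circleMap 0 R (2 * Real.pi * s) := rfl
  rw [e]
  simpa [Function.comp_def] using h

theorem contourIntegral_circleContour (R : ℝ) (f : ℂ → ℂ) :
    contourIntegral (circleContour R) f = ∮ z in C(0, R), f z := by
  rw [contourIntegral, circleIntegral]
  have h := intervalIntegral.smul_integral_comp_mul_left
    (f := fun θ => deriv (circleMap 0 R) θ • f (circleMap 0 R θ)) (a := 0) (b := 1)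
    (2 * Real.pi)
  rw [mul_zero, mul_one] at h
  rw [← h, ← intervalIntegral.integral_smul]
  refine intervalIntegral.integral_congr fun s _ => ?_
  simp only [(hasDerivAt_circleContour R s).deriv]
  simp only [circleContour, smul_eq_mul, Complex.real_smul]
  ring

theorem isContour_circleContour (R : ℝ) : IsContour (circleContour R) where
  continuousOn := fun s _ => (hasDerivAt_circleContour R s).continuousAt.continuousWithinAt
  closed := by
    simp [circleContour, circleMap]
  differentiable := ⟨∅, Set.finite_empty, fun s _ => (hasDerivAt_circleContour R s).differentiableAt⟩
  integrable := by
    have : deriv (circleContour R) =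
        fun s => (2 * Real.pi : ℝ) * deriv (circleMap 0 R) (2 * Real.pi * s) :=
      funext fun s => (hasDerivAt_circleContour R s).deriv
    rw [this]
    refine Continuous.intervalIntegrable ?_ _ _
    simp only [deriv_circleMap]
    fun_prop

theorem norm_of_mem_circleContour {R : ℝ} (hR : 0 ≤ R) {w : ℂ}
    (hw : w ∈ circleContour R '' Set.Icc 0 1) : ‖w‖ = R := by
  obtain ⟨s, -, rfl⟩ := hw
  simp [circleContour, abs_of_nonneg hR]

theorem encircles_circleContour {R : ℝ} {z : ℂ} (hz : ‖z‖ < R) : Encircles (circleContour R) z := by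
  refine ⟨fun h => ?_, ?_⟩
  · exact absurd (norm_of_mem_circleContour ((norm_nonneg z).trans hz.le) h) hz.ne
  · rw [contourIntegral_circleContour, circleIntegral.integral_sub_inv_of_mem_ball (by simpa using hz)]
    exact inv_mul_cancel₀ Complex.two_pi_I_ne_zero

/-! ### Functions whose poles are at `0` and the points `lam x` -/

/-- `f` is, off `0` and the points `lam x`, the quotient of an entire function and a product of
linear factors vanishing at some of these points. -/
def HasPolesIn (lam : ℕ → ℝ) (f : ℂ → ℂ) : Prop :=
  ∃ (L : List ℂ) (E : ℂ → ℂ), (∀ a ∈ L, a = 0 ∨ ∃ x, a = lam x) ∧ Differentiable ℂ E ∧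
    ∀ w : ℂ, w ≠ 0 → (∀ x, w ≠ lam x) → f w = E w * (L.map fun a => (w - a)⁻¹).prod

/-- `γ` goes once around `0` and all points `lam x`. -/
structure EncirclesPoles (lam : ℕ → ℝ) (γ : ℝ → ℂ) : Prop where
  isContour : IsContour γ
  encircles_zero : Encircles γ 0
  encircles : ∀ x, Encircles γ (lam x)

namespace HasPolesIn

variable {lam : ℕ → ℝ} {f g : ℂ → ℂ}

theorem of_entire (hf : Differentiable ℂ f) : HasPolesIn lam f :=
  ⟨[], f, by simp, hf, by simp⟩

theorem mul (hf : HasPolesIn lam f) (hg : HasPolesIn lam g) :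
    HasPolesIn lam (fun w => f w * g w) := by
  obtain ⟨L, E, h1, h2, h3⟩ := hf
  obtain ⟨L', E', h1', h2', h3'⟩ := hg
  refine ⟨L ++ L', fun w => E w * E' w, fun a ha => ?_, h2.mul h2', fun w h0 hw => ?_⟩
  · rcases List.mem_append.1 ha with h | h
    exacts [h1 a h, h1' a h]
  · beta_reduce
    rw [h3 w h0 hw, h3' w h0 hw, List.map_append, List.prod_append]
    ring

theorem inv_id : HasPolesIn lam (fun w => w⁻¹) :=
  ⟨[0], fun _ => 1, by simp, differentiable_const _, by simp⟩

theorem pow (hf : HasPolesIn lam f) (n : ℕ) : HasPolesIn lam (fun w => f w ^ n) := by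
  induction n with
  | zero => simpa using of_entire (differentiable_const _)
  | succ n ih => simpa only [pow_succ] using ih.mul hf

theorem zpow (m : ℤ) : HasPolesIn lam (fun w => w ^ m) := by
  rcases m with n | n
  · simpa using of_entire (f := fun w => w ^ n) (by fun_prop)
  · simpa only [zpow_negSucc, inv_pow] using (inv_id (lam := lam)).pow (n + 1)

theorem factor (k : ℕ) : HasPolesIn lam (fun w => (lam k : ℂ) / (lam k - w)) := by
  refine ⟨[(lam k : ℂ)], fun _ => -(lam k : ℂ), by simp, differentiable_const _, fun w _ h => ?_⟩
  have h1 : w - lam k ≠ 0 := sub_ne_zero.2 (h k)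
  have h2 : (lam k : ℂ) - w ≠ 0 := sub_ne_zero.2 (h k).symm
  simp only [List.map_cons, List.map_nil, List.prod_cons, List.prod_nil, mul_one]
  rw [← neg_sub, div_neg, div_eq_mul_inv, neg_mul]

theorem prod {ι : Type*} (s : Finset ι) {F : ι → ℂ → ℂ} (h : ∀ i ∈ s, HasPolesIn lam (F i)) :
    HasPolesIn lam (fun w => ∏ i ∈ s, F i w) := by
  classical
  induction s using Finset.induction_on with
  | empty => simpa using of_entire (differentiable_const _)
  | insert a s ha ih =>
    simp only [Finset.prod_insert ha]
    exact (h a (Finset.mem_insert_self a s)).mul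
      (ih fun i hi => h i (Finset.mem_insert_of_mem hi))

theorem ne_of_mem {γ : ℝ → ℂ} (hγ : EncirclesPoles lam γ) {w : ℂ} (hw : w ∈ γ '' Set.Icc 0 1) :
    w ≠ 0 ∧ ∀ x, w ≠ lam x :=
  ⟨fun h => hγ.encircles_zero.1 (h ▸ hw), fun x h => (hγ.encircles x).1 (h ▸ hw)⟩

theorem continuousOn (hf : HasPolesIn lam f) {γ : ℝ → ℂ} (hγ : EncirclesPoles lam γ) :
    ContinuousOn f (γ '' Set.Icc 0 1) := by
  obtain ⟨L, E, h1, h2, h3⟩ := hf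
  refine ContinuousOn.congr (f := fun w => E w * (L.map fun a => (w - a)⁻¹).prod) ?_
    fun w hw => h3 w (ne_of_mem hγ hw).1 (ne_of_mem hγ hw).2
  refine h2.continuous.continuousOn.mul (continuousOn_prod_inv fun a ha => ?_)
  rcases h1 a ha with rfl | ⟨x, rfl⟩
  exacts [hγ.encircles_zero.1, (hγ.encircles x).1]

theorem integral_eq (hf : HasPolesIn lam f) {γ γ' : ℝ → ℂ} (hγ : EncirclesPoles lam γ)
    (hγ' : EncirclesPoles lam γ') : contourIntegral γ f = contourIntegral γ' f := by
  obtain ⟨L, E, h1, h2, h3⟩ := hf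
  rw [contourIntegral_congr fun w hw => h3 w (ne_of_mem hγ hw).1 (ne_of_mem hγ hw).2,
    contourIntegral_congr fun w hw => h3 w (ne_of_mem hγ' hw).1 (ne_of_mem hγ' hw).2]
  refine contourIntegral_prod_inv_eq hγ.isContour hγ'.isContour _ L rfl (fun a ha => ?_)
    (fun a ha => ?_) E h2
  · rcases h1 a ha with rfl | ⟨x, rfl⟩
    exacts [hγ.encircles_zero, hγ.encircles x]
  · rcases h1 a ha with rfl | ⟨x, rfl⟩
    exacts [hγ'.encircles_zero, hγ'.encircles x]

end HasPolesIn

/-! ### Residue sums -/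

/-- The supremum of the rates. -/
noncomputable def rateSup (lam : ℕ → ℝ) : ℝ := ⨆ x, lam x

theorem UniformlyBounded.pos {lam : ℕ → ℝ} (h : UniformlyBounded lam) (x : ℕ) : 0 < lam x := by
  obtain ⟨s, M, hs, h⟩ := h
  exact hs.trans_le (h x).1

theorem UniformlyBounded.le_rateSup {lam : ℕ → ℝ} (h : UniformlyBounded lam) (x : ℕ) :
    lam x ≤ rateSup lam := by
  obtain ⟨s, M, hs, h⟩ := h
  exact le_ciSup ⟨M, Set.forall_mem_range.2 fun y => (h y).2⟩ x

theorem UniformlyBounded.rateSup_pos {lam : ℕ → ℝ} (h : UniformlyBounded lam) :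
    0 < rateSup lam := (h.pos 0).trans_le (h.le_rateSup 0)

theorem UniformlyBounded.ne_zero {lam : ℕ → ℝ} (h : UniformlyBounded lam) (x : ℕ) :
    (lam x : ℂ) ≠ 0 := by exact_mod_cast (h.pos x).ne'

theorem UniformlyBounded.encirclesPoles {lam : ℕ → ℝ} (h : UniformlyBounded lam) {R : ℝ}
    (hR : rateSup lam < R) : EncirclesPoles lam (circleContour R) where
  isContour := isContour_circleContour R
  encircles_zero := encircles_circleContour (by simpa using h.rateSup_pos.trans hR)
  encircles x := encircles_circleContour (by
    rw [Complex.norm_real, Real.norm_eq_abs, abs_of_pos (h.pos x)]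
    exact (h.le_rateSup x).trans_lt hR)

/-- The sum of the residues at `0` and the points `lam x`. -/
noncomputable def residueSum (lam : ℕ → ℝ) (f : ℂ → ℂ) : ℂ :=
  (2 * Real.pi * Complex.I)⁻¹ * contourIntegral (circleContour (3 * rateSup lam)) f

theorem UniformlyBounded.encirclesPoles_three {lam : ℕ → ℝ} (h : UniformlyBounded lam) :
    EncirclesPoles lam (circleContour (3 * rateSup lam)) :=
  h.encirclesPoles (by linarith [h.rateSup_pos])

theorem HasPolesIn.contourIntegral_eq {lam : ℕ → ℝ} (h : UniformlyBounded lam) {f : ℂ → ℂ}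
    (hf : HasPolesIn lam f) {γ : ℝ → ℂ} (hγ : EncirclesPoles lam γ) :
    contourIntegral γ f = 2 * Real.pi * Complex.I * residueSum lam f := by
  rw [residueSum, mul_inv_cancel_left₀ Complex.two_pi_I_ne_zero,
    hf.integral_eq hγ h.encirclesPoles_three]

section
variable {lam : ℕ → ℝ} {f g : ℂ → ℂ}

theorem residueSum_const_mul (c : ℂ) : residueSum lam (fun w => c * f w) = c * residueSum lam f := by
  rw [residueSum, contourIntegral_const_mul, residueSum]; ring

theorem residueSum_add (h : UniformlyBounded lam) (hf : HasPolesIn lam f) (hg : HasPolesIn lam g) :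
    residueSum lam (fun w => f w + g w) = residueSum lam f + residueSum lam g := by
  rw [residueSum, (isContour_circleContour _).integral_add (hf.continuousOn h.encirclesPoles_three)
    (hg.continuousOn h.encirclesPoles_three), mul_add, residueSum, residueSum]

theorem residueSum_sub (h : UniformlyBounded lam) (hf : HasPolesIn lam f) (hg : HasPolesIn lam g) :
    residueSum lam (fun w => f w - g w) = residueSum lam f - residueSum lam g := by
  have h1 := residueSum_add h hf ((HasPolesIn.of_entire (differentiable_const (-1))).mul hg)
  rw [residueSum_const_mul] at h1
  rw [sub_eq_add_neg, ← neg_one_mul, ← h1]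
  congr 1; ext w; ring

theorem residueSum_congr (h : UniformlyBounded lam)
    (hfg : ∀ w : ℂ, w ≠ 0 → (∀ x, w ≠ lam x) → f w = g w) : residueSum lam f = residueSum lam g := by
  rw [residueSum, residueSum]
  congr 1
  exact contourIntegral_congr fun w hw =>
    hfg w (HasPolesIn.ne_of_mem h.encirclesPoles_three hw).1
      (HasPolesIn.ne_of_mem h.encirclesPoles_three hw).2

theorem residueSum_entire (hf : Differentiable ℂ f) : residueSum lam f = 0 := by
  rw [residueSum, (isContour_circleContour _).integral_entire hf, mul_zero]

theorem residueSum_inv_id (h : UniformlyBounded lam) : residueSum lam (fun w => w⁻¹) = 1 := by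
  have := h.encirclesPoles_three.encircles_zero.2
  simpa [residueSum] using this

theorem residueSum_div_id (h : UniformlyBounded lam) (hf : Differentiable ℂ f) :
    residueSum lam (fun w => f w * w⁻¹) = f 0 := by
  have hd : Differentiable ℂ (dslope f 0) := by
    rw [← differentiableOn_univ]
    exact (Complex.differentiableOn_dslope univ_mem).2 hf.differentiableOn
  rw [residueSum_congr (g := fun w => f 0 * w⁻¹ + dslope f 0 w) h,
    residueSum_add h ((HasPolesIn.of_entire (differentiable_const _)).mul HasPolesIn.inv_id)
      (HasPolesIn.of_entire hd), residueSum_entire hd, residueSum_const_mul, residueSum_inv_id h]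
  · ring
  · intro w hw _
    have := sub_smul_dslope f 0 w
    rw [smul_eq_mul, sub_zero] at this
    rw [← sub_eq_iff_eq_add', ← sub_mul, ← this]
    field_simp

theorem norm_residueSum_le (h : UniformlyBounded lam) {R : ℝ} (hR : rateSup lam < R)
    (hf : HasPolesIn lam f) {B : ℝ} (hB : ∀ w : ℂ, ‖w‖ = R → ‖f w‖ ≤ B) :
    ‖residueSum lam f‖ ≤ R * B := by
  have hR0 : 0 ≤ R := (h.rateSup_pos.trans hR).le
  have h1 : residueSum lam f = (2 * Real.pi * Complex.I)⁻¹ • ∮ z in C(0, R), f z := by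
    rw [← contourIntegral_circleContour, hf.contourIntegral_eq h (h.encirclesPoles hR), smul_eq_mul,
      inv_mul_cancel_left₀ Complex.two_pi_I_ne_zero]
  rw [h1]
  exact circleIntegral.norm_two_pi_i_inv_smul_integral_le_of_norm_le_const hR0
    fun z hz => hB z (by simpa using hz)

/-- The residue sum can be computed on any circle of radius `R` beyond the poles, where it is at
most `R * (B / R ^ 2)`; let `R → ∞`. -/
theorem residueSum_eq_zero_of_decay (h : UniformlyBounded lam) (hf : HasPolesIn lam f) (B : ℝ)
    (hB : ∀ R : ℝ, 2 * rateSup lam ≤ R → ∀ w : ℂ, ‖w‖ = R → ‖f w‖ ≤ B / R ^ 2) :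
    residueSum lam f = 0 := by
  have hM := h.rateSup_pos
  have h1 : ∀ᶠ R : ℝ in atTop, ‖residueSum lam f‖ ≤ B / R := by
    filter_upwards [eventually_ge_atTop (2 * rateSup lam)] with R hR
    have hR0 : 0 < R := by linarith
    refine (norm_residueSum_le h (by linarith) hf (hB R hR)).trans (le_of_eq ?_)
    field_simp
  have h2 : Tendsto (fun R : ℝ => B / R) atTop (𝓝 0) := tendsto_const_nhds.div_atTop tendsto_id
  exact norm_le_zero_iff.1 (ge_of_tendsto h2 h1)

/-- The derivative of `exp (a w) w^{-(i+1)}` integrates to zero, which relates the pole orders `i +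
1` and `i + 2`. -/
theorem residueSum_exp_mul_inv_pow (h : UniformlyBounded lam) (a : ℂ) (i : ℕ) :
    residueSum lam (fun w => Complex.exp (a * w) * (w⁻¹) ^ (i + 1)) = a ^ i / i.factorial := by
  have hexp : Differentiable ℂ fun w => Complex.exp (a * w) := by fun_prop
  induction i with
  | zero => simpa using residueSum_div_id h hexp
  | succ i ih =>
    have h1 : residueSum lam (fun w => a * (Complex.exp (a * w) * (w⁻¹) ^ (i + 1)) +
        -((i : ℂ) + 1) * (Complex.exp (a * w) * (w⁻¹) ^ (i + 1 + 1))) = 0 := by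
      rw [residueSum, (isContour_circleContour _).integral_eq_zero_of_hasDerivAt
        (F := fun w => Complex.exp (a * w) * (w⁻¹) ^ (i + 1)), mul_zero]
      · intro w hw
        have hw0 := (HasPolesIn.ne_of_mem h.encirclesPoles_three hw).1
        have h2 := (((hasDerivAt_id w).const_mul a).cexp).mul ((hasDerivAt_inv hw0).pow (i + 1))
        refine h2.congr_deriv ?_
        simp only [id, Nat.add_sub_cancel, Nat.cast_add, Nat.cast_one, pow_succ, Pi.pow_apply]
        generalize (w⁻¹) ^ i = q
        field_simp
      · exact ContinuousOn.add
          (((HasPolesIn.of_entire (differentiable_const a)).mul ((HasPolesIn.of_entire hexp).mul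
            (HasPolesIn.inv_id.pow _))).continuousOn h.encirclesPoles_three)
          (((HasPolesIn.of_entire (differentiable_const _)).mul ((HasPolesIn.of_entire hexp).mul
            (HasPolesIn.inv_id.pow _))).continuousOn h.encirclesPoles_three)
    rw [residueSum_add h ((HasPolesIn.of_entire (differentiable_const a)).mul
        ((HasPolesIn.of_entire hexp).mul (HasPolesIn.inv_id.pow _)))
        ((HasPolesIn.of_entire (differentiable_const _)).mul ((HasPolesIn.of_entire hexp).mul
            (HasPolesIn.inv_id.pow _))), residueSum_const_mul, residueSum_const_mul, ih] at h1
    have h0 : ((i : ℂ) + 1) ≠ 0 := by exact_mod_cast Nat.succ_ne_zero i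
    have h3 : (i.factorial : ℂ) ≠ 0 := by exact_mod_cast i.factorial_ne_zero
    rw [Nat.factorial_succ]
    push_cast
    rw [eq_div_iff (mul_ne_zero h0 h3)]
    generalize residueSum lam _ = q at h1 ⊢
    field_simp at h1
    linear_combination -h1

end

/-! ### The functions entering the kernel -/

section
variable {lam : ℕ → ℝ}

/-- `∏_{k < x} λ(k) / (λ(k) - w)`. -/
noncomputable def shiftedPsi (lam : ℕ → ℝ) (x : ℕ) (w : ℂ) : ℂ :=
  ∏ k ∈ Finset.range x, (lam k : ℂ) / (lam k - w)

theorem shiftedPsi_succ (lam : ℕ → ℝ) (x : ℕ) (w : ℂ) :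
    shiftedPsi lam (x + 1) w = shiftedPsi lam x w * ((lam x : ℂ) / (lam x - w)) :=
  Finset.prod_range_succ _ _

theorem pPoly_succ (lam : ℕ → ℝ) (x : ℕ) (w : ℂ) :
    pPoly lam (x + 1) w = pPoly lam x w * (((lam x : ℂ) - w) / lam x) :=
  Finset.prod_range_succ _ _

theorem hasPolesIn_shiftedPsi (x : ℕ) : HasPolesIn lam (shiftedPsi lam x) :=
  HasPolesIn.prod _ fun k _ => HasPolesIn.factor k

theorem differentiable_pPoly (lam : ℕ → ℝ) (x : ℕ) : Differentiable ℂ (pPoly lam x) := by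
  unfold pPoly
  fun_prop

theorem hasPolesIn_pPoly (x : ℕ) : HasPolesIn lam (pPoly lam x) :=
  HasPolesIn.of_entire (differentiable_pPoly lam x)

theorem differentiable_exp_mul (a : ℂ) : Differentiable ℂ fun w => Complex.exp (a * w) := by
  fun_prop

theorem pPoly_zero_right (h : UniformlyBounded lam) (x : ℕ) : pPoly lam x 0 = 1 := by
  refine Finset.prod_eq_one fun k _ => ?_
  rw [sub_zero, div_self (h.ne_zero k)]

/-- The functions `-∮ ∏_{k < x} λ(k) / (λ(k) - w) w ^ m e ^ (-t w) dw`, normalised. -/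
noncomputable def birthFun (lam : ℕ → ℝ) (m : ℤ) (t : ℝ) (x : ℕ) : ℂ :=
  -residueSum lam (fun w => shiftedPsi lam x w * w ^ m * Complex.exp (-(t : ℂ) * w))

theorem hasPolesIn_birthFun (m : ℤ) (t : ℝ) (x : ℕ) :
    HasPolesIn lam (fun w => shiftedPsi lam x w * w ^ m * Complex.exp (-(t : ℂ) * w)) :=
  ((hasPolesIn_shiftedPsi x).mul (HasPolesIn.zpow m)).mul
    (HasPolesIn.of_entire (differentiable_exp_mul _))

/-- Since `λ / (λ - w) - 1 = w / (λ - w)`, a factor `w` in the integrand acts as a lattice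
difference. As `-w` is also the time derivative, this is the pure birth equation; its inverse form
`birthFun_sub` drives the summation by parts. -/
theorem birthFun_succ (h : UniformlyBounded lam) (m : ℤ) (t : ℝ) (x : ℕ) :
    birthFun lam (m + 1) t (x + 1) =
      lam x * (birthFun lam m t (x + 1) - birthFun lam m t x) := by
  rw [birthFun, birthFun, birthFun, neg_sub_neg, ← residueSum_sub h (hasPolesIn_birthFun m t x)
    (hasPolesIn_birthFun m t (x + 1)), ← residueSum_const_mul, ← neg_one_mul,
    ← residueSum_const_mul]
  refine residueSum_congr h fun w hw hwx => ?_
  have h1 : (lam x : ℂ) - w ≠ 0 := sub_ne_zero.2 (hwx x).symm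
  rw [shiftedPsi_succ, zpow_add_one₀ hw]
  generalize w ^ m = q
  field_simp
  ring

theorem birthFun_sub (h : UniformlyBounded lam) (m : ℤ) (t : ℝ) (x : ℕ) :
    birthFun lam (m - 1) t (x + 1) - birthFun lam (m - 1) t x =
      birthFun lam m t (x + 1) / lam x := by
  have := birthFun_succ h (m - 1) t x
  rw [sub_add_cancel] at this
  rw [this, mul_div_cancel_left₀ _ (h.ne_zero x)]

theorem birthFun_nat_zero (n : ℕ) (t : ℝ) : birthFun lam n t 0 = 0 := by
  rw [birthFun, residueSum_entire, neg_zero]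
  simp only [shiftedPsi, Finset.range_zero, Finset.prod_empty, one_mul, zpow_natCast]
  fun_prop

theorem birthFun_neg_zero (h : UniformlyBounded lam) (n : ℕ) (t : ℝ) :
    birthFun lam (-(n : ℤ) - 1) t 0 = -((-(t : ℂ)) ^ n / n.factorial) := by
  rw [birthFun, ← residueSum_exp_mul_inv_pow h]
  congr 2
  ext w
  rw [shiftedPsi, Finset.range_zero, Finset.prod_empty, one_mul, mul_comm,
    show (-(n : ℤ) - 1) = -((n + 1 : ℕ) : ℤ) by push_cast; ring, zpow_neg, zpow_natCast, inv_pow]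

/-! ### Estimates on large circles and the time derivative -/

theorem norm_factor_le (h : UniformlyBounded lam) {w : ℂ} (hw : 2 * rateSup lam ≤ ‖w‖) (k : ℕ) :
    ‖(lam k : ℂ) / (lam k - w)‖ ≤ 2 * rateSup lam / ‖w‖ := by
  have h1 := h.le_rateSup k
  have h2 := h.pos k
  have h3 := h.rateSup_pos
  have h4 : ‖w‖ - lam k ≤ ‖(lam k : ℂ) - w‖ := by
    have := norm_sub_norm_le w (lam k : ℂ)
    rwa [Complex.norm_real, Real.norm_eq_abs, abs_of_pos h2, norm_sub_rev] at this
  rw [norm_div, Complex.norm_real, Real.norm_eq_abs, abs_of_pos h2,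
    div_le_div_iff₀ (by linarith) (by linarith)]
  nlinarith

/-- The reason for the radius `3 * rateSup lam` in `residueSum`: each factor of `shiftedPsi` is at
most `1 / 2` there, so `birthFun` decays geometrically in space. -/
theorem norm_factor_le_half (h : UniformlyBounded lam) {w : ℂ} (hw : 3 * rateSup lam = ‖w‖)
    (k : ℕ) : ‖(lam k : ℂ) / (lam k - w)‖ ≤ 1 / 2 := by
  have h1 := h.le_rateSup k
  have h2 := h.pos k
  have h4 : ‖w‖ - lam k ≤ ‖(lam k : ℂ) - w‖ := by
    have := norm_sub_norm_le w (lam k : ℂ)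
    rwa [Complex.norm_real, Real.norm_eq_abs, abs_of_pos h2, norm_sub_rev] at this
  rw [norm_div, Complex.norm_real, Real.norm_eq_abs, abs_of_pos h2,
    div_le_div_iff₀ (by linarith) (by linarith)]
  linarith

theorem norm_birthFun_le (h : UniformlyBounded lam) (m : ℤ) (t : ℝ) :
    ∃ B : ℝ, ∀ x, ‖birthFun lam m t x‖ ≤ B * (1 / 2) ^ x := by
  have hM := h.rateSup_pos
  refine ⟨3 * rateSup lam * ((3 * rateSup lam) ^ m * Real.exp (|t| * (3 * rateSup lam))),
    fun x => ?_⟩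
  rw [birthFun, norm_neg, mul_assoc]
  refine norm_residueSum_le h (by linarith) (hasPolesIn_birthFun m t x) fun w hw => ?_
  rw [norm_mul, norm_mul, norm_zpow, hw, mul_assoc, mul_comm]
  have h1 : ‖shiftedPsi lam x w‖ ≤ (1 / 2) ^ x := by
    rw [shiftedPsi, norm_prod]
    refine (Finset.prod_le_prod (fun _ _ => norm_nonneg _)
      fun k _ => norm_factor_le_half h hw.symm k).trans ?_
    simp
  have h2 : ‖Complex.exp (-(t : ℂ) * w)‖ ≤ Real.exp (|t| * (3 * rateSup lam)) := by
    refine (Complex.norm_exp_le_exp_norm _).trans (le_of_eq ?_)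
    rw [norm_mul, norm_neg, Complex.norm_real, hw, Real.norm_eq_abs]
  have h3 : 0 < 3 * rateSup lam := by linarith
  have h4 : 0 < (3 * rateSup lam) ^ m := zpow_pos h3 m
  gcongr

theorem hasDerivAt_residueSum (f g : ℂ → ℂ) (t : ℝ)
    (hf : ContinuousOn f (circleContour (3 * rateSup lam) '' Set.Icc 0 1))
    (hg : g = fun w => -w * f w) :
    HasDerivAt (fun t : ℝ => residueSum lam (fun w => f w * Complex.exp (-(t : ℂ) * w)))
      (residueSum lam (fun w => g w * Complex.exp (-(t : ℂ) * w))) t := by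
  have hγ := isContour_circleContour (3 * rateSup lam)
  set γ := circleContour (3 * rateSup lam) with hγdef
  refine HasDerivAt.const_mul _ ?_
  simp only [contourIntegral]
  have hgc : ContinuousOn g (γ '' Set.Icc 0 1) := by
    rw [hg]; exact (continuous_neg.continuousOn).mul hf
  have hI : ∀ t : ℝ, IntervalIntegrable (fun s => f (γ s) * Complex.exp (-(t : ℂ) * γ s) *
      deriv γ s) volume 0 1 := fun t =>
    hγ.intervalIntegrable (f := fun w => f w * Complex.exp (-(t : ℂ) * w))
      (hf.mul (by fun_prop))
  have hI' : ∀ t : ℝ, IntervalIntegrable (fun s => g (γ s) * Complex.exp (-(t : ℂ) * γ s) *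
      deriv γ s) volume 0 1 := fun t =>
    hγ.intervalIntegrable (f := fun w => g w * Complex.exp (-(t : ℂ) * w))
      (hgc.mul (by fun_prop))
  obtain ⟨B, hB⟩ : ∃ B : ℝ, ∀ s ∈ Set.Icc (0 : ℝ) 1, ‖γ s‖ ≤ B :=
    isCompact_Icc.exists_bound_of_continuousOn hγ.continuousOn
  refine (intervalIntegral.hasDerivAt_integral_of_dominated_loc_of_deriv_le
    (F := fun (t : ℝ) s => f (γ s) * Complex.exp (-(t : ℂ) * γ s) * deriv γ s)
    (F' := fun (t : ℝ) s => g (γ s) * Complex.exp (-(t : ℂ) * γ s) * deriv γ s)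
    (bound := fun s => ‖g (γ s) * deriv γ s‖ * Real.exp ((|t| + 1) * B))
    (Metric.ball_mem_nhds t one_pos) (Eventually.of_forall fun t' => ?_) (hI t) ?_ ?_ ?_ ?_).2
  · exact (hI t').aestronglyMeasurable_restrict_uIoc
  · exact (hI' t).aestronglyMeasurable_restrict_uIoc
  · refine Eventually.of_forall fun s hs t' ht' => ?_
    rw [Set.uIoc_of_le zero_le_one] at hs
    have hs' := hB s ⟨hs.1.le, hs.2⟩
    have e : ‖Complex.exp (-(t' : ℂ) * γ s)‖ ≤ Real.exp ((|t| + 1) * B) := by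
      refine (Complex.norm_exp_le_exp_norm _).trans (Real.exp_le_exp.2 ?_)
      rw [norm_mul, norm_neg, Complex.norm_real, Real.norm_eq_abs]
      have : |t'| ≤ |t| + 1 := by
        rw [Metric.mem_ball, Real.dist_eq] at ht'
        have := abs_sub_abs_le_abs_sub t' t
        linarith
      gcongr
    rw [mul_right_comm, norm_mul]
    gcongr
  · exact ((hγ.intervalIntegrable hgc).norm).mul_const _
  · refine Eventually.of_forall fun s _ t' _ => ?_
    have h1 : HasDerivAt (fun t : ℝ => Complex.exp (-(t : ℂ) * γ s))
        (Complex.exp (-(t' : ℂ) * γ s) * (-1 * γ s)) t' :=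
      (((Complex.ofRealCLM.hasDerivAt (x := t')).neg).mul_const (γ s)).cexp
    refine ((h1.const_mul (f (γ s))).mul_const (deriv γ s)).congr_deriv ?_
    rw [hg]; ring

theorem hasDerivAt_birthFun (h : UniformlyBounded lam) (m : ℤ) (x : ℕ) (t : ℝ) :
    HasDerivAt (fun t => birthFun lam m t x) (-birthFun lam (m + 1) t x) t := by
  have hp : HasPolesIn lam (fun w => shiftedPsi lam x w * w ^ m) :=
    (hasPolesIn_shiftedPsi x).mul (HasPolesIn.zpow m)
  refine ((hasDerivAt_residueSum (lam := lam) _ _ t (hp.continuousOn h.encirclesPoles_three)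
    rfl).neg).congr_deriv ?_
  rw [birthFun, neg_inj, neg_eq_neg_one_mul (residueSum _ _), ← residueSum_const_mul]
  refine residueSum_congr h fun w hw _ => ?_
  rw [zpow_add_one₀ hw]; ring

/-- The Taylor coefficients of `p_x(u) e ^ (t u)` at `0`. -/
noncomputable def taylorCoeff (lam : ℕ → ℝ) (t : ℝ) (i x : ℕ) : ℂ :=
  residueSum lam (fun u => pPoly lam x u * Complex.exp (t * u) * (u⁻¹) ^ (i + 1))

theorem hasPolesIn_taylorCoeff (t : ℝ) (i x : ℕ) :
    HasPolesIn lam (fun u => pPoly lam x u * Complex.exp (t * u) * (u⁻¹) ^ (i + 1)) :=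
  ((hasPolesIn_pPoly x).mul (HasPolesIn.of_entire (differentiable_exp_mul _))).mul
    (HasPolesIn.inv_id.pow _)

theorem taylorCoeff_zero (h : UniformlyBounded lam) (t : ℝ) (x : ℕ) : taylorCoeff lam t 0 x = 1 := by
  have := residueSum_div_id h ((differentiable_pPoly lam x).mul (differentiable_exp_mul (t : ℂ)))
  simpa [pPoly_zero_right h, taylorCoeff] using this

theorem taylorCoeff_zero_right (h : UniformlyBounded lam) (t : ℝ) (i : ℕ) :
    taylorCoeff lam t i 0 = (t : ℂ) ^ i / i.factorial := by
  rw [← residueSum_exp_mul_inv_pow h, taylorCoeff]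
  simp [pPoly]

/-- Because `p_{x+1}(u) = p_x(u) (1 - u / λ(x))`, a lattice difference lowers the Taylor index by
one. This matches the recursion that summation over interlacing rows imposes on `rowFun`. -/
theorem taylorCoeff_succ (h : UniformlyBounded lam) (t : ℝ) (i x : ℕ) :
    taylorCoeff lam t (i + 1) (x + 1) =
      taylorCoeff lam t (i + 1) x - taylorCoeff lam t i x / lam x := by
  rw [div_eq_inv_mul, taylorCoeff, taylorCoeff, taylorCoeff, ← residueSum_const_mul,
    ← residueSum_sub h (hasPolesIn_taylorCoeff _ _ _)
      ((HasPolesIn.of_entire (differentiable_const _)).mul (hasPolesIn_taylorCoeff _ _ _))]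
  refine residueSum_congr h fun w hw _ => ?_
  have := h.ne_zero x
  rw [pPoly_succ, pow_succ _ (i + 1)]
  generalize (w⁻¹) ^ (i + 1) = q
  field_simp

/-- The transition function from level `n` to level `n + j`. -/
noncomputable def transFun (lam : ℕ → ℝ) (j y x : ℕ) : ℂ :=
  residueSum lam (fun w => shiftedPsi lam (y + 1) w * pPoly lam x w * (w⁻¹) ^ j)

theorem hasPolesIn_transFun (j y x : ℕ) :
    HasPolesIn lam (fun w => shiftedPsi lam (y + 1) w * pPoly lam x w * (w⁻¹) ^ j) :=
  ((hasPolesIn_shiftedPsi _).mul (hasPolesIn_pPoly x)).mul (HasPolesIn.inv_id.pow _)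

theorem transFun_succ (h : UniformlyBounded lam) (j y x : ℕ) :
    transFun lam (j + 1) y (x + 1) = transFun lam (j + 1) y x - transFun lam j y x / lam x := by
  rw [div_eq_inv_mul, transFun, transFun, transFun, ← residueSum_const_mul,
    ← residueSum_sub h (hasPolesIn_transFun _ _ _)
      ((HasPolesIn.of_entire (differentiable_const _)).mul (hasPolesIn_transFun _ _ _))]
  refine residueSum_congr h fun w hw _ => ?_
  have := h.ne_zero x
  rw [pPoly_succ, pow_succ]
  generalize (w⁻¹) ^ j = q
  field_simp

theorem norm_shiftedPsi_mul_pPoly_le (h : UniformlyBounded lam) {w : ℂ}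
    (hw : 2 * rateSup lam ≤ ‖w‖) (x d : ℕ) :
    ‖shiftedPsi lam (x + d) w * pPoly lam x w‖ ≤ (2 * rateSup lam / ‖w‖) ^ d := by
  have hM := h.rateSup_pos
  have h1 : shiftedPsi lam (x + d) w * pPoly lam x w =
      ∏ k ∈ Finset.range d, (lam (x + k) : ℂ) / (lam (x + k) - w) := by
    have h2 : shiftedPsi lam x w * pPoly lam x w = 1 := by
      rw [shiftedPsi, pPoly, ← Finset.prod_mul_distrib]
      refine Finset.prod_eq_one fun k _ => ?_
      have h3 : (lam k : ℂ) - w ≠ 0 := by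
        intro h0
        rw [sub_eq_zero] at h0
        rw [← h0, Complex.norm_real, Real.norm_eq_abs, abs_of_pos (h.pos k)] at hw
        linarith [h.le_rateSup k]
      have := h.ne_zero k
      field_simp
    rw [shiftedPsi, Finset.prod_range_add, mul_right_comm, ← shiftedPsi, h2, one_mul]
  rw [h1, norm_prod]
  refine (Finset.prod_le_prod (fun _ _ => norm_nonneg _) fun k _ => norm_factor_le h hw _).trans ?_
  rw [Finset.prod_const, Finset.card_range]

/-- All factors of `p_x` cancel and at least one factor `λ / (λ - w)` survives. Together with
`w^{-(j+1)}` the integrand is `O(|w|^{-2})` at infinity. -/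
theorem transFun_of_le (h : UniformlyBounded lam) (j : ℕ) {y x : ℕ} (hxy : x ≤ y) :
    transFun lam (j + 1) y x = 0 := by
  have hM := h.rateSup_pos
  obtain ⟨d, rfl⟩ := Nat.exists_eq_add_of_le hxy
  refine residueSum_eq_zero_of_decay h (hasPolesIn_transFun _ _ _)
    (2 * rateSup lam * ((2 * rateSup lam)⁻¹) ^ j) fun R hR w hw => ?_
  have hR0 : 0 < R := by linarith
  have h1 := norm_shiftedPsi_mul_pPoly_le h (hw.symm ▸ hR) x (d + 1)
  rw [hw, pow_succ, ← add_assoc] at h1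
  have h2 : (2 * rateSup lam / R) ^ d ≤ 1 :=
    pow_le_one₀ (by positivity) ((div_le_one hR0).2 hR)
  have h3 : R⁻¹ ≤ (2 * rateSup lam)⁻¹ := inv_anti₀ (by linarith) hR
  rw [norm_mul, norm_pow, norm_inv, hw, pow_succ]
  calc _ ≤ (1 * (2 * rateSup lam / R)) * (((2 * rateSup lam)⁻¹) ^ j * R⁻¹) := by
        gcongr
        exact h1.trans (by gcongr)
    _ = _ := by field_simp

/-- If `y < x`, the poles at the rates cancel and the residue at `0` of a polynomial with value one
there, divided by `w`, is left. So one level step is the interlacing indicator, and `transFun_succ`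
iterates it with weights. -/
theorem transFun_one (h : UniformlyBounded lam) (y x : ℕ) :
    transFun lam 1 y x = if y < x then 1 else 0 := by
  split_ifs with hxy
  swap
  · exact transFun_of_le h 0 (not_lt.1 hxy)
  obtain ⟨d, rfl⟩ := Nat.exists_eq_add_of_le hxy
  have hE : Differentiable ℂ (fun w => ∏ k ∈ Finset.range d,
      ((lam (y + 1 + k) : ℂ) - w) / lam (y + 1 + k)) := by fun_prop
  have h1 := residueSum_div_id h hE
  rw [transFun]
  rw [show (∏ k ∈ Finset.range d, ((lam (y + 1 + k) : ℂ) - 0) / lam (y + 1 + k)) = 1 from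
    Finset.prod_eq_one fun k _ => by rw [sub_zero, div_self (h.ne_zero _)]] at h1
  rw [← h1]
  refine residueSum_congr h fun w hw hwx => ?_
  rw [pow_one]
  congr 1
  have h2 : shiftedPsi lam (y + 1) w * pPoly lam (y + 1) w = 1 := by
    rw [shiftedPsi, pPoly, ← Finset.prod_mul_distrib]
    refine Finset.prod_eq_one fun k _ => ?_
    have h3 : (lam k : ℂ) - w ≠ 0 := sub_ne_zero.2 (hwx k).symm
    have := h.ne_zero k
    field_simp
  rw [pPoly, Finset.prod_range_add, ← mul_assoc, ← pPoly, Nat.succ_eq_add_one, h2, one_mul]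

/-- At time zero the exponential is absent, and this is a `transFun` ending at position `0`. -/
theorem birthFun_neg_time_zero (h : UniformlyBounded lam) (j x : ℕ) :
    birthFun lam (-(j : ℤ) - 1) 0 (x + 1) = 0 := by
  have h1 := transFun_of_le h j (Nat.zero_le x)
  rw [birthFun, neg_eq_zero, ← h1, transFun]
  congr 1; ext w
  rw [show (-(j : ℤ) - 1) = -((j + 1 : ℕ) : ℤ) by push_cast; ring, zpow_neg, zpow_natCast, inv_pow]
  simp [pPoly]

end

/-! ### The kernel in biorthogonal form -/

section
variable {lam : ℕ → ℝ}

theorem AdmissibleContours.encirclesPoles {C C₀ : ℝ → ℂ} (h : AdmissibleContours lam C C₀) :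
    EncirclesPoles lam C := ⟨h.isContour, h.encircles_zero, h.encircles⟩

/-- Only `0` is a pole here, so a contour around `0` alone suffices, wherever it runs relative to
the rates. This is why `C₀` need not be small. -/
theorem contourIntegral_taylorCoeff (h : UniformlyBounded lam) {γ : ℝ → ℂ} (hγ : IsContour γ)
    (hγ0 : Encircles γ 0) (t : ℝ) (i x : ℕ) :
    contourIntegral γ (fun u => pPoly lam x u * Complex.exp (t * u) * (u⁻¹) ^ (i + 1)) =
      2 * Real.pi * Complex.I * taylorCoeff lam t i x := by
  rw [taylorCoeff, residueSum, mul_inv_cancel_left₀ Complex.two_pi_I_ne_zero]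
  have := contourIntegral_prod_inv_eq hγ h.encirclesPoles_three.isContour _
    (List.replicate (i + 1) 0) rfl
    (fun a ha => by rw [List.eq_of_mem_replicate ha]; exact hγ0)
    (fun a ha => by rw [List.eq_of_mem_replicate ha]; exact h.encirclesPoles_three.encircles_zero)
    _ ((differentiable_pPoly lam x).mul (differentiable_exp_mul (t : ℂ)))
  simpa [List.map_replicate, List.prod_replicate] using this

/-- The quotient `(w ^ n - u ^ n) / (w - u)` is a finite geometric sum, so the apparent pole at `w =
u` disappears and the variables separate: each term is a `birthFun` in `w` times a Taylor
coefficient in `u`. -/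
theorem corrKernel_eq (h : UniformlyBounded lam) {C C₀ : ℝ → ℂ} (hC : AdmissibleContours lam C C₀)
    (t : ℝ) (z₁ z₂ : ℕ × ℕ) :
    corrKernel lam C C₀ t z₁ z₂ = (lam z₁.2 : ℂ)⁻¹ *
      ((if z₁.1 < z₂.1 then transFun lam (z₂.1 - z₁.1) z₁.2 z₂.2 else 0) +
        ∑ i ∈ Finset.range z₂.1, birthFun lam ((z₁.1 : ℤ) - z₂.1 + i) t (z₁.2 + 1) *
          taylorCoeff lam t i z₂.2) := by
  have hpi := Complex.two_pi_I_ne_zero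
  have h1 : contourIntegral C (fun w => psi lam z₁.2 w * (pPoly lam z₂.2 w / w ^ (z₂.1 - z₁.1))) =
      2 * Real.pi * Complex.I * transFun lam (z₂.1 - z₁.1) z₁.2 z₂.2 := by
    rw [transFun, ← (hasPolesIn_transFun _ _ _).contourIntegral_eq h hC.encirclesPoles]
    congr 1; ext w
    rw [inv_pow, psi, shiftedPsi]; ring
  have h2 : ∀ w ∈ C '' Set.Icc 0 1, contourIntegral C₀ (fun u =>
      psi lam z₁.2 w * pPoly lam z₂.2 u * Complex.exp (-(t : ℂ) * (w - u)) *
        (w ^ ((z₁.1 : ℤ) - (z₂.1 : ℤ)) / u ^ z₂.1) *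
        ((w ^ z₂.1 - u ^ z₂.1) / (w - u))) =
      ∑ i ∈ Finset.range z₂.1, 2 * Real.pi * Complex.I * taylorCoeff lam t i z₂.2 *
        (shiftedPsi lam (z₁.2 + 1) w * w ^ ((z₁.1 : ℤ) - z₂.1 + i) *
          Complex.exp (-(t : ℂ) * w)) := by
    intro w hw
    have hw0 := (HasPolesIn.ne_of_mem hC.encirclesPoles hw).1
    have h3 : ∀ u ∈ C₀ '' Set.Icc 0 1, psi lam z₁.2 w * pPoly lam z₂.2 u *
        Complex.exp (-(t : ℂ) * (w - u)) * (w ^ ((z₁.1 : ℤ) - (z₂.1 : ℤ)) / u ^ z₂.1) *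
        ((w ^ z₂.1 - u ^ z₂.1) / (w - u)) = ∑ i ∈ Finset.range z₂.1,
        (shiftedPsi lam (z₁.2 + 1) w * w ^ ((z₁.1 : ℤ) - z₂.1 + i) * Complex.exp (-(t : ℂ) * w)) *
          (pPoly lam z₂.2 u * Complex.exp (t * u) * (u⁻¹) ^ (i + 1)) := by
      intro u hu
      have hne : w ≠ u := fun e => (hC.disjoint.ne_of_mem hw hu) e
      have hu0 : u ≠ 0 := fun e => hC.encircles₀.1 (e ▸ hu)
      rw [← (Commute.all w u).geom_sum₂ hne, Finset.mul_sum]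
      refine Finset.sum_congr rfl fun i hi => ?_
      rw [show -(t : ℂ) * (w - u) = -(t : ℂ) * w + t * u by ring, Complex.exp_add,
        zpow_add₀ hw0, zpow_natCast, psi, shiftedPsi]
      have h4 : u ^ (z₂.1 - 1 - i) / u ^ z₂.1 = (u⁻¹) ^ (i + 1) := by
        rw [inv_pow, div_eq_iff (pow_ne_zero _ hu0), eq_inv_mul_iff_mul_eq₀ (pow_ne_zero _ hu0),
          ← pow_add]
        congr 1
        have := Finset.mem_range.1 hi
        omega
      rw [← h4]
      ring
    have hc : ∀ i : ℕ, ContinuousOn (fun u => pPoly lam z₂.2 u * Complex.exp (t * u) *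
        (u⁻¹) ^ (i + 1)) (C₀ '' Set.Icc 0 1) := fun i => by
      have h0 : ∀ u ∈ C₀ '' Set.Icc 0 1, u ≠ 0 := fun u hu e => hC.encircles₀.1 (e ▸ hu)
      refine ContinuousOn.mul (Continuous.continuousOn ?_) (ContinuousOn.pow
        (ContinuousOn.inv₀ continuousOn_id h0) _)
      exact ((differentiable_pPoly lam z₂.2).mul (differentiable_exp_mul (t : ℂ))).continuous
    rw [contourIntegral_congr h3, hC.isContour₀.integral_sum_const_mul _ _ fun i _ => hc i]
    refine Finset.sum_congr rfl fun i _ => ?_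
    rw [contourIntegral_taylorCoeff h hC.isContour₀ hC.encircles₀]
    ring
  rw [corrKernel, h1, contourIntegral_congr h2, hC.isContour.integral_sum_const_mul _ _ fun i _ =>
    (hasPolesIn_birthFun _ _ _).continuousOn hC.encirclesPoles]
  have h5 : ∀ i ∈ Finset.range z₂.1, 2 * Real.pi * Complex.I *
      taylorCoeff lam t i z₂.2 * contourIntegral C (fun w => (shiftedPsi lam (z₁.2 + 1) w * w ^ ((z₁.1 : ℤ) - z₂.1 + i) *
          Complex.exp (-(t : ℂ) * w))) = -(2 * Real.pi * Complex.I) ^ 2 *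
        (birthFun lam ((z₁.1 : ℤ) - z₂.1 + i) t (z₁.2 + 1) * taylorCoeff lam t i z₂.2) := by
    intro i _
    rw [(hasPolesIn_birthFun _ _ _).contourIntegral_eq h
      hC.encirclesPoles, birthFun]
    ring
  rw [Finset.sum_congr rfl h5, ← Finset.mul_sum]
  generalize (∑ i ∈ Finset.range z₂.1, birthFun lam ((z₁.1 : ℤ) - z₂.1 + i) t (z₁.2 + 1) *
          taylorCoeff lam t i z₂.2) = S
  generalize (2 * Real.pi * Complex.I : ℂ) = q at hpi ⊢
  have := h.ne_zero z₁.2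
  split_ifs <;> field_simp <;> ring

end

/-! ### Biorthogonality -/

section
variable {lam : ℕ → ℝ}

/-- Growth at most like `(3 / 2) ^ x`. -/
def SlowGrowth (b : ℕ → ℂ) : Prop := ∃ B : ℝ, ∀ x, ‖b x‖ ≤ B * (3 / 2) ^ x

/-- Summing `(3 / 2) ^ y` over `y < x` costs at most a factor `2`. The base `3 / 2` is chosen so
that, against the decay `(1 / 2) ^ x` of `birthFun`, boundary terms at infinity are `O((3 / 4) ^
x)`. -/
theorem SlowGrowth.of_sub (h : UniformlyBounded lam) {a b : ℕ → ℂ} (ha : SlowGrowth a)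
    (hb : ∀ x, b (x + 1) = b x - a x / lam x) : SlowGrowth b := by
  obtain ⟨B, hB⟩ := ha
  obtain ⟨s, M, hs, hsM⟩ := h
  have hB0 : 0 ≤ B := by simpa using (norm_nonneg _).trans (hB 0)
  refine ⟨‖b 0‖ + 2 * (B / s), fun x => ?_⟩
  induction x with
  | zero =>
    have : 0 ≤ 2 * (B / s) := by positivity
    simpa using this
  | succ x ih =>
    have h1 : ‖a x / lam x‖ ≤ B / s * (3 / 2) ^ x := by
      rw [norm_div, Complex.norm_real, Real.norm_eq_abs, abs_of_pos (hs.trans_le (hsM x).1),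
        div_mul_eq_mul_div]
      have := hB x
      have := (hsM x).1
      gcongr
    have h2 : (0 : ℝ) ≤ ‖b 0‖ * (3 / 2) ^ x := by positivity
    rw [hb, pow_succ]
    have h3 := norm_sub_le (b x) (a x / lam x)
    linarith

theorem SlowGrowth.mul_birthFun (h : UniformlyBounded lam) {b : ℕ → ℂ} (hb : SlowGrowth b)
    (m : ℤ) (t : ℝ) : Tendsto (fun x => b x * birthFun lam m t x) atTop (𝓝 0) := by
  obtain ⟨B, hB⟩ := hb
  obtain ⟨B', hB'⟩ := norm_birthFun_le h m t
  have hB0 : 0 ≤ B := by simpa using (norm_nonneg _).trans (hB 0)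
  refine squeeze_zero_norm (a := fun x => (B * B') * (3 / 4) ^ x) (fun x => ?_) ?_
  · rw [norm_mul]
    calc _ ≤ (B * (3 / 2) ^ x) * (B' * (1 / 2) ^ x) :=
          mul_le_mul (hB x) (hB' x) (norm_nonneg _) (by positivity)
      _ = B * B' * ((3 / 2) ^ x * (1 / 2) ^ x) := by ring
      _ = _ := by rw [← mul_pow]; norm_num
  · simpa using (tendsto_pow_atTop_nhds_zero_of_lt_one (by norm_num : (0 : ℝ) ≤ 3 / 4)
      (by norm_num)).const_mul (B * B')

/-- Abel summation: `birthFun lam m t (x + 1) / lam x` is the difference of `birthFun lam (m - 1)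
t`, while the difference of `b` is `-a / λ`. -/
theorem sum_mul_birthFun (h : UniformlyBounded lam) {a b : ℕ → ℂ}
    (hb : ∀ x, b (x + 1) = b x - a x / lam x) (m : ℤ) (t : ℝ) (R : ℕ) :
    ∑ x ∈ Finset.range R, b x * (birthFun lam m t (x + 1) / lam x) =
      b R * birthFun lam (m - 1) t R - b 0 * birthFun lam (m - 1) t 0 +
        ∑ x ∈ Finset.range R, a x * (birthFun lam (m - 1) t (x + 1) / lam x) := by
  induction R with
  | zero => simp
  | succ R ih =>
    rw [Finset.sum_range_succ, Finset.sum_range_succ, ih, hb, ← birthFun_sub h]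
    ring

theorem tendsto_sum_mul_birthFun (h : UniformlyBounded lam) {a b : ℕ → ℂ} (hg : SlowGrowth b)
    (hb : ∀ x, b (x + 1) = b x - a x / lam x) (m : ℤ) (t : ℝ) {S : ℂ}
    (ha : Tendsto (fun R => ∑ x ∈ Finset.range R,
      a x * (birthFun lam (m - 1) t (x + 1) / lam x)) atTop (𝓝 S)) :
    Tendsto (fun R => ∑ x ∈ Finset.range R, b x * (birthFun lam m t (x + 1) / lam x)) atTop
      (𝓝 (-(b 0 * birthFun lam (m - 1) t 0) + S)) := by
  simp_rw [sum_mul_birthFun h hb]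
  have := ((hg.mul_birthFun h (m - 1) t).sub_const (b 0 * birthFun lam (m - 1) t 0)).add ha
  rwa [zero_sub] at this

theorem slowGrowth_const (c : ℂ) : SlowGrowth fun _ => c :=
  ⟨‖c‖, fun x => le_mul_of_one_le_right (norm_nonneg _) (one_le_pow₀ (by norm_num))⟩

theorem slowGrowth_taylorCoeff (h : UniformlyBounded lam) (t : ℝ) (i : ℕ) :
    SlowGrowth (taylorCoeff lam t i) := by
  induction i with
  | zero =>
    rw [show taylorCoeff lam t 0 = fun _ => 1 from funext (taylorCoeff_zero h t)]
    exact slowGrowth_const 1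
  | succ i ih => exact ih.of_sub h (taylorCoeff_succ h t i)

theorem slowGrowth_transFun (h : UniformlyBounded lam) (j y : ℕ) :
    SlowGrowth (transFun lam (j + 1) y) := by
  induction j with
  | zero =>
    refine ⟨1, fun x => ?_⟩
    have : (1 : ℝ) ≤ (3 / 2) ^ x := one_le_pow₀ (by norm_num)
    rw [zero_add, transFun_one h]
    split_ifs <;> simp <;> linarith
  | succ j ih => exact ih.of_sub h (transFun_succ h (j + 1) y)

/-- Each Abel summation removes one level from `transFun` and lowers the exponent of `birthFun` by
one; no boundary term arises at `0`, where `transFun` vanishes. -/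
theorem tendsto_transFun_mul_birthFun (h : UniformlyBounded lam) (j y : ℕ) (m : ℤ) (t : ℝ) :
    Tendsto (fun R => ∑ x ∈ Finset.range R,
      transFun lam (j + 1) y x * (birthFun lam m t (x + 1) / lam x)) atTop
      (𝓝 (-birthFun lam (m - (j + 1)) t (y + 1))) := by
  induction j generalizing m with
  | zero =>
    have h1 := tendsto_sum_mul_birthFun h (slowGrowth_transFun h 0 y)
      -- The step function `1(y < x)` has a unit jump between `y` and `y + 1`; `a` is this jump
      -- times `-λ(y)`.
      (a := fun x => if x = y then -(lam y : ℂ) else 0) (fun x => ?_) m t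
      (S := -birthFun lam (m - 1) t (y + 1)) ?_
    · simpa [transFun_one h] using h1
    · simp only [zero_add, transFun_one h]
      have := h.ne_zero x
      rcases lt_trichotomy x y with hxy | rfl | hxy
      · rw [if_neg (by omega), if_neg (by omega), if_neg (by omega)]; simp
      · rw [if_pos (by omega), if_neg (by omega), if_pos rfl]; field_simp; ring
      · rw [if_pos (by omega), if_pos (by omega), if_neg (by omega)]; simp
    · refine tendsto_const_nhds.congr' ?_
      filter_upwards [eventually_gt_atTop y] with R hR
      have := h.ne_zero y
      rw [Finset.sum_eq_single_of_mem y (Finset.mem_range.2 hR) fun x _ hx => by simp [hx]]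
      simp only [if_true]
      field_simp
  | succ j ih =>
    have h1 := tendsto_sum_mul_birthFun h (slowGrowth_transFun h (j + 1) y)
      (transFun_succ h (j + 1) y) m t (ih (m - 1))
    rw [transFun_of_le h _ (Nat.zero_le y), zero_mul, neg_zero, zero_add] at h1
    convert h1 using 4
    push_cast; ring

/-- After `i + 1` Abel summations nothing remains but the boundary terms at position `0`. -/
theorem tendsto_taylorCoeff_mul_birthFun_aux (h : UniformlyBounded lam) (i : ℕ) (m : ℤ) (t : ℝ) :
    Tendsto (fun R => ∑ x ∈ Finset.range R,
      taylorCoeff lam t i x * (birthFun lam m t (x + 1) / lam x)) atTop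
      (𝓝 (∑ j ∈ Finset.range (i + 1),
        -(taylorCoeff lam t (i - j) 0 * birthFun lam (m - 1 - j) t 0))) := by
  induction i generalizing m with
  | zero =>
    have h1 := tendsto_sum_mul_birthFun h (slowGrowth_taylorCoeff h t 0) (a := fun _ => 0)
      (fun x => by simp [taylorCoeff_zero h]) m t (S := 0) (by simp)
    simpa using h1
  | succ i ih =>
    have h1 := tendsto_sum_mul_birthFun h (slowGrowth_taylorCoeff h t (i + 1))
      (taylorCoeff_succ h t i) m t (ih (m - 1))
    rw [Finset.sum_range_succ']
    convert h1 using 2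
    rw [add_comm]
    congr 1
    · simp
    · refine Finset.sum_congr rfl fun j _ => ?_
      rw [Nat.succ_sub_succ_eq_sub,
        show m - 1 - ((j + 1 : ℕ) : ℤ) = m - 1 - 1 - j by push_cast; ring]

/-- For `k = 0` the boundary terms are the binomial expansion of `(t - t) ^ i / i!`. For larger `k`
the first one vanishes, its integrand being entire, and both indices drop by one. -/
theorem sum_taylorCoeff_mul_birthFun_zero (h : UniformlyBounded lam) (i k : ℕ) (t : ℝ) :
    (if i = k then (1 : ℂ) else 0) = ∑ j ∈ Finset.range (i + 1),
        -(taylorCoeff lam t (i - j) 0 * birthFun lam (k - 1 - j) t 0) := by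
  induction i generalizing k with
  | zero =>
    rcases k with _ | k
    · have := birthFun_neg_zero h 0 t
      simp only [Nat.cast_zero, neg_zero, zero_sub] at this
      simp [taylorCoeff_zero h, this]
    · have := birthFun_nat_zero (lam := lam) k t
      simp [this]
  | succ i ih =>
    rcases k with _ | k
    · have h2 : ∀ j ∈ Finset.range (i + 1 + 1),
          -(taylorCoeff lam t (i + 1 - j) 0 * birthFun lam (((0 : ℕ) : ℤ) - 1 - j) t 0) =
          ((i + 1).factorial : ℂ)⁻¹ *
            ((-(t : ℂ)) ^ j * (t : ℂ) ^ (i + 1 - j) * ((i + 1).choose j)) := by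
        intro j hj
        rw [show (((0 : ℕ) : ℤ) - 1 - j) = -(j : ℤ) - 1 by push_cast; ring, birthFun_neg_zero h,
          taylorCoeff_zero_right h, Nat.cast_choose ℂ (Nat.lt_succ_iff.1 (Finset.mem_range.1 hj))]
        have h3 : ((i + 1).factorial : ℂ) ≠ 0 := by exact_mod_cast (i + 1).factorial_ne_zero
        field_simp
      rw [Finset.sum_congr rfl h2, ← Finset.mul_sum, ← add_pow]
      simp
    · rw [Finset.sum_range_succ', show ((k + 1 : ℕ) : ℤ) - 1 - ((0 : ℕ) : ℤ) = k by push_cast; ring,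
        birthFun_nat_zero, mul_zero, neg_zero, add_zero]
      rw [show (if i + 1 = k + 1 then (1 : ℂ) else 0) = if i = k then 1 else 0 by simp, ih k]
      refine Finset.sum_congr rfl fun j _ => ?_
      rw [Nat.succ_sub_succ_eq_sub,
        show ((k + 1 : ℕ) : ℤ) - 1 - ((j + 1 : ℕ) : ℤ) = k - 1 - j by push_cast; ring]

theorem tendsto_taylorCoeff_mul_birthFun (h : UniformlyBounded lam) (i k : ℕ) (t : ℝ) :
    Tendsto (fun R => ∑ x ∈ Finset.range R,
      taylorCoeff lam t i x * (birthFun lam k t (x + 1) / lam x)) atTop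
      (𝓝 (if i = k then 1 else 0)) := by
  rw [sum_taylorCoeff_mul_birthFun_zero h i k t]
  exact tendsto_taylorCoeff_mul_birthFun_aux h i k t

end

/-! ### Determinants -/

theorem det_sum_eq_sum_piFinset {n : ℕ} {α : Type*} [DecidableEq α] (S : Fin n → Finset α)
    (F : Fin n → Fin n → α → ℂ) :
    (Matrix.of fun l k => ∑ y ∈ S k, F l k y).det =
      ∑ q ∈ Fintype.piFinset S, (Matrix.of fun l k => F l k (q k)).det := by
  simp only [Matrix.det_apply, Matrix.of_apply]
  rw [Finset.sum_comm]
  refine Finset.sum_congr rfl fun σ _ => ?_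
  rw [Finset.prod_univ_sum, Finset.smul_sum]

/-- Strictly increasing rows with entries below `R`. -/
def rowSet (N R : ℕ) : Finset (Fin N → ℕ) :=
  {r ∈ Fintype.piFinset fun _ => Finset.range R | StrictMono r}

theorem mem_rowSet {N R : ℕ} {r : Fin N → ℕ} :
    r ∈ rowSet N R ↔ (∀ k, r k < R) ∧ StrictMono r := by
  simp [rowSet]

/-- Sorting: an injective tuple is a strictly increasing one composed with a unique permutation,
because the range determines the sorted tuple. -/
theorem sum_piFinset_eq_sum_rowSet_perm {N R : ℕ} (F : (Fin N → ℕ) → ℂ)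
    (hF : ∀ q, ¬ Function.Injective q → F q = 0) :
    ∑ q ∈ Fintype.piFinset (fun _ : Fin N => Finset.range R), F q =
      ∑ r ∈ rowSet N R, ∑ σ : Equiv.Perm (Fin N), F (r ∘ σ) := by
  classical
  rw [← Finset.sum_product', ← Finset.sum_filter_of_ne (p := Function.Injective) fun q _ hq => by
    by_contra h; exact hq (hF q h)]
  symm
  refine Finset.sum_bij (fun p _ => p.1 ∘ p.2) (fun p hp => ?_) (fun p hp p' hp' he => ?_)
    (fun q hq => ?_) fun _ _ => rfl
  · have := mem_rowSet.1 (Finset.mem_product.1 hp).1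
    simp only [Finset.mem_filter, Fintype.mem_piFinset, Finset.mem_range, Function.comp_apply]
    exact ⟨fun k => this.1 _, this.2.injective.comp p.2.injective⟩
  · have h1 := (mem_rowSet.1 (Finset.mem_product.1 hp).1).2
    have h2 := (mem_rowSet.1 (Finset.mem_product.1 hp').1).2
    have h3 : p.1 = p'.1 := by
      rw [← h1.range_inj h2]
      have := congrArg Set.range he
      rwa [p.2.surjective.range_comp, p'.2.surjective.range_comp] at this
    refine Prod.ext h3 (Equiv.ext fun k => h1.injective ?_)
    have := congrFun he k
    simp only [Function.comp_apply] at this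
    rw [this, h3]
  · simp only [Finset.mem_filter, Fintype.mem_piFinset, Finset.mem_range] at hq
    refine ⟨(q ∘ Tuple.sort q, (Tuple.sort q)⁻¹), ?_, ?_⟩
    · rw [Finset.mem_product]
      refine ⟨mem_rowSet.2 ⟨fun k => hq.1 _, ?_⟩, Finset.mem_univ _⟩
      exact (Tuple.monotone_sort q).strictMono_of_injective
        (hq.2.comp (Tuple.sort q).injective)
    · ext k; simp

/-- The Cauchy–Binet (Andréief) identity. -/
theorem sum_rowSet_det_mul_det {N R : ℕ} (a b : Fin N → ℕ → ℂ) :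
    ∑ r ∈ rowSet N R, (Matrix.of fun l k => a l (r k)).det * (Matrix.of fun l k => b l (r k)).det =
      (Matrix.of fun l i => ∑ x ∈ Finset.range R, a l x * b i x).det := by
  rw [det_sum_eq_sum_piFinset (fun _ => Finset.range R) fun l i x => a l x * b i x,
    sum_piFinset_eq_sum_rowSet_perm]
  · refine Finset.sum_congr rfl fun r _ => ?_
    have h1 : ∀ σ : Equiv.Perm (Fin N),
        (Matrix.of fun l k => a l ((r ∘ σ) k) * b k ((r ∘ σ) k)).det =
        (Matrix.of fun l k => a l (r k)).det *
          ((Equiv.Perm.sign σ : ℤ) * ∏ k, b k (r (σ k))) := by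
      intro σ
      have h2 := Matrix.det_mul_row (fun k => b k (r (σ k))) (Matrix.of fun l k => a l (r (σ k)))
      have h3 := Matrix.det_permute' σ (Matrix.of fun l k => a l (r k))
      have h4 : ((Matrix.of fun l k => a l (r k)).submatrix id σ) =
          Matrix.of fun l k => a l (r (σ k)) := rfl
      rw [h4] at h3
      rw [h3] at h2
      simp only [Matrix.of_apply] at h2
      rw [show (Matrix.of fun l k => a l ((r ∘ σ) k) * b k ((r ∘ σ) k)) =
        Matrix.of fun i j => b j (r (σ j)) * a i (r (σ j)) by ext; simp [mul_comm], h2]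
      ring
    simp only [h1]
    rw [← Finset.mul_sum]
    congr 1
    rw [← Matrix.det_transpose, Matrix.det_apply']
    rfl
  · intro q hq
    rw [Function.Injective] at hq
    push Not at hq
    obtain ⟨i, j, hij, hne⟩ := hq
    have h2 := Matrix.det_mul_row (fun k => b k (q k)) (Matrix.of fun l k => a l (q k))
    have h3 : (Matrix.of fun l k => a l (q k)).det = 0 :=
      Matrix.det_zero_of_column_eq hne (fun l => by simp [hij])
    rw [h3, mul_zero] at h2
    rw [← h2]
    congr 1; ext; simp [mul_comm]

/-- Subtracting from each column its predecessor turns the last row into `(1, 0, …, 0)`; expand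
along it. -/
theorem det_border_ones {N : ℕ} (M : Matrix (Fin (N + 1)) (Fin (N + 1)) ℂ)
    (hM : ∀ k, M (Fin.last N) k = 1) :
    M.det = (-1) ^ N * (Matrix.of fun (l k : Fin N) =>
      M l.castSucc k.succ - M l.castSucc k.castSucc).det := by
  let B : Matrix (Fin (N + 1)) (Fin (N + 1)) ℂ := Matrix.of fun l =>
    Fin.cons (M l 0) fun k => M l k.succ - M l k.castSucc
  have h1 : M.det = B.det :=
    Matrix.det_eq_of_forall_col_eq_smul_add_pred (fun _ => 1) (fun i => by simp [B])
      (fun i j => by simp [B])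
  rw [h1, Matrix.det_succ_row B (Fin.last N), Finset.sum_eq_single 0]
  · simp only [Fin.val_last, Fin.val_zero, add_zero, B, Matrix.of_apply, Fin.cons_zero, hM, mul_one]
    congr 1
    congr 1
    ext l k
    simp
  · intro k _ hk
    obtain ⟨j, rfl⟩ := Fin.exists_succ_eq.2 hk
    simp [B, hM]
  · simp

/-- Differences of neighbouring columns of primitives are sums over the interlacing intervals, and
multilinearity takes these sums out of the determinant. The constants `κ` drop out, so they are free
and are later chosen to give biorthogonality. -/
theorem sum_interlacing_det {N : ℕ} (a : Fin N → ℕ → ℂ) (κ : Fin N → ℂ) (w : ℕ → ℂ)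
    (r : Fin (N + 1) → ℕ) (hr : Monotone r) (M : Matrix (Fin (N + 1)) (Fin (N + 1)) ℂ)
    (hM1 : ∀ k, M (Fin.last N) k = 1)
    (hM : ∀ l k, M (Fin.castSucc l) k = κ l - ∑ y ∈ Finset.range (r k), a l y * w y) :
    ∑ q ∈ Fintype.piFinset fun k : Fin N => Finset.Ico (r k.castSucc) (r k.succ),
      (∏ k, w (q k)) * (Matrix.of fun l k => a l (q k)).det = M.det := by
  rw [det_border_ones M hM1]
  have h1 : (Matrix.of fun (l k : Fin N) => M l.castSucc k.succ - M l.castSucc k.castSucc) =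
      -(Matrix.of fun (l k : Fin N) => ∑ y ∈ Finset.Ico (r k.castSucc) (r k.succ), w y * a l y) := by
    ext l k
    simp only [Matrix.of_apply, Matrix.neg_apply, hM]
    rw [Finset.sum_Ico_eq_sub _ (hr (Fin.castSucc_le_succ k))]
    simp only [mul_comm (w _)]
    ring
  rw [h1, Matrix.det_neg, Fintype.card_fin, ← mul_assoc, ← mul_pow, neg_one_mul, neg_neg, one_pow,
    one_mul, det_sum_eq_sum_piFinset (fun k : Fin N => Finset.Ico (r k.castSucc) (r k.succ))
      fun l _ y => w y * a l y]
  refine Finset.sum_congr rfl fun q _ => ?_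
  exact (Matrix.det_mul_row (fun k => w (q k)) (Matrix.of fun l k => a l (q k))).symm

/-- The perturbative computation behind determinantal correlations. -/
theorem det_one_add_of_eq_add {ι κ : Type*} [Fintype ι] [DecidableEq ι] [Fintype κ] [DecidableEq κ]
    (A c : Matrix κ ι ℂ) (γ : Matrix ι κ ℂ) (T : Matrix ι ι ℂ) (s : ℂ) (lev : ι → ℕ)
    (hT : ∀ i j, lev j ≤ lev i → T i j = 0) (hA : A = c + s • (A * T)) :
    (1 + s • (A * γ)).det = (1 + s • (γ * c - T)).det := by
  -- `T` strictly raises the level, so `1 - s T` is unitriangular; multiplying by it turns `A` into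
  -- `c`, since `A (1 - s T) = c`.
  have h1 : (1 - s • T).det = 1 := by
    have hb : (1 - s • T).BlockTriangular lev := by
      intro i j hij
      have hne : i ≠ j := by rintro rfl; exact lt_irrefl _ hij
      simp [hne, hT i j hij.le]
    rw [hb.det]
    refine Finset.prod_eq_one fun a _ => ?_
    have : (1 - s • T).toSquareBlock lev a = 1 := by
      ext i j
      have h0 := hT i.1 j.1 (by rw [i.2, j.2])
      change (1 - s • T) i.1 j.1 = _
      simp [Matrix.one_apply, Subtype.ext_iff, h0]
    rw [this, Matrix.det_one]
  have h2 : (1 + s • (A * γ)).det = (1 + s • (γ * A)).det := by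
    rw [← Matrix.smul_mul, Matrix.det_one_add_mul_comm, Matrix.mul_smul]
  have hA' : A - s • (A * T) = c := by rw [sub_eq_iff_eq_add]; exact hA
  rw [h2, ← mul_one (Matrix.det _), ← h1, ← Matrix.det_mul]
  congr 1
  have h3 : γ * c = γ * A - s • (γ * A * T) := by
    rw [← hA', Matrix.mul_sub, Matrix.mul_smul, Matrix.mul_assoc]
  rw [h3]
  simp only [Matrix.mul_sub, Matrix.add_mul, Matrix.one_mul, Matrix.mul_one, Matrix.mul_smul,
    Matrix.smul_mul, smul_sub, smul_add]
  abel

/-! ### The perturbed row functions -/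

/-- The functions `A^{(n)}_l` such that the sum over all patterns below a row `r` of length `n` of the
products of the weights `w` is `det [A^{(n)}_l(r_k)]`. -/
def rowFun (κ : ℕ → ℂ) (w : ℕ → ℕ → ℂ) : ℕ → ℕ → ℕ → ℂ
  | 0, _, _ => 0
  | n + 1, l, x => if l < n then κ (n - l) - ∑ y ∈ Finset.range x, rowFun κ w n l y * w n y
      else if l = n then 1 else 0

theorem rowFun_of_le (κ : ℕ → ℂ) (w : ℕ → ℕ → ℂ) {n l : ℕ} (h : n ≤ l) (x : ℕ) :
    rowFun κ w n l x = 0 := by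
  rcases n with _ | n
  · rfl
  · rw [rowFun, if_neg (by omega), if_neg (by omega)]

section
variable {lam : ℕ → ℝ} {m : ℕ}

/-- The weights `1 / λ`, multiplied by `1 + s` at the points `z i`. -/
noncomputable def tiltedWeight (lam : ℕ → ℝ) (s : ℂ) (z : Fin m → ℕ × ℕ) (n y : ℕ) : ℂ :=
  (1 + s * ∑ i, if z i = (n, y) then 1 else 0) / lam y

/-- The strictly triangular part of the correlation kernel. -/
noncomputable def levelKernel (lam : ℕ → ℝ) (z₁ z₂ : ℕ × ℕ) : ℂ :=
  if z₁.1 < z₂.1 then -transFun lam (z₂.1 - z₁.1) z₁.2 z₂.2 / lam z₁.2 else 0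

theorem taylorCoeff_eq_sum (h : UniformlyBounded lam) (t : ℝ) (i x : ℕ) :
    taylorCoeff lam t (i + 1) x = taylorCoeff lam t (i + 1) 0 -
      ∑ y ∈ Finset.range x, taylorCoeff lam t i y / lam y := by
  induction x with
  | zero => simp
  | succ x ih => rw [taylorCoeff_succ h, ih, Finset.sum_range_succ]; ring

theorem transFun_eq_sum (h : UniformlyBounded lam) (j y x : ℕ) :
    transFun lam (j + 2) y x = -∑ y' ∈ Finset.range x, transFun lam (j + 1) y y' / lam y' := by
  induction x with
  | zero => simp [transFun_of_le h (j + 1) (Nat.zero_le y)]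
  | succ x ih => rw [transFun_succ h, ih, Finset.sum_range_succ]; ring

/-- The recursion of `rowFun` without the constant and with a unit source at `z`: `levelKernel` is
its Green function. -/
theorem levelKernel_succ (h : UniformlyBounded lam) (z : ℕ × ℕ) (n x : ℕ) :
    levelKernel lam z (n + 1, x) =
      -(∑ y ∈ Finset.range x, levelKernel lam z (n, y) / lam y) -
        ∑ y ∈ Finset.range x, (if z = (n, y) then 1 else 0) / (lam y : ℂ) := by
  obtain ⟨k, y⟩ := z
  simp only [levelKernel, Prod.mk.injEq]
  rcases lt_trichotomy k n with hk | rfl | hk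
  · obtain ⟨j, rfl⟩ := Nat.exists_eq_add_of_lt hk
    rw [if_pos (by omega), show k + j + 1 + 1 - k = j + 2 by omega,
      show k + j + 1 - k = j + 1 by omega, transFun_eq_sum h]
    simp only [if_pos hk, show ¬ (k = k + j + 1) by omega, false_and, if_false, zero_div, Finset.sum_const_zero,
      sub_zero, neg_div, Finset.sum_neg_distrib, neg_neg, Finset.sum_div]
    exact Finset.sum_congr rfl fun _ _ => by ring
  · rw [if_pos (by omega), show k + 1 - k = 1 by omega, transFun_one h]
    simp only [lt_irrefl, if_false, zero_div, Finset.sum_const_zero, neg_zero, zero_sub, true_and]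
    rw [neg_div, neg_inj]
    simp only [ite_div, one_div, zero_div]
    rw [Finset.sum_ite_eq]
    simp
  · rw [if_neg (by omega)]
    simp [show ¬ k < n by omega, show ¬ k = n by omega]

/-- Duhamel's formula for the level recursion. Without the tilt the solution is a Taylor
coefficient; at each `z i` the tilt adds a source `s` times the tilted function itself, carried
upwards by `levelKernel`. Evaluated at the points this is the relation `A = c + s A T`. -/
theorem rowFun_tiltedWeight (h : UniformlyBounded lam) (t : ℝ) (s : ℂ) (z : Fin m → ℕ × ℕ)
    (n l x : ℕ) :
    rowFun (fun i => taylorCoeff lam t i 0) (tiltedWeight lam s z) n l x =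
      (if l < n then taylorCoeff lam t (n - 1 - l) x else 0) +
        s * ∑ i, rowFun (fun i => taylorCoeff lam t i 0) (tiltedWeight lam s z) (z i).1 l (z i).2 *
          levelKernel lam (z i) (n, x) := by
  induction n generalizing x with
  | zero => simp [rowFun, levelKernel]
  | succ n ih =>
    set A := rowFun (fun i => taylorCoeff lam t i 0) (tiltedWeight lam s z) with hA
    by_cases hl : l < n
    · obtain ⟨d, rfl⟩ := Nat.exists_eq_add_of_lt hl
      have h1 : A (l + d + 1 + 1) l x = taylorCoeff lam t (d + 1) 0 -
          ∑ y ∈ Finset.range x, A (l + d + 1) l y * tiltedWeight lam s z (l + d + 1) y := by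
        rw [hA, rowFun, if_pos hl, show l + d + 1 - l = d + 1 by omega]
      have h2 : ∀ y, A (l + d + 1) l y * tiltedWeight lam s z (l + d + 1) y =
          taylorCoeff lam t d y / lam y +
            s * ∑ i, A (z i).1 l (z i).2 * (levelKernel lam (z i) (l + d + 1, y) / lam y +
              (if z i = (l + d + 1, y) then 1 else 0) / lam y) := by
        intro y
        have h3 : A (l + d + 1) l y * ∑ i, (if z i = (l + d + 1, y) then (1 : ℂ) else 0) =
            ∑ i, A (z i).1 l (z i).2 * (if z i = (l + d + 1, y) then 1 else 0) := by
          rw [Finset.mul_sum]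
          refine Finset.sum_congr rfl fun i _ => ?_
          split_ifs with hi
          · rw [hi]
          · simp
        have h4 : A (l + d + 1) l y = taylorCoeff lam t d y +
            s * ∑ i, A (z i).1 l (z i).2 * levelKernel lam (z i) (l + d + 1, y) := by
          rw [ih, if_pos hl, show l + d + 1 - 1 - l = d by omega]
        rw [tiltedWeight, mul_div_assoc', mul_add, mul_one, mul_left_comm, h3, h4]
        simp only [mul_add, Finset.sum_add_distrib, mul_div_assoc', ← Finset.sum_div]
        ring
      rw [h1, if_pos (by omega), show l + d + 1 + 1 - 1 - l = d + 1 by omega,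
        Finset.sum_congr rfl fun y _ => h2 y, Finset.sum_add_distrib, ← Finset.mul_sum,
        Finset.sum_comm, taylorCoeff_eq_sum h t d x]
      simp only [← Finset.mul_sum, Finset.sum_add_distrib]
      have h5 : ∀ i, A (z i).1 l (z i).2 * levelKernel lam (z i) (l + d + 1 + 1, x) =
          -(A (z i).1 l (z i).2 * (∑ y ∈ Finset.range x, levelKernel lam (z i) (l + d + 1, y) / lam y +
            ∑ y ∈ Finset.range x, (if z i = (l + d + 1, y) then 1 else 0) / (lam y : ℂ))) := by
        intro i
        rw [levelKernel_succ h]; ring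
      rw [Finset.sum_congr rfl fun i _ => h5 i, Finset.sum_neg_distrib]
      ring
    · have h1 : ∀ i, A (z i).1 l (z i).2 * levelKernel lam (z i) (n + 1, x) = 0 := by
        intro i
        by_cases hi : (z i).1 < n + 1
        · rw [hA, rowFun_of_le _ _ (by omega), zero_mul]
        · rw [levelKernel, if_neg hi, mul_zero]
      rw [Finset.sum_eq_zero fun i _ => h1 i, mul_zero, add_zero, hA, rowFun, if_neg hl]
      by_cases hln : l = n
      · rw [if_pos hln, if_pos (by omega), show n + 1 - 1 - l = 0 by omega, taylorCoeff_zero h]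
      · rw [if_neg hln, if_neg (by omega)]

/-- The free part pairs to the identity by biorthogonality. A source below the top passes through
`transFun`, which lowers the exponent by the number of levels crossed; a source on the top level
comes from the tilt of the top weight. Both give the same expression. -/
theorem tendsto_rowFun_mul_birthFun (h : UniformlyBounded lam) (t : ℝ) (s : ℂ)
    (z : Fin m → ℕ × ℕ) (N : ℕ) (hz : ∀ j, (z j).1 ≤ N) (l i : Fin N) :
    Tendsto (fun R => ∑ x ∈ Finset.range R,
      rowFun (fun i => taylorCoeff lam t i 0) (tiltedWeight lam s z) N l x *
        (birthFun lam (N - 1 - i) t (x + 1) * tiltedWeight lam s z N x)) atTop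
      (𝓝 ((if l = i then 1 else 0) + s * ∑ j,
        rowFun (fun i => taylorCoeff lam t i 0) (tiltedWeight lam s z) (z j).1 l (z j).2 *
          (birthFun lam ((z j).1 - 1 - i) t ((z j).2 + 1) / lam (z j).2))) := by
  set A := rowFun (fun i => taylorCoeff lam t i 0) (tiltedWeight lam s z) with hA
  set b : ℕ → ℂ := fun x => birthFun lam (N - 1 - i) t (x + 1) / lam x with hb
  have hterm : ∀ x, A N l x * (birthFun lam (N - 1 - i) t (x + 1) * tiltedWeight lam s z N x) =
      taylorCoeff lam t (N - 1 - l) x * b x + s * ∑ j, A (z j).1 l (z j).2 *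
        (levelKernel lam (z j) (N, x) * b x + (if z j = (N, x) then b x else 0)) := by
    intro x
    have h3 : A N l x * ∑ i, (if z i = (N, x) then (1 : ℂ) else 0) =
        ∑ i, A (z i).1 l (z i).2 * (if z i = (N, x) then 1 else 0) := by
      rw [Finset.mul_sum]
      refine Finset.sum_congr rfl fun i _ => ?_
      split_ifs with hi
      · rw [hi]
      · simp
    have h4 : A N l x = taylorCoeff lam t (N - 1 - l) x +
        s * ∑ i, A (z i).1 l (z i).2 * levelKernel lam (z i) (N, x) := by
      rw [hA, rowFun_tiltedWeight h, if_pos l.2]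
    have h5 : A N l x * (birthFun lam (N - 1 - i) t (x + 1) * tiltedWeight lam s z N x) =
        A N l x * b x + s * (A N l x * ∑ i, (if z i = (N, x) then (1 : ℂ) else 0)) * b x := by
      rw [tiltedWeight, hb]; ring
    rw [h5, h3, h4]
    simp only [mul_add, Finset.sum_add_distrib, add_mul, Finset.mul_sum, Finset.sum_mul]
    rw [add_assoc]
    congr 1
    congr 1
    · exact Finset.sum_congr rfl fun _ _ => by ring
    · refine Finset.sum_congr rfl fun _ _ => ?_
      split_ifs <;> ring
  simp only [hterm, Finset.sum_add_distrib]
  refine Tendsto.add ?_ ?_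
  · have h1 := tendsto_taylorCoeff_mul_birthFun h (N - 1 - l) (N - 1 - i) t
    have h2 : ((N - 1 - i : ℕ) : ℤ) = N - 1 - i := by have := i.2; omega
    rw [h2] at h1
    have h3 : (N - 1 - l = N - 1 - (i : ℕ)) ↔ l = i := by
      rw [Fin.ext_iff]; have := i.2; have := l.2; omega
    simpa only [h3] using h1
  · simp only [← Finset.mul_sum]
    refine Tendsto.const_mul s ?_
    simp only [Finset.sum_comm (s := Finset.range _), ← Finset.mul_sum]
    refine tendsto_finsetSum _ fun j _ => Tendsto.const_mul _ ?_
    simp only [Finset.sum_add_distrib]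
    rcases (hz j).lt_or_eq with hj | hj
    · obtain ⟨d, hd⟩ := Nat.exists_eq_add_of_lt hj
      have h1 := (tendsto_transFun_mul_birthFun h d (z j).2 (N - 1 - i) t).const_mul
        (-(lam (z j).2 : ℂ)⁻¹)
      have h2 : ∀ x, z j ≠ (N, x) := fun x e => by rw [e] at hj; simp at hj
      simp only [h2, if_false, Finset.sum_const_zero, add_zero]
      convert h1 using 2
      · rw [Finset.mul_sum]
        refine Finset.sum_congr rfl fun x _ => ?_
        rw [levelKernel, if_pos hj, show (N, x).1 - (z j).1 = d + 1 by simp only; omega]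
        simp only [hb]
        ring
      · rw [show (N : ℤ) - 1 - i - (d + 1) = (z j).1 - 1 - i by omega]
        ring
    · have h2 : ∀ x, levelKernel lam (z j) (N, x) = 0 := fun x => by
        rw [levelKernel, if_neg (by simp [hj])]
      simp only [h2, zero_mul, Finset.sum_const_zero, zero_add]
      refine tendsto_const_nhds.congr' ?_
      filter_upwards [eventually_gt_atTop (z j).2] with R hR
      rw [Finset.sum_eq_single_of_mem (z j).2 (Finset.mem_range.2 hR)]
      · rw [if_pos (by rw [← hj]), hb, hj]
      · intro x _ hx
        rw [if_neg]
        intro e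
        rw [e] at hx
        exact hx rfl

/-- The generating function of the correlations. -/
theorem tendsto_det_rowFun (h : UniformlyBounded lam) (t : ℝ) (s : ℂ)
    (z : Fin m → ℕ × ℕ) (N : ℕ) (hz : ∀ j, (z j).1 ≤ N) {C C₀ : ℝ → ℂ}
    (hC : AdmissibleContours lam C C₀) :
    Tendsto (fun R => (Matrix.of fun l i : Fin N => ∑ x ∈ Finset.range R,
      rowFun (fun i => taylorCoeff lam t i 0) (tiltedWeight lam s z) N l x *
        (birthFun lam (N - 1 - i) t (x + 1) * tiltedWeight lam s z N x)).det) atTop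
      (𝓝 (1 + s • Matrix.of fun i j => corrKernel lam C C₀ t (z i) (z j)).det) := by
  set A : Matrix (Fin N) (Fin m) ℂ := Matrix.of fun l j =>
    rowFun (fun i => taylorCoeff lam t i 0) (tiltedWeight lam s z) (z j).1 l (z j).2 with hA
  set γ : Matrix (Fin m) (Fin N) ℂ := Matrix.of fun j i =>
    birthFun lam ((z j).1 - 1 - i) t ((z j).2 + 1) / lam (z j).2 with hγ
  set c : Matrix (Fin N) (Fin m) ℂ := Matrix.of fun l j =>
    if (l : ℕ) < (z j).1 then taylorCoeff lam t ((z j).1 - 1 - l) (z j).2 else 0 with hc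
  set T : Matrix (Fin m) (Fin m) ℂ := Matrix.of fun i j => levelKernel lam (z i) (z j) with hT
  have h1 := det_one_add_of_eq_add A c γ T s (fun i => (z i).1)
    (fun i j hij => by simp [hT, levelKernel, hij]) (by
      ext l j
      simp only [hA, hc, hT, Matrix.add_apply, Matrix.smul_apply, Matrix.mul_apply, Matrix.of_apply,
        smul_eq_mul]
      rw [rowFun_tiltedWeight h])
  have h2 : γ * c - T = Matrix.of fun i j => corrKernel lam C C₀ t (z i) (z j) := by
    ext i j
    simp only [hγ, hc, hT, Matrix.sub_apply, Matrix.mul_apply, Matrix.of_apply]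
    rw [corrKernel_eq h hC, mul_add, levelKernel, sub_eq_neg_add]
    congr 1
    · split_ifs <;> ring
    · rw [Fin.sum_univ_eq_sum_range (fun l => birthFun lam ((z i).1 - 1 - l) t ((z i).2 + 1) /
        lam (z i).2 * if l < (z j).1 then taylorCoeff lam t ((z j).1 - 1 - l) (z j).2 else 0) N,
        ← Finset.sum_range_reflect _ (z j).1, Finset.mul_sum]
      symm
      refine Finset.sum_subset_zero_on_sdiff (fun l hl => ?_) (fun l hl => ?_) (fun l hl => ?_)
      · have := hz j
        simp only [Finset.mem_range] at hl ⊢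
        omega
      · rw [Finset.mem_sdiff, Finset.mem_range, Finset.mem_range] at hl
        rw [if_neg hl.2, mul_zero]
      · rw [Finset.mem_range] at hl
        rw [if_pos hl, show ((z i).1 : ℤ) - (z j).1 + ((z j).1 - 1 - l : ℕ) = (z i).1 - 1 - l by omega]
        ring
  -- The `m × m` determinant of the kernel becomes the `N × N` determinant `det (1 + s A γ)`, whose
  -- entries are the limits of the pairings.
  rw [← h2, ← h1]
  refine ((continuous_id (X := Matrix (Fin N) (Fin N) ℂ)).matrix_det.tendsto _).comp
    (tendsto_pi_nhds.2 fun l => tendsto_pi_nhds.2 fun i => ?_)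
  have h3 := tendsto_rowFun_mul_birthFun h t s z N hz l i
  have h4 : (1 + s • (A * γ) : Matrix (Fin N) (Fin N) ℂ) l i = (if l = i then 1 else 0) + s * ∑ j,
      rowFun (fun i => taylorCoeff lam t i 0) (tiltedWeight lam s z) (z j).1 l (z j).2 *
          (birthFun lam ((z j).1 - 1 - i) t ((z j).2 + 1) / lam (z j).2) := by
    simp [hA, hγ, Matrix.mul_apply, Matrix.one_apply]
  rw [← h4] at h3
  exact h3

end

/-! ### Sums over patterns -/

section
variable {N : ℕ}

/-- The top row of a pattern. -/
def GT.topRow (x : GT N) (k : Fin N) : ℕ := x.1 N (k + 1)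

theorem IsGT.le_top {x : ℕ → ℕ → ℕ} (hx : IsGT N x) (d : ℕ) :
    ∀ n k, 1 ≤ k → k ≤ n → n + d = N → x n k ≤ x N (k + d) := by
  induction d with
  | zero => rintro n k - - rfl; exact le_rfl
  | succ d ih =>
    intro n k h1 h2 h3
    have h4 := (hx.interlace n k h1 h2 (by omega)).2
    have h5 := ih (n + 1) (k + 1) (by omega) (by omega) (by omega)
    rw [show k + (d + 1) = k + 1 + d by omega]
    omega

theorem GT.lt_of_topRow_lt (x : GT N) {R : ℕ} (h : ∀ k, x.topRow k < R) {n k : ℕ} (h1 : 1 ≤ k)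
    (h2 : k ≤ n) (h3 : n ≤ N) : x.1 n k < R := by
  have h4 := x.2.le_top (N - n) n k h1 h2 (by omega)
  have h5 := h ⟨k + (N - n) - 1, by omega⟩
  rw [GT.topRow] at h5
  simp only [show k + (N - n) - 1 + 1 = k + (N - n) by omega] at h5
  omega

theorem GT.strictMono_topRow (x : GT N) : StrictMono x.topRow := by
  rcases N with _ | N
  · intro a; exact a.elim0
  · rw [Fin.strictMono_iff_lt_succ]
    intro i
    exact x.2.strict (N + 1) (i + 1) (by omega) (by have := i.2; omega) le_rfl

theorem GT.ext' {x y : GT N} (h : ∀ n k, 1 ≤ k → k ≤ n → n ≤ N → x.1 n k = y.1 n k) : x = y := by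
  refine Subtype.ext (funext fun n => funext fun k => ?_)
  by_cases hnk : 1 ≤ k ∧ k ≤ n ∧ n ≤ N
  · exact h n k hnk.1 hnk.2.1 hnk.2.2
  · rw [x.2.support n k hnk, y.2.support n k hnk]

theorem GT.finite_topRow_lt (N R : ℕ) : {x : GT N | ∀ k, x.topRow k < R}.Finite := by
  refine Set.Finite.of_injOn (f := fun (x : GT N) (n k : Fin (N + 1)) => x.1 n k)
    (t := Set.pi Set.univ fun _ => Set.pi Set.univ fun _ => Set.Iio (R + 1)) ?_ ?_
    (Set.Finite.pi fun _ => Set.Finite.pi fun _ => Set.finite_Iio _)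
  · intro x hx n _ k _
    by_cases h : 1 ≤ (k : ℕ) ∧ (k : ℕ) ≤ n ∧ (n : ℕ) ≤ N
    · exact (x.lt_of_topRow_lt hx h.1 h.2.1 h.2.2).trans (Nat.lt_succ_self R)
    · simp [x.2.support _ _ h]
  · intro x _ y _ hxy
    refine GT.ext' fun n k h1 h2 h3 => ?_
    exact congrFun (congrFun hxy ⟨n, by omega⟩) ⟨k, by omega⟩

/-- The patterns with all entries below `R`. -/
noncomputable def gtFin (N R : ℕ) : Finset (GT N) := (GT.finite_topRow_lt N R).toFinset

theorem mem_gtFin {R : ℕ} {x : GT N} : x ∈ gtFin N R ↔ ∀ k, x.topRow k < R := by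
  simp [gtFin]

theorem exists_mem_gtFin (x : GT N) : ∃ R, x ∈ gtFin N R := by
  refine ⟨(Finset.univ.sup x.topRow) + 1, mem_gtFin.2 fun k => Nat.lt_succ_of_le ?_⟩
  exact Finset.le_sup (f := x.topRow) (Finset.mem_univ k)

theorem gtFin_mono {R R' : ℕ} (h : R ≤ R') : gtFin N R ⊆ gtFin N R' := fun _ hx =>
  mem_gtFin.2 fun k => (mem_gtFin.1 hx k).trans_le h

instance : Countable (GT N) := by
  have : (Set.univ : Set (GT N)) = ⋃ R, (gtFin N R : Set (GT N)) := by
    ext x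
    simpa using exists_mem_gtFin x
  rw [← Set.countable_univ_iff, this]
  exact Set.countable_iUnion fun R => (gtFin N R).countable_toSet

/-- Dropping the top row. -/
def GT.res (x : GT (N + 1)) : GT N :=
  ⟨fun n k => if n ≤ N then x.1 n k else 0, by
    refine ⟨fun n k h => ?_, fun n k h1 h2 h3 => ?_, fun n k h1 h2 h3 => ?_⟩
    · by_cases hn : n ≤ N
      · simpa [hn] using x.2.support n k (fun h' => h ⟨h'.1, h'.2.1, hn⟩)
      · simp [hn]
    · simpa [h3] using x.2.strict n k h1 h2 (by omega)
    · simpa [h3, (by omega : n ≤ N)] using x.2.interlace n k h1 h2 (by omega)⟩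

theorem GT.res_apply (x : GT (N + 1)) {n : ℕ} (h : n ≤ N) (k : ℕ) : x.res.1 n k = x.1 n k :=
  if_pos h

theorem GT.topRow_interlace (x : GT (N + 1)) (k : Fin N) :
    x.topRow k.castSucc ≤ x.res.topRow k ∧ x.res.topRow k < x.topRow k.succ := by
  have := x.2.interlace N (k + 1) (by omega) k.2 le_rfl
  simpa [GT.topRow, GT.res_apply x le_rfl] using this

/-- Adding a top row. -/
def GT.addRow (x : GT N) (r : Fin (N + 1) → ℕ)
    (hr : ∀ k : Fin N, r k.castSucc ≤ x.topRow k ∧ x.topRow k < r k.succ) : GT (N + 1) :=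
  ⟨fun n k => if n = N + 1 then (if h : 1 ≤ k ∧ k ≤ N + 1 then r ⟨k - 1, by omega⟩ else 0)
      else x.1 n k, by
    have key : ∀ n k, 1 ≤ k → k ≤ n → n + 1 ≤ N + 1 →
      (if n + 1 = N + 1 then (if h : 1 ≤ k ∧ k ≤ N + 1 then r ⟨k - 1, by omega⟩ else 0)
        else x.1 (n + 1) k) ≤ (if n = N + 1 then (if h : 1 ≤ k ∧ k ≤ N + 1 then
          r ⟨k - 1, by omega⟩ else 0) else x.1 n k) ∧
      (if n = N + 1 then (if h : 1 ≤ k ∧ k ≤ N + 1 then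
          r ⟨k - 1, by omega⟩ else 0) else x.1 n k) <
      (if n + 1 = N + 1 then (if h : 1 ≤ k + 1 ∧ k + 1 ≤ N + 1 then r ⟨k + 1 - 1, by omega⟩ else 0)
        else x.1 (n + 1) (k + 1)) := by
      intro n k h1 h2 h3
      rw [if_neg (show ¬ n = N + 1 by omega)]
      by_cases hn : n = N
      · subst hn
        rw [if_pos rfl, if_pos rfl, dif_pos (by omega), dif_pos (by omega)]
        have := hr ⟨k - 1, by omega⟩
        simp only [GT.topRow, Fin.castSucc_mk, Fin.succ_mk, Nat.sub_add_cancel h1] at this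
        simpa using this
      · rw [if_neg (by omega), if_neg (by omega)]
        exact x.2.interlace n k h1 h2 (by omega)
    refine ⟨fun n k h => ?_, fun n k h1 h2 h3 => ?_, key⟩
    · split_ifs with h1 h2
      · omega
      · rfl
      · exact x.2.support n k (by omega)
    · obtain ⟨n, rfl⟩ : ∃ n', n = n' + 1 := ⟨n - 1, by omega⟩
      exact lt_of_le_of_lt (key n k h1 (by omega) h3).1 (key n k h1 (by omega) h3).2⟩

theorem GT.topRow_addRow (x : GT N) (r : Fin (N + 1) → ℕ)
    (hr : ∀ k : Fin N, r k.castSucc ≤ x.topRow k ∧ x.topRow k < r k.succ) :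
    (x.addRow r hr).topRow = r := by
  ext k
  have := k.2
  simp [GT.topRow, GT.addRow, show (k : ℕ) ≤ N by omega]

theorem GT.addRow_apply (x : GT N) (r : Fin (N + 1) → ℕ)
    (hr : ∀ k : Fin N, r k.castSucc ≤ x.topRow k ∧ x.topRow k < r k.succ) {n : ℕ} (hn : n ≤ N)
    (k : ℕ) : (x.addRow r hr).1 n k = x.1 n k := by
  simp [GT.addRow, show ¬ n = N + 1 by omega]

theorem GT.res_addRow (x : GT N) (r : Fin (N + 1) → ℕ)
    (hr : ∀ k : Fin N, r k.castSucc ≤ x.topRow k ∧ x.topRow k < r k.succ) :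
    (x.addRow r hr).res = x :=
  GT.ext' fun n k _ _ h3 => by rw [GT.res_apply _ h3, GT.addRow_apply _ _ _ h3]

theorem GT.eq_of_topRow_eq_of_res_eq {x y : GT (N + 1)} (h : x.topRow = y.topRow)
    (h' : x.res = y.res) : x = y := by
  refine GT.ext' fun n k h1 h2 h3 => ?_
  by_cases hn : n ≤ N
  · rw [← GT.res_apply x hn, h', GT.res_apply y hn]
  · obtain rfl : n = N + 1 := by omega
    have := congrFun h ⟨k - 1, by omega⟩
    simpa [GT.topRow, Nat.sub_add_cancel h1] using this

theorem GT.finite_topRow_eq (r : Fin N → ℕ) : {x : GT N | x.topRow = r}.Finite := by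
  refine (GT.finite_topRow_lt N (Finset.univ.sup r + 1)).subset fun x hx k => ?_
  rw [Set.mem_ofPred_eq] at hx
  rw [hx]
  exact Nat.lt_succ_of_le (Finset.le_sup (f := r) (Finset.mem_univ k))

/-- The patterns with a given top row. -/
noncomputable def gtFiber (r : Fin N → ℕ) : Finset (GT N) := (GT.finite_topRow_eq r).toFinset

theorem mem_gtFiber {r : Fin N → ℕ} {x : GT N} : x ∈ gtFiber r ↔ x.topRow = r := by
  simp [gtFiber]

/-- The product of the weights of the entries on the levels below `N`. -/
def lowerWeight (w : ℕ → ℕ → ℂ) (N : ℕ) (x : ℕ → ℕ → ℕ) : ℂ :=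
  ∏ n ∈ Finset.range N, ∏ k ∈ Finset.range n, w n (x n (k + 1))

/-- A pattern with top row `r` is a row interlacing with `r` and a pattern below that row. -/
theorem sum_gtFiber_succ (w : ℕ → ℕ → ℂ) (r : Fin (N + 1) → ℕ) :
    ∑ x ∈ gtFiber r, lowerWeight w (N + 1) x.1 =
      ∑ q ∈ Fintype.piFinset fun k : Fin N => Finset.Ico (r k.castSucc) (r k.succ),
        (∏ k, w N (q k)) * ∑ x ∈ gtFiber q, lowerWeight w N x.1 := by
  simp only [Finset.mul_sum]
  rw [Finset.sum_sigma']
  refine Finset.sum_bij (fun x _ => ⟨x.res.topRow, x.res⟩) (fun x hx => ?_) (fun x hx y hy h => ?_)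
    (fun p hp => ?_) (fun x hx => ?_)
  · rw [Finset.mem_sigma, Fintype.mem_piFinset, mem_gtFiber]
    rw [mem_gtFiber] at hx
    refine ⟨fun k => ?_, rfl⟩
    rw [Finset.mem_Ico, ← hx]
    exact x.topRow_interlace k
  · rw [mem_gtFiber] at hx hy
    refine GT.eq_of_topRow_eq_of_res_eq (hx.trans hy.symm) ?_
    exact eq_of_heq (Sigma.mk.inj_iff.1 h).2
  · obtain ⟨q, x⟩ := p
    rw [Finset.mem_sigma, Fintype.mem_piFinset, mem_gtFiber] at hp
    obtain ⟨h1, h0⟩ := hp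
    simp only at h0 h1
    subst h0
    have h2 : ∀ k : Fin N, r k.castSucc ≤ x.topRow k ∧ x.topRow k < r k.succ := fun k =>
      Finset.mem_Ico.1 (h1 k)
    exact ⟨x.addRow r h2, mem_gtFiber.2 (x.topRow_addRow r h2), by
      rw [GT.res_addRow]⟩
  · simp only [lowerWeight]
    rw [Finset.prod_range_succ, mul_comm]
    congr 1
    · rw [← Fin.prod_univ_eq_prod_range (fun k => w N (x.1 N (k + 1))) N]
      exact Finset.prod_congr rfl fun k _ => by rw [GT.topRow, GT.res_apply _ le_rfl]
    · refine Finset.prod_congr rfl fun n hn => Finset.prod_congr rfl fun k _ => ?_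
      rw [GT.res_apply _ (Finset.mem_range.1 hn).le]

/-- Induction on the level by `sum_interlacing_det`; the row of ones is the function that `rowFun`
introduces on the new level. -/
theorem sum_gtFiber (κ : ℕ → ℂ) (w : ℕ → ℕ → ℂ) (N : ℕ) :
    ∀ r : Fin N → ℕ, StrictMono r → ∑ x ∈ gtFiber r, lowerWeight w N x.1 =
      (Matrix.of fun l k : Fin N => rowFun κ w N l (r k)).det := by
  induction N with
  | zero =>
    intro r _
    have : gtFiber r = {densePacked 0} := by
      ext x
      rw [mem_gtFiber, Finset.mem_singleton]
      exact ⟨fun _ => GT.ext' fun n k h1 h2 h3 => by omega, fun _ => Subsingleton.elim _ _⟩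
    simp [this, lowerWeight]
  | succ N ih =>
    intro r hr
    rw [sum_gtFiber_succ, ← sum_interlacing_det (fun l => rowFun κ w N l) (fun l => κ (N - l)) (w N) r
      hr.monotone]
    · refine Finset.sum_congr rfl fun q hq => ?_
      rw [ih q]
      rw [Fintype.mem_piFinset] at hq
      rcases N with _ | N
      · intro a; exact a.elim0
      · rw [Fin.strictMono_iff_lt_succ]
        intro i
        have h1 := (Finset.mem_Ico.1 (hq i.castSucc)).2
        have h2 := (Finset.mem_Ico.1 (hq i.succ)).1
        rw [← Fin.succ_castSucc] at h2
        omega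
    · intro k; simp [rowFun]
    · intro l k; simp [rowFun]

/-- The sum over all patterns below `R` as a determinant. -/
theorem sum_gtFin (κ : ℕ → ℂ) (w : ℕ → ℕ → ℂ) (b : Fin N → ℕ → ℂ) (R : ℕ) :
    ∑ x ∈ gtFin N R, lowerWeight w (N + 1) x.1 * (Matrix.of fun i k => b i (x.topRow k)).det =
      (Matrix.of fun l i : Fin N => ∑ x ∈ Finset.range R,
        rowFun κ w N l x * (b i x * w N x)).det := by
  classical
  rw [← sum_rowSet_det_mul_det (fun l : Fin N => rowFun κ w N l) fun i x => b i x * w N x,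
    ← Finset.sum_fiberwise_of_maps_to (g := GT.topRow) (t := rowSet N R)]
  · refine Finset.sum_congr rfl fun r hr => ?_
    have h1 : {x ∈ gtFin N R | x.topRow = r} = gtFiber r := by
      ext x
      rw [Finset.mem_filter, mem_gtFin, mem_gtFiber]
      exact ⟨fun h => h.2, fun h => ⟨fun k => h ▸ (mem_rowSet.1 hr).1 k, h⟩⟩
    rw [h1, ← sum_gtFiber κ w N r (mem_rowSet.1 hr).2, Finset.sum_mul]
    refine Finset.sum_congr rfl fun x hx => ?_
    rw [mem_gtFiber] at hx
    have h2 := Matrix.det_mul_row (fun k => w N (r k)) (Matrix.of fun i k => b i (r k))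
    have h3 : (Matrix.of fun l k => b l (r k) * w N (r k)) =
        Matrix.of fun i j => w N (r j) * Matrix.of (fun i k => b i (r k)) i j := by
      ext; simp [mul_comm]
    rw [h3, h2, hx, ← mul_assoc]
    congr 1
    rw [lowerWeight, Finset.prod_range_succ, ← lowerWeight]
    congr 1
    rw [← Fin.prod_univ_eq_prod_range (fun k => w N (x.1 N (k + 1))) N, ← hx]
    rfl
  · intro x hx
    exact mem_rowSet.2 ⟨mem_gtFin.1 hx, x.strictMono_topRow⟩

end

/-! ### Push chains -/

/-- If particle `k` on level `n` jumps, it pushes exactly the particles above it on its diagonal, up to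
level `n + r`. -/
structure PushChain (N : ℕ) (y : ℕ → ℕ → ℕ) (n k r : ℕ) : Prop where
  le : n + r ≤ N
  eq : ∀ a b, n ≤ a → a < n + r → a + k = b + n → y a b + 1 = y (a + 1) (b + 1)
  unpushed : n + r < N → y (n + r) (k + r) + 1 < y (n + r + 1) (k + r + 1)

section
variable {N : ℕ} {x y : ℕ → ℕ → ℕ}

theorem exists_pushChain (hy : IsGT N y) (d : ℕ) :
    ∀ {n k}, 1 ≤ k → k ≤ n → n + d = N → ∃ r, PushChain N y n k r := by
  induction d with
  | zero => intro n k _ _ h; exact ⟨0, by omega, by omega, by omega⟩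
  | succ d ih =>
    intro n k h1 h2 h3
    have h4 := (hy.interlace n k h1 h2 (by omega)).2
    rcases Nat.lt_or_ge (y n k + 1) (y (n + 1) (k + 1)) with h5 | h5
    · exact ⟨0, by omega, by omega, fun _ => by simpa using h5⟩
    · obtain ⟨r, hr⟩ := ih (n := n + 1) (k := k + 1) (by omega) (by omega) (by omega)
      refine ⟨r + 1, by have := hr.le; omega, fun a b ha hb hab => ?_, fun h => ?_⟩
      · rcases ha.eq_or_lt with rfl | ha
        · obtain rfl : b = k := by omega
          omega
        · exact hr.eq a b ha (by omega) (by omega)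
      · have := hr.unpushed (by omega)
        rwa [show n + 1 + r = n + (r + 1) by omega, show k + 1 + r = k + (r + 1) by omega] at this

theorem PushChain.moves_iff {n k r : ℕ} (h : PushChain N y n k r) (a b : ℕ) :
    Moves N y n k a b ↔ n ≤ a ∧ a ≤ n + r ∧ a + k = b + n := by
  constructor
  · intro hm
    induction hm with
    | self => omega
    | @push m j _ h2 h3 ih =>
      refine ⟨by omega, ?_, by omega⟩
      by_contra h4
      obtain rfl : m = n + r := by omega
      obtain rfl : j = k + r := by omega
      exact h3 (h.unpushed (by omega))
  · rintro ⟨h1, h2, h3⟩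
    obtain ⟨i, rfl⟩ := Nat.exists_eq_add_of_le h1
    obtain rfl : b = k + i := by omega
    clear h1 h3
    induction i with
    | zero => exact Moves.self
    | succ i ih =>
      have h4 := h.eq (n + i) (k + i) (by omega) (by omega) (by omega)
      have h5 := h.le
      exact Moves.push (ih (by omega)) (show n + i + 1 ≤ N by omega)
        (show ¬ (y (n + i) (k + i) + 1 < y (n + i + 1) (k + i + 1)) by omega)

/-- `x` arises from `y` by an unblocked jump of particle `k` on level `n`, which pushes the particles
up to level `n + r`. -/
structure IsPush (N : ℕ) (y : ℕ → ℕ → ℕ) (n k r : ℕ) (x : ℕ → ℕ → ℕ) : Prop where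
  one_le : 1 ≤ k
  le : k ≤ n
  chain : PushChain N y n k r
  not_blocked : ¬ Blocked y n k
  apply : ∀ a b, x a b = if n ≤ a ∧ a ≤ n + r ∧ a + k = b + n then y a b + 1 else y a b

/-- The particle `j` on level `m` may have been the last one to move. -/
def Removable (N : ℕ) (x : ℕ → ℕ → ℕ) (m j : ℕ) : Prop :=
  (m < N → x (m + 1) j < x m j) ∧ (m = N → 0 < x N j ∧ (1 < j → x N (j - 1) + 1 < x N j))

theorem IsPush.apply_of_mem {n k r : ℕ} (h : IsPush N y n k r x) {a b : ℕ} (h1 : n ≤ a)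
    (h2 : a ≤ n + r) (h3 : a + k = b + n) : x a b = y a b + 1 := by
  rw [h.apply, if_pos ⟨h1, h2, h3⟩]

theorem IsPush.apply_of_notMem {n k r : ℕ} (h : IsPush N y n k r x) {a b : ℕ}
    (h1 : ¬ (n ≤ a ∧ a ≤ n + r ∧ a + k = b + n)) : x a b = y a b := by
  rw [h.apply, if_neg h1]

/-! ### Reconstructing a push from the last particle that moved -/

theorem IsPush.removable {n k r : ℕ} (hy : IsGT N y) (h : IsPush N y n k r x) :
    Removable N x (n + r) (k + r) := by
  have h1 := h.one_le
  have h2 := h.le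
  have h3 := h.apply_of_mem (a := n + r) (b := k + r) (by omega) le_rfl (by omega)
  refine ⟨fun hm => ?_, fun hm => ?_⟩
  · have h4 := (hy.interlace (n + r) (k + r) (by omega) (by omega) (by omega)).1
    rw [h.apply_of_notMem (a := n + r + 1) (by omega)]
    omega
  · rw [← hm, h3]
    refine ⟨by omega, fun hj => ?_⟩
    have h4 := hy.strict (n + r) (k + r - 1) (by omega) (by omega) (by omega)
    rw [Nat.sub_add_cancel (by omega)] at h4
    rw [h.apply_of_notMem (b := k + r - 1) (by omega)]
    omega

/-- If the second chain were longer, it would contain the diagonal predecessor of the first chain's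
starter, at distance exactly one in `x`. That predecessor does not move in the first push, so in `y`
the two would coincide, against strict interlacing. -/
theorem IsPush.length_le {n k r n' k' r' : ℕ} {y' : ℕ → ℕ → ℕ} (hy : IsGT N y)
    (h : IsPush N y n k r x) (h' : IsPush N y' n' k' r' x) (hn : n + r = n' + r')
    (hk : k + r = k' + r') : r' ≤ r := by
  by_contra hlt
  have h1 := h.one_le
  have h2 := h.le
  have h3 := h'.one_le
  have h4 := h.chain.le
  have h6 := h'.chain.eq (n - 1) (k - 1) (by omega) (by omega) (by omega)
  rw [Nat.sub_add_cancel (by omega), Nat.sub_add_cancel (by omega)] at h6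
  have h7 := h'.apply_of_mem (a := n - 1) (b := k - 1) (by omega) (by omega) (by omega)
  have h8 := h'.apply_of_mem (a := n) (b := k) (by omega) (by omega) (by omega)
  have h9 := h.apply_of_notMem (a := n - 1) (b := k - 1) (by omega)
  have h10 := h.apply_of_mem (a := n) (b := k) (by omega) (by omega) (by omega)
  have h11 := (hy.interlace (n - 1) (k - 1) (by omega) (by omega) (by omega)).2
  rw [Nat.sub_add_cancel (by omega), Nat.sub_add_cancel (by omega)] at h11
  omega

/-- Walk down the diagonal while consecutive positions differ by exactly one; the walk ends at a gap
or at the first particle of a level. The end is the particle whose clock rang. -/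
theorem exists_downChain (x : ℕ → ℕ → ℕ) (hx : IsGT N x) (j : ℕ) :
    ∀ m, 1 ≤ j → j ≤ m → m ≤ N → ∃ n k r, 1 ≤ k ∧ k ≤ n ∧ m = n + r ∧ j = k + r ∧
      (∀ a b, n ≤ a → a < n + r → a + k = b + n → x a b + 1 = x (a + 1) (b + 1)) ∧
      (1 < k → x (n - 1) (k - 1) + 1 < x n k) := by
  induction j with
  | zero => intro m h; omega
  | succ j ih =>
    intro m _ hjm hm
    rcases Nat.eq_zero_or_pos j with rfl | hj
    · exact ⟨m, 1, 0, le_rfl, hjm, rfl, rfl, by omega, by omega⟩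
    · have h1 := (hx.interlace (m - 1) j hj (by omega) (by omega)).2
      rw [Nat.sub_add_cancel (by omega)] at h1
      rcases Nat.lt_or_ge (x (m - 1) j + 1) (x m (j + 1)) with h2 | h2
      · exact ⟨m, j + 1, 0, by omega, hjm, rfl, rfl, by omega, fun _ => by simpa using h2⟩
      · obtain ⟨n, k, r, h3, h4, h5, h6, h7, h8⟩ := ih (m - 1) hj (by omega) (by omega)
        refine ⟨n, k, r + 1, h3, h4, by omega, by omega, fun a b ha hb hab => ?_, h8⟩
        rcases Nat.lt_or_ge a (n + r) with h9 | h9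
        · exact h7 a b ha h9 hab
        · obtain rfl : a = m - 1 := by omega
          obtain rfl : b = j := by omega
          rw [Nat.sub_add_cancel (by omega)]
          omega

theorem Removable.exists_isPush (hx : IsGT N x) {m j : ℕ} (hj : 1 ≤ j) (hjm : j ≤ m) (hm : m ≤ N)
    (h : Removable N x m j) :
    ∃ (y : ℕ → ℕ → ℕ) (n k r : ℕ), IsGT N y ∧ IsPush N y n k r x ∧ m = n + r ∧ j = k + r := by
  obtain ⟨n, k, r, hk, hkn, rfl, rfl, heq, hstart⟩ := exists_downChain x hx j m hj hjm hm
  -- Room to step back is inherited down the chain: neighbours on the diagonal differ by one, and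
  -- interlacing transfers the strict inequality. If the chain ends on level `N`, the gap to the
  -- left neighbour starts the induction.
  have hdown : ∀ i, i ≤ r → n + r - i < N → x (n + r - i + 1) (k + r - i) < x (n + r - i) (k + r - i) := by
    intro i
    induction i with
    | zero => intro _ h1; exact h.1 h1
    | succ i ih =>
      intro hi _
      have h1 := heq (n + r - (i + 1)) (k + r - (i + 1)) (by omega) (by omega) (by omega)
      rw [show n + r - (i + 1) + 1 = n + r - i by omega, show k + r - (i + 1) + 1 = k + r - i by omega]
        at h1
      rw [show n + r - (i + 1) + 1 = n + r - i by omega]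
      rcases (show n + r - i ≤ N by omega).lt_or_eq with h2 | h2
      · have h3 := ih (by omega) h2
        have h4 := (hx.interlace (n + r - i) (k + r - (i + 1)) (by omega) (by omega) (by omega)).2
        rw [show k + r - (i + 1) + 1 = k + r - i by omega] at h4
        omega
      · obtain rfl : i = 0 := by omega
        have h3 := (h.2 (by omega)).2 (by omega)
        simp only [zero_add, Nat.sub_zero] at h1 h2 ⊢
        rw [← h2] at h3
        omega
  have hdown' : ∀ a b, n ≤ a → a ≤ n + r → a + k = b + n → a < N → x (a + 1) b < x a b := by
    intro a b h1 h2 h3 h4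
    have := hdown (n + r - a) (by omega) (by omega)
    rwa [show n + r - (n + r - a) = a by omega, show k + r - (n + r - a) = b by omega] at this
  have hpos : ∀ a b, n ≤ a → a ≤ n + r → a + k = b + n → 0 < x a b := by
    intro a b h1 h2 h3
    rcases (show a ≤ N by omega).lt_or_eq with h4 | rfl
    · have := hdown' a b h1 h2 h3 h4; omega
    · have := (h.2 (by omega)).1
      rwa [show b = k + r by omega]
  have key : ∀ a b, 1 ≤ b → b ≤ a → a + 1 ≤ N →
      (if n ≤ a + 1 ∧ a + 1 ≤ n + r ∧ a + 1 + k = b + n then x (a + 1) b - 1 else x (a + 1) b) ≤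
        (if n ≤ a ∧ a ≤ n + r ∧ a + k = b + n then x a b - 1 else x a b) ∧
      (if n ≤ a ∧ a ≤ n + r ∧ a + k = b + n then x a b - 1 else x a b) <
      (if n ≤ a + 1 ∧ a + 1 ≤ n + r ∧ a + 1 + k = b + 1 + n then x (a + 1) (b + 1) - 1
        else x (a + 1) (b + 1)) := by
    intro a b hb hba ha
    have hi := hx.interlace a b hb hba ha
    by_cases h1 : n ≤ a ∧ a ≤ n + r ∧ a + k = b + n
    · have h2 := hdown' a b h1.1 h1.2.1 h1.2.2 (by omega)
      rw [if_pos h1, if_neg (show ¬ (n ≤ a + 1 ∧ a + 1 ≤ n + r ∧ a + 1 + k = b + n) by omega)]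
      refine ⟨by omega, ?_⟩
      have h3 := hpos a b h1.1 h1.2.1 h1.2.2
      split_ifs <;> omega
    · rw [if_neg h1]
      refine ⟨by split_ifs <;> omega, ?_⟩
      split_ifs with h2
      · obtain rfl : n = a + 1 := by omega
        obtain rfl : k = b + 1 := by omega
        have := hstart (by omega)
        simp only [Nat.add_sub_cancel] at this
        omega
      · exact hi.2
  refine ⟨fun a b => if n ≤ a ∧ a ≤ n + r ∧ a + k = b + n then x a b - 1 else x a b, n, k, r,
    ⟨fun a b hab => ?_, fun a b h1 h2 h3 => ?_, key⟩,
    ⟨hk, hkn, ⟨hm, fun a b h1 h2 h3 => ?_, fun h1 => ?_⟩, ?_, fun a b => ?_⟩, rfl, rfl⟩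
  · rw [if_neg (by omega), hx.support a b hab]
  · obtain ⟨a, rfl⟩ : ∃ a', a = a' + 1 := ⟨a - 1, by omega⟩
    exact lt_of_le_of_lt (key a b h1 (by omega) h3).1 (key a b h1 (by omega) h3).2
  · have h4 := heq a b h1 h2 h3
    have h5 := hpos a b h1 (by omega) h3
    rw [if_pos (by omega), if_pos (by omega)]
    omega
  · have h4 := hpos (n + r) (k + r) (by omega) (by omega) (by omega)
    have h5 := (hx.interlace (n + r) (k + r) (by omega) (by omega) (by omega)).2
    rw [if_pos (by omega), if_neg (by omega)]
    omega
  · rintro ⟨h1, h2⟩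
    have h3 := hpos n k le_rfl (by omega) (by omega)
    have h4 := (hx.interlace (n - 1) k hk (by omega) (by omega)).1
    rw [Nat.sub_add_cancel (by omega)] at h4
    beta_reduce at h2
    rw [if_neg (by omega), if_pos (by omega)] at h2
    omega
  · split_ifs with h1
    · have := hpos a b h1.1 h1.2.1 h1.2.2; omega
    · rfl

theorem GT.ring_eq_iff {x y : GT N} {n k : ℕ} (hk : 1 ≤ k) (hkn : k ≤ n) (hn : n ≤ N)
    (hb : ¬ Blocked y.1 n k) : y.ring n k = x ↔ ∃ r, IsPush N y.1 n k r x.1 := by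
  have h1 : y.ring n k = ⟨pushArray N y.1 n k, isGT_pushArray y.2 hk hkn hn hb⟩ := by
    unfold GT.ring
    exact dif_pos (⟨⟨hk, hkn, hn⟩, hb⟩ : (1 ≤ k ∧ k ≤ n ∧ n ≤ N) ∧ ¬ Blocked y.1 n k)
  have h2 : ∀ r, PushChain N y.1 n k r → ∀ a b, pushArray N y.1 n k a b =
      if n ≤ a ∧ a ≤ n + r ∧ a + k = b + n then y.1 a b + 1 else y.1 a b := by
    intro r hr a b
    simp only [pushArray, hr.moves_iff]
  rw [h1]
  constructor
  · rintro rfl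
    obtain ⟨r, hr⟩ := exists_pushChain y.2 (N - n) hk hkn (by omega)
    exact ⟨r, hk, hkn, hr, hb, h2 r hr⟩
  · rintro ⟨r, hr⟩
    refine Subtype.ext (funext fun a => funext fun b => ?_)
    rw [hr.apply]
    exact h2 r hr.chain a b

theorem PushChain.unique {n k r r' : ℕ} (h : PushChain N y n k r) (h' : PushChain N y n k r') :
    r = r' := by
  by_contra hne
  rcases lt_or_gt_of_ne hne with hlt | hlt
  · have h1 := h.unpushed (by have := h'.le; omega)
    have h2 := h'.eq (n + r) (k + r) (by omega) (by omega) (by omega)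
    omega
  · have h1 := h'.unpushed (by have := h.le; omega)
    have h2 := h.eq (n + r') (k + r') (by omega) (by omega) (by omega)
    omega

end

/-! ### The density and its evolution -/

/-- The indices `(n, k)` with `1 ≤ k ≤ n ≤ N`. -/
def gtIndex (N : ℕ) : Finset (ℕ × ℕ) :=
  {p ∈ Finset.range (N + 1) ×ˢ Finset.range (N + 1) | 1 ≤ p.2 ∧ p.2 ≤ p.1}

theorem mem_gtIndex {N : ℕ} {p : ℕ × ℕ} : p ∈ gtIndex N ↔ 1 ≤ p.2 ∧ p.2 ≤ p.1 ∧ p.1 ≤ N := by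
  rw [gtIndex, Finset.mem_filter, Finset.mem_product, Finset.mem_range, Finset.mem_range]
  omega

theorem sum_gtIndex {M : Type*} [AddCommMonoid M] (N : ℕ) (f : ℕ → ℕ → M) :
    ∑ p ∈ gtIndex N, f p.1 p.2 = ∑ n ∈ Finset.Icc 1 N, ∑ k ∈ Finset.Icc 1 n, f n k := by
  refine Finset.sum_finset_product' _ _ _ fun p => ?_
  rw [mem_gtIndex, Finset.mem_Icc, Finset.mem_Icc]
  omega

theorem sum_range_succ_right {M : Type*} [AddCommMonoid M] (n : ℕ) (f : ℕ → M) :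
    ∑ k ∈ Finset.range n, f (k + 1) = ∑ k ∈ Finset.Icc 1 n, f k := by
  rw [Finset.range_eq_Ico, Finset.sum_Ico_add' f 0 n 1]
  rfl

theorem sum_gtIndex_range {M : Type*} [AddCommMonoid M] (N : ℕ) (f : ℕ → ℕ → M) :
    ∑ p ∈ gtIndex N, f p.1 p.2 =
      ∑ n ∈ Finset.range (N + 1), ∑ k ∈ Finset.range n, f n (k + 1) := by
  simp only [sum_range_succ_right]
  refine Finset.sum_finset_product' _ _ _ fun p => ?_
  rw [mem_gtIndex, Finset.mem_Icc, Finset.mem_range]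
  omega

theorem lowerWeight_eq_prod (w : ℕ → ℕ → ℂ) (N : ℕ) (x : ℕ → ℕ → ℕ) :
    lowerWeight w (N + 1) x = ∏ p ∈ gtIndex N, w p.1 (x p.1 p.2) := by
  have h := sum_gtIndex_range (M := Additive ℂ) N fun n k => Additive.ofMul (w n (x n k))
  exact (congrArg Additive.toMul h).symm

section
variable {lam : ℕ → ℝ} {N : ℕ}

/-- The product of the inverse rates at all particles. -/
noncomputable def invRateProd (lam : ℕ → ℝ) (N : ℕ) (x : ℕ → ℕ → ℕ) : ℂ :=
  ∏ p ∈ gtIndex N, (lam (x p.1 p.2) : ℂ)⁻¹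

theorem invRateProd_update (h : UniformlyBounded lam) {f g : ℕ → ℕ → ℕ} {a b : ℕ}
    (hab : (a, b) ∈ gtIndex N) (hfg : ∀ a' b', (a', b') ≠ (a, b) → f a' b' = g a' b') :
    lam (f a b) * invRateProd lam N f = lam (g a b) * invRateProd lam N g := by
  have h1 : ∀ p ∈ (gtIndex N).erase (a, b), (lam (f p.1 p.2) : ℂ)⁻¹ = (lam (g p.1 p.2) : ℂ)⁻¹ := by
    intro p hp
    rw [hfg p.1 p.2 (Finset.ne_of_mem_erase hp)]
  rw [invRateProd, invRateProd, ← Finset.mul_prod_erase _ _ hab, ← Finset.mul_prod_erase _ _ hab,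
    Finset.prod_congr rfl h1, mul_inv_cancel_left₀ (h.ne_zero _), mul_inv_cancel_left₀ (h.ne_zero _)]

/-- A pushing particle lands on the old position of the pushed one, so its new rate is the old rate
of the next. Moving the particles one at a time, through the arrays `B i`, all intermediate rates
cancel. -/
theorem IsPush.invRateProd_eq (h : UniformlyBounded lam) {y x : ℕ → ℕ → ℕ} {n k r : ℕ}
    (hp : IsPush N y n k r x) :
    lam (y n k) * invRateProd lam N y = lam (x (n + r) (k + r)) * invRateProd lam N x := by
  have h1 := hp.one_le
  have h2 := hp.le
  have h3 := hp.chain.le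
  let B : ℕ → ℕ → ℕ → ℕ := fun i a b =>
    if n ≤ a ∧ a ≤ n + i ∧ a + k = b + n then y a b + 1 else y a b
  have key : ∀ i, i ≤ r → lam (y n k) * invRateProd lam N y =
      lam (y (n + i) (k + i) + 1) * invRateProd lam N (B i) := by
    intro i
    induction i with
    | zero =>
      intro _
      rw [invRateProd_update h (f := y) (g := B 0) (a := n) (b := k) (mem_gtIndex.2 (by simp; omega))]
      · have : B 0 n k = y n k + 1 := if_pos (by omega)
        rw [this, add_zero, add_zero]
      · intro a b hab
        have : ¬ (n ≤ a ∧ a ≤ n + 0 ∧ a + k = b + n) := fun h' =>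
          hab (by rw [Prod.mk.injEq]; omega)
        simp only [B, if_neg this]
    | succ i ih =>
      intro hi
      have h4 := hp.chain.eq (n + i) (k + i) (by omega) (by omega) (by omega)
      rw [ih (by omega), h4]
      have h5 := invRateProd_update h (N := N) (f := B i) (g := B (i + 1)) (a := n + i + 1)
        (b := k + i + 1) (mem_gtIndex.2 (by simp; omega)) (by
          intro a b hab
          have : (n ≤ a ∧ a ≤ n + i ∧ a + k = b + n) ↔ (n ≤ a ∧ a ≤ n + (i + 1) ∧ a + k = b + n) := by
            refine ⟨by omega, fun h' => ⟨h'.1, ?_, h'.2.2⟩⟩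
            by_contra hlt
            exact hab (by rw [Prod.mk.injEq]; omega)
          simp only [B, this])
      have h6 : B i (n + i + 1) (k + i + 1) = y (n + i + 1) (k + i + 1) := if_neg (by omega)
      have h7 : B (i + 1) (n + i + 1) (k + i + 1) = y (n + i + 1) (k + i + 1) + 1 :=
        if_pos (by omega)
      rw [h6, h7] at h5
      exact h5
  have h8 : B r = x := funext fun a => funext fun b => (hp.apply a b).symm
  rw [key r le_rfl, h8, hp.apply_of_mem (a := n + r) (b := k + r) (by omega) le_rfl (by omega)]

open Classical in
-- Unblocked transitions into `x` correspond bijectively to the particles that may have moved last.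
-- If the last mover lies below level `N`, the top row is unchanged; otherwise only its own entry
-- was one less.
theorem sum_incoming (h : UniformlyBounded lam) (x : GT N) (D : (ℕ → ℕ) → ℂ) (S : Finset (GT N))
    (hS : ∀ y n k, GT.ring y n k = x → y ∈ S) :
    (∑ y ∈ S, ∑ p ∈ gtIndex N, if ¬ Blocked y.1 p.1 p.2 ∧ y.ring p.1 p.2 = x then
      (lam (y.1 p.1 p.2) : ℂ) * (invRateProd lam N y.1 * D (y.1 N)) else 0) =
    ∑ p ∈ gtIndex N, if Removable N x.1 p.1 p.2 then
      (lam (x.1 p.1 p.2) : ℂ) * (invRateProd lam N x.1 * if p.1 < N then D (x.1 N) else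
        D (Function.update (x.1 N) p.2 (x.1 N p.2 - 1))) else 0 := by
  rw [← Finset.sum_product', ← Finset.sum_filter, ← Finset.sum_filter]
  have hmem : ∀ q ∈ (S ×ˢ gtIndex N).filter
      (fun q => ¬ Blocked q.1.1 q.2.1 q.2.2 ∧ q.1.ring q.2.1 q.2.2 = x),
      ∃ r, IsPush N q.1.1 q.2.1 q.2.2 r x.1 := by
    intro q hq
    rw [Finset.mem_filter, Finset.mem_product, mem_gtIndex] at hq
    exact (GT.ring_eq_iff hq.1.2.1 hq.1.2.2.1 hq.1.2.2.2 hq.2.1).1 hq.2.2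
  choose! len hlen using hmem
  refine Finset.sum_bij (fun q _ => (q.2.1 + len q, q.2.2 + len q)) (fun q hq => ?_)
    (fun q hq q' hq' he => ?_) (fun p hp => ?_) (fun q hq => ?_)
  · have h1 := hlen q hq
    have h2 := h1.one_le
    have h3 := h1.le
    have h4 := h1.chain.le
    rw [Finset.mem_filter, mem_gtIndex]
    exact ⟨⟨by simp only; omega, by simp only; omega, h4⟩, h1.removable q.1.2⟩
  · have h1 := hlen q hq
    have h1' := hlen q' hq'
    rw [Prod.mk.injEq] at he
    have h2 := h1.length_le q.1.2 h1' he.1 he.2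
    have h3 := h1'.length_le q'.1.2 h1 he.1.symm he.2.symm
    obtain ⟨y, n, k⟩ := q
    obtain ⟨y', n', k'⟩ := q'
    simp only at h1 h1' he h2 h3
    obtain rfl : n = n' := by omega
    obtain rfl : k = k' := by omega
    congr 1
    refine Subtype.ext (funext fun a => funext fun b => ?_)
    have h4 := h1.apply a b
    have h5 := h1'.apply a b
    rw [show len (y', n, k) = len (y, n, k) by omega] at h5
    split_ifs at h4 h5 <;> omega
  · rw [Finset.mem_filter, mem_gtIndex] at hp
    obtain ⟨y, n, k, r, hy, hpush, h1, h2⟩ :=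
      hp.2.exists_isPush x.2 hp.1.1 hp.1.2.1 hp.1.2.2
    obtain ⟨y, rfl⟩ : ∃ y' : GT N, y'.1 = y := ⟨⟨y, hy⟩, rfl⟩
    have h3 := hpush.one_le
    have h4 := hpush.le
    have h5 := hpush.chain.le
    have h6 : y.ring n k = x :=
      (GT.ring_eq_iff h3 h4 (by omega) hpush.not_blocked).2 ⟨r, hpush⟩
    have h7 : (y, (n, k)) ∈ (S ×ˢ gtIndex N).filter
        (fun q => ¬ Blocked q.1.1 q.2.1 q.2.2 ∧ q.1.ring q.2.1 q.2.2 = x) := by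
      rw [Finset.mem_filter, Finset.mem_product, mem_gtIndex]
      exact ⟨⟨hS _ n k h6, h3, h4, by simp only; omega⟩, hpush.not_blocked, h6⟩
    refine ⟨(y, (n, k)), h7, ?_⟩
    rw [(hlen _ h7).chain.unique hpush.chain]
    exact Prod.ext h1.symm h2.symm
  · have h1 := hlen q hq
    have h2 := h1.one_le
    have h3 := h1.le
    have h4 := h1.chain.le
    simp only
    rw [← mul_assoc, ← mul_assoc, h1.invRateProd_eq h]
    congr 1
    split_ifs with h5
    · congr 1
      ext b
      exact (h1.apply_of_notMem (by omega)).symm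
    · congr 1
      have h6 : q.2.1 + len q = N := by omega
      ext b
      by_cases hb : b = q.2.2 + len q
      · subst hb
        rw [Function.update_self, h1.apply_of_mem (a := N) (by omega) (by omega) (by omega)]
        omega
      · rw [Function.update_of_ne hb]
        exact (h1.apply_of_notMem (by omega)).symm

open Classical in
-- Particle `k` on level `n` cannot have been the last mover exactly when it blocks particle `k` on
-- level `n + 1`. The two then share a position, so the missing gain and the missing loss carry the
-- same rate.
theorem sum_removable_add_top (f : ℕ → ℂ) (x : ℕ → ℕ → ℕ) (N : ℕ)
    (hx : ∀ n k, 1 ≤ k → k ≤ n → n + 1 ≤ N → x (n + 1) k ≤ x n k) :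
    (∑ n ∈ Finset.range N, ∑ k ∈ Finset.range n,
      if x (n + 1) (k + 1) < x n (k + 1) then f (x n (k + 1)) else 0) +
        ∑ k ∈ Finset.range N, f (x N (k + 1)) =
    ∑ n ∈ Finset.range (N + 1), ∑ k ∈ Finset.range n,
      if ¬ Blocked x n (k + 1) then f (x n (k + 1)) else 0 := by
  induction N with
  | zero => simp
  | succ N ih =>
    rw [Finset.sum_range_succ _ (N + 1), ← ih fun n k h1 h2 h3 => hx n k h1 h2 (by omega),
      Finset.sum_range_succ _ N, Finset.sum_range_succ _ N, Finset.sum_range_succ _ N, add_assoc,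
      add_assoc]
    congr 1
    have h1 : ¬ Blocked x (N + 1) (N + 1) := fun h => absurd h.1 (lt_irrefl _)
    rw [if_pos h1, ← add_assoc, ← add_assoc, ← Finset.sum_add_distrib, ← Finset.sum_add_distrib]
    congr 1
    refine Finset.sum_congr rfl fun k hk => ?_
    rw [Finset.mem_range] at hk
    have h2 := hx N (k + 1) (by omega) (by omega) le_rfl
    have h3 : Blocked x (N + 1) (k + 1) ↔ x N (k + 1) = x (N + 1) (k + 1) := by
      rw [Blocked, Nat.add_sub_cancel]
      exact ⟨fun h => h.2, fun h => ⟨by omega, h⟩⟩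
    rcases h2.lt_or_eq with h4 | h4
    · rw [if_pos h4, if_pos (fun h => by rw [h3] at h; omega)]
    · rw [if_neg (by omega), if_neg (not_not.2 (h3.2 h4.symm)), h4]
      ring

/-- The Karlin–McGregor type determinant of a row. -/
noncomputable def rowDet (lam : ℕ → ℝ) (N : ℕ) (t : ℝ) (r : ℕ → ℕ) : ℂ :=
  (Matrix.of fun i k : Fin N => birthFun lam (N - 1 - i) t (r (k + 1) + 1)).det

/-- The law of the pattern at time `t`, explicitly. -/
noncomputable def gtDensity (lam : ℕ → ℝ) (N : ℕ) (t : ℝ) (x : GT N) : ℂ :=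
  invRateProd lam N x.1 * rowDet lam N t (x.1 N)

theorem hasDerivAt_det {n : ℕ} {M M' : ℝ → Matrix (Fin n) (Fin n) ℂ} {t : ℝ}
    (h : ∀ i k, HasDerivAt (fun t => M t i k) (M' t i k) t) :
    HasDerivAt (fun t => (M t).det) (∑ k, ((M t).updateCol k fun i => M' t i k).det) t := by
  simp only [Matrix.det_apply]
  rw [Finset.sum_comm]
  refine HasDerivAt.fun_sum fun σ _ => ?_
  rw [← Finset.smul_sum]
  refine HasDerivAt.const_smul _ ?_
  refine (HasDerivAt.fun_finsetProd (u := Finset.univ) fun k _ => h (σ k) k).congr_deriv ?_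
  refine Finset.sum_congr rfl fun k _ => ?_
  rw [← Finset.mul_prod_erase _ _ (Finset.mem_univ k), smul_eq_mul, mul_comm]
  congr 1
  · simp
  · refine Finset.prod_congr rfl fun j hj => ?_
    rw [Matrix.updateCol_ne (Finset.ne_of_mem_erase hj)]

open Classical in
-- Differentiating one column gives `λ` times (column at the position one lower, minus the column).
-- If that step back is not allowed, the lowered column is zero (position `0`) or repeats the
-- preceding column (adjacent particles), so its determinant vanishes.
theorem hasDerivAt_rowDet (h : UniformlyBounded lam) (x : GT N) (t : ℝ) :
    HasDerivAt (fun t => rowDet lam N t (x.1 N))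
      (∑ k ∈ Finset.range N, (lam (x.1 N (k + 1)) : ℂ) *
        ((if Removable N x.1 N (k + 1) then
          rowDet lam N t (Function.update (x.1 N) (k + 1) (x.1 N (k + 1) - 1)) else 0) -
          rowDet lam N t (x.1 N))) t := by
  refine (hasDerivAt_det (M := fun t => Matrix.of fun i k : Fin N =>
    birthFun lam (N - 1 - i) t (x.1 N (k + 1) + 1)) (M' := fun t => Matrix.of fun i k : Fin N =>
    -birthFun lam (N - 1 - i + 1) t (x.1 N (k + 1) + 1)) fun i k =>
    hasDerivAt_birthFun h _ _ t).congr_deriv ?_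
  rw [← Fin.sum_univ_eq_sum_range (fun k => (lam (x.1 N (k + 1)) : ℂ) *
        ((if Removable N x.1 N (k + 1) then
          rowDet lam N t (Function.update (x.1 N) (k + 1) (x.1 N (k + 1) - 1)) else 0) -
          rowDet lam N t (x.1 N))) N]
  refine Finset.sum_congr rfl fun k _ => ?_
  set M : Matrix (Fin N) (Fin N) ℂ := Matrix.of fun i k : Fin N =>
    birthFun lam (N - 1 - i) t (x.1 N (k + 1) + 1) with hM
  have hcol : (fun i => Matrix.of (fun i k : Fin N =>
      -birthFun lam (N - 1 - i + 1) t (x.1 N (k + 1) + 1)) i k) =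
      (lam (x.1 N (k + 1)) : ℂ) • ((fun i : Fin N => birthFun lam (N - 1 - i) t (x.1 N (k + 1))) +
        (-1 : ℂ) • fun i => M i k) := by
    ext i
    simp only [Matrix.of_apply, birthFun_succ h, hM, Pi.smul_apply, Pi.add_apply, smul_eq_mul]
    ring
  rw [hcol, Matrix.det_updateCol_smul, Matrix.det_updateCol_add, Matrix.det_updateCol_smul,
    Matrix.updateCol_eq_self, neg_one_mul, ← sub_eq_add_neg,
    show rowDet lam N t (x.1 N) = M.det from rfl]
  congr 2
  split_ifs with hr
  · have h1 := (hr.2 rfl).1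
    rw [rowDet]
    congr 1
    ext i j
    by_cases hjk : j = k
    · subst hjk
      simp [Nat.sub_add_cancel h1]
    · rw [Matrix.updateCol_ne hjk]
      have : (j : ℕ) + 1 ≠ k + 1 := fun e => hjk (Fin.ext (by omega))
      simp [hM, Function.update_of_ne this]
  · have h2 : x.1 N (k + 1) = 0 ∨ (1 < (k : ℕ) + 1 ∧ x.1 N (k + 1) ≤ x.1 N k + 1) := by
      by_contra hcon
      push Not at hcon
      exact hr ⟨fun hlt => absurd hlt (lt_irrefl _), fun _ =>
        ⟨Nat.pos_of_ne_zero hcon.1, fun hk => by simpa using hcon.2 hk⟩⟩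
    rcases h2 with h2 | ⟨h2, h3⟩
    · refine Matrix.det_eq_zero_of_column_eq_zero k fun i => ?_
      rw [Matrix.updateCol_self, h2, show (N : ℤ) - 1 - i = ((N - 1 - i : ℕ) : ℤ) by
        have := i.2; omega, birthFun_nat_zero]
    · have h4 := x.2.strict N k (by omega) k.2 le_rfl
      have hne : (⟨k - 1, by have := k.2; omega⟩ : Fin N) ≠ k := by
        intro e; rw [Fin.ext_iff] at e; simp at e; omega
      refine Matrix.det_zero_of_column_eq hne fun i => ?_
      rw [Matrix.updateCol_ne hne, Matrix.updateCol_self, hM, Matrix.of_apply]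
      simp only [Nat.sub_add_cancel (show 1 ≤ (k : ℕ) by omega)]
      rw [show x.1 N k + 1 = x.1 N (k + 1) by omega]

end

/-! ### The forward equation for the density -/

section
variable {lam : ℕ → ℝ} {N : ℕ}

open Classical in
/-- The indicator function of a pattern. -/
noncomputable def GT.ind (x y : GT N) : ℝ := if y = x then 1 else 0

/-! ### Triangularity of the generator and the evolution of the density -/

theorem generator_eq_sum_gtIndex (f : GT N → ℝ) (x : GT N) :
    generator lam N f x = ∑ p ∈ gtIndex N, lam (x.1 p.1 p.2) * (f (x.ring p.1 p.2) - f x) :=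
  (sum_gtIndex N fun n k => lam (x.1 n k) * (f (x.ring n k) - f x)).symm

theorem GT.ring_of_blocked (x : GT N) {n k : ℕ} (h : Blocked x.1 n k) : x.ring n k = x := by
  unfold GT.ring
  exact dif_neg (fun h' => h'.2 h)

theorem GT.le_ring (x : GT N) (n k a b : ℕ) : x.1 a b ≤ (x.ring n k).1 a b := by
  by_cases h : (1 ≤ k ∧ k ≤ n ∧ n ≤ N) ∧ ¬ Blocked x.1 n k
  · have h1 : x.ring n k = ⟨pushArray N x.1 n k, isGT_pushArray x.2 h.1.1 h.1.2.1 h.1.2.2 h.2⟩ := by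
      unfold GT.ring
      exact dif_pos h
    rw [h1]
    simp only [pushArray]
    split_ifs <;> omega
  · have h1 : x.ring n k = x := by
      unfold GT.ring
      exact dif_neg h
    rw [h1]

theorem mem_gtFin_of_ring {R : ℕ} {x y : GT N} {n k : ℕ} (hx : x ∈ gtFin N R)
    (h : y.ring n k = x) : y ∈ gtFin N R :=
  mem_gtFin.2 fun j => ((h ▸ y.le_ring n k N (j + 1) : y.1 N (j + 1) ≤ x.1 N (j + 1))).trans_lt
    (mem_gtFin.1 hx j)

/-- The sum of all coordinates. -/
def GT.size (x : GT N) : ℕ := ∑ p ∈ gtIndex N, x.1 p.1 p.2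

theorem GT.size_lt_of_ring {x y : GT N} {n k : ℕ} (h : y.ring n k = x) (hne : y ≠ x) :
    y.size < x.size := by
  subst h
  refine Finset.sum_lt_sum (fun p _ => y.le_ring n k p.1 p.2) ?_
  by_contra hcon
  push Not at hcon
  refine hne (GT.ext' fun a b h1 h2 h3 => ?_)
  exact le_antisymm (y.le_ring n k a b) (hcon (a, b) (mem_gtIndex.2 ⟨h1, h2, h3⟩))

theorem generator_ind_of_ne (x y : GT N) (hne : y ≠ x) : generator lam N x.ind y =
    ∑ p ∈ gtIndex N, lam (y.1 p.1 p.2) * x.ind (y.ring p.1 p.2) := by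
  rw [generator_eq_sum_gtIndex]
  refine Finset.sum_congr rfl fun p _ => ?_
  rw [show x.ind y = 0 from if_neg hne, sub_zero]

theorem generator_ind_eq_zero {x y : GT N} (hne : y ≠ x) (h : x.size ≤ y.size) :
    generator lam N x.ind y = 0 := by
  rw [generator_ind_of_ne x y hne]
  refine Finset.sum_eq_zero fun p _ => ?_
  rw [GT.ind, if_neg fun h1 => absurd (GT.size_lt_of_ring h1 hne) (not_lt.2 h), mul_zero]

theorem generator_ind_nonneg (h : UniformlyBounded lam) {x y : GT N} (hne : y ≠ x) :
    0 ≤ generator lam N x.ind y := by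
  rw [generator_ind_of_ne x y hne]
  refine Finset.sum_nonneg fun p _ => mul_nonneg (h.pos _).le ?_
  rw [GT.ind]
  split_ifs <;> norm_num

open Classical in
theorem sum_generator_ind_mul_gtDensity (h : UniformlyBounded lam) (x : GT N) {R : ℕ}
    (hx : x ∈ gtFin N R) (t : ℝ) :
    ∑ y ∈ gtFin N R, (generator lam N x.ind y : ℂ) * gtDensity lam N t y =
      invRateProd lam N x.1 * ∑ k ∈ Finset.range N, (lam (x.1 N (k + 1)) : ℂ) *
        ((if Removable N x.1 N (k + 1) then
          rowDet lam N t (Function.update (x.1 N) (k + 1) (x.1 N (k + 1) - 1)) else 0) -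
          rowDet lam N t (x.1 N)) := by
  have h1 : ∀ y : GT N, (generator lam N x.ind y : ℂ) * gtDensity lam N t y =
      (∑ p ∈ gtIndex N, if ¬ Blocked y.1 p.1 p.2 ∧ y.ring p.1 p.2 = x then
        (lam (y.1 p.1 p.2) : ℂ) * (invRateProd lam N y.1 * rowDet lam N t (y.1 N)) else 0) -
      if y = x then ∑ p ∈ gtIndex N, (if ¬ Blocked x.1 p.1 p.2 then
        (lam (x.1 p.1 p.2) : ℂ) * gtDensity lam N t x else 0) else 0 := by
    intro y
    have h2 : (if y = x then ∑ p ∈ gtIndex N, (if ¬ Blocked x.1 p.1 p.2 then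
        (lam (x.1 p.1 p.2) : ℂ) * gtDensity lam N t x else 0) else 0) =
        ∑ p ∈ gtIndex N, if ¬ Blocked y.1 p.1 p.2 ∧ y = x then
          (lam (y.1 p.1 p.2) : ℂ) * gtDensity lam N t y else 0 := by
      by_cases hyx : y = x
      · subst hyx; simp
      · simp [hyx]
    rw [h2, ← Finset.sum_sub_distrib, generator_eq_sum_gtIndex, Complex.ofReal_sum, Finset.sum_mul]
    refine Finset.sum_congr rfl fun p _ => ?_
    rw [← gtDensity]
    by_cases hb : Blocked y.1 p.1 p.2
    · rw [y.ring_of_blocked hb]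
      simp [hb]
    · simp only [hb, not_false_eq_true, true_and, GT.ind]
      split_ifs <;> push_cast <;> ring
  simp only [h1]
  rw [Finset.sum_sub_distrib, Finset.sum_ite_eq' (gtFin N R) x, if_pos hx,
    sum_incoming h x (fun r => rowDet lam N t r) _ fun y n k hy => mem_gtFin_of_ring hx hy]
  have h3 := sum_removable_add_top (fun v => (lam v : ℂ) * gtDensity lam N t x) x.1 N
    fun n k h1 h2 h3 => (x.2.interlace n k h1 h2 h3).1
  rw [sum_gtIndex_range N (fun n k => if ¬ Blocked x.1 n k then
    (lam (x.1 n k) : ℂ) * gtDensity lam N t x else 0), ← h3,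
    sum_gtIndex_range N (fun n k => if Removable N x.1 n k then (lam (x.1 n k) : ℂ) *
      (invRateProd lam N x.1 * if n < N then rowDet lam N t (x.1 N) else
        rowDet lam N t (Function.update (x.1 N) k (x.1 N k - 1))) else 0),
    Finset.sum_range_succ]
  have h4 : (∑ n ∈ Finset.range N, ∑ k ∈ Finset.range n, if Removable N x.1 n (k + 1) then
      (lam (x.1 n (k + 1)) : ℂ) * (invRateProd lam N x.1 * if n < N then rowDet lam N t (x.1 N) else
        rowDet lam N t (Function.update (x.1 N) (k + 1) (x.1 N (k + 1) - 1))) else 0) =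
      ∑ n ∈ Finset.range N, ∑ k ∈ Finset.range n, if x.1 (n + 1) (k + 1) < x.1 n (k + 1) then
        (lam (x.1 n (k + 1)) : ℂ) * gtDensity lam N t x else 0 := by
    refine Finset.sum_congr rfl fun n hn => Finset.sum_congr rfl fun k _ => ?_
    have hn' := Finset.mem_range.1 hn
    have h5 : Removable N x.1 n (k + 1) ↔ x.1 (n + 1) (k + 1) < x.1 n (k + 1) :=
      ⟨fun h => h.1 hn', fun h => ⟨fun _ => h, fun e => absurd e hn'.ne⟩⟩
    simp only [h5, if_pos hn', gtDensity]
  rw [h4, add_sub_add_left_eq_sub, ← Finset.sum_sub_distrib, Finset.mul_sum]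
  refine Finset.sum_congr rfl fun k _ => ?_
  rw [gtDensity, if_neg (lt_irrefl N)]
  split_ifs <;> ring

theorem hasDerivAt_gtDensity (h : UniformlyBounded lam) (x : GT N) {R : ℕ}
    (hx : x ∈ gtFin N R) (t : ℝ) :
    HasDerivAt (fun t => gtDensity lam N t x)
      (∑ y ∈ gtFin N R, (generator lam N x.ind y : ℂ) * gtDensity lam N t y) t := by
  classical
  rw [sum_generator_ind_mul_gtDensity h x hx]
  exact (hasDerivAt_rowDet h x t).const_mul _

/-! ### Normalisation and initial condition -/

theorem lowerWeight_tiltedWeight {m : ℕ} (s : ℂ) (z : Fin m → ℕ × ℕ) (x : ℕ → ℕ → ℕ) :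
    lowerWeight (tiltedWeight lam s z) (N + 1) x = invRateProd lam N x *
      ∏ p ∈ gtIndex N, (1 + s * ∑ i, if z i = (p.1, x p.1 p.2) then 1 else 0) := by
  rw [lowerWeight_eq_prod, invRateProd, ← Finset.prod_mul_distrib]
  refine Finset.prod_congr rfl fun p _ => ?_
  rw [tiltedWeight]; ring

/-- The tilt is absorbed into the weights, after which `sum_gtFin` and `tendsto_det_rowFun` apply.
Positivity is not yet known, so the limit is along the exhaustion `gtFin`. -/
theorem tendsto_sum_gtDensity_mul (h : UniformlyBounded lam) (t : ℝ) {m : ℕ} (s : ℂ)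
    (z : Fin m → ℕ × ℕ) (hz : ∀ j, (z j).1 ≤ N) {C C₀ : ℝ → ℂ}
    (hC : AdmissibleContours lam C C₀) :
    Tendsto (fun R => ∑ x ∈ gtFin N R, gtDensity lam N t x *
      ∏ p ∈ gtIndex N, (1 + s * ∑ i, if z i = (p.1, x.1 p.1 p.2) then 1 else 0)) atTop
      (𝓝 (1 + s • Matrix.of fun i j => corrKernel lam C C₀ t (z i) (z j)).det) := by
  refine (tendsto_det_rowFun h t s z N hz hC).congr fun R => ?_
  rw [← sum_gtFin (fun i => taylorCoeff lam t i 0) (tiltedWeight lam s z)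
    (fun i x => birthFun lam (N - 1 - i) t (x + 1)) R]
  refine Finset.sum_congr rfl fun x _ => ?_
  rw [lowerWeight_tiltedWeight, gtDensity, rowDet]
  simp only [GT.topRow]
  ring

theorem UniformlyBounded.exists_admissibleContours (h : UniformlyBounded lam) :
    ∃ C C₀, AdmissibleContours lam C C₀ := by
  have hM := h.rateSup_pos
  have h1 := h.encirclesPoles_three
  have h2 := h.encirclesPoles (show rateSup lam < 2 * rateSup lam by linarith)
  refine ⟨_, _, h1.isContour, h1.encircles_zero, h1.encircles, h2.isContour, h2.encircles_zero, ?_⟩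
  rw [Set.disjoint_left]
  intro w hw hw'
  have h3 := norm_of_mem_circleContour (by linarith) hw
  have h4 := norm_of_mem_circleContour (by linarith) hw'
  linarith

theorem tendsto_sum_gtDensity (h : UniformlyBounded lam) (N : ℕ) (t : ℝ) :
    Tendsto (fun R => ∑ x ∈ gtFin N R, gtDensity lam N t x) atTop (𝓝 1) := by
  obtain ⟨C, C₀, hC⟩ := h.exists_admissibleContours
  have h1 := tendsto_sum_gtDensity_mul (N := N) h t 0 (fun i : Fin 0 => i.elim0)
    (fun i => i.elim0) hC
  simpa using h1

/-- For negative exponents there is nothing at positive positions at time zero, and each increase of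
the exponent is a lattice difference, which widens the support by one. -/
theorem birthFun_time_zero (h : UniformlyBounded lam) (n : ℕ) :
    ∀ x, n < x → birthFun lam n 0 (x + 1) = 0 := by
  induction n with
  | zero =>
    intro x hx
    obtain ⟨x, rfl⟩ := Nat.exists_eq_add_of_lt hx
    have h1 := birthFun_succ h (-((0 : ℕ) : ℤ) - 1) 0 (0 + x + 1)
    rw [birthFun_neg_time_zero h, birthFun_neg_time_zero h] at h1
    simpa using h1
  | succ n ih =>
    intro x hx
    obtain ⟨x, rfl⟩ := Nat.exists_eq_add_of_lt hx
    have h1 := birthFun_succ h n 0 (n + 1 + x + 1)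
    rw [ih _ (by omega), ih _ (by omega)] at h1
    simpa using h1

/-- Any other pattern has its rightmost top particle beyond the packed position, and then the last
column of the determinant is zero. -/
theorem gtDensity_zero_of_ne (h : UniformlyBounded lam) {x : GT N} (hx : x ≠ densePacked N) :
    gtDensity lam N 0 x = 0 := by
  rcases N with _ | N
  · exact absurd (GT.ext' fun n k h1 h2 h3 => by omega) hx
  have hlow : ∀ d n k, n + d = N + 1 → 1 ≤ k → k ≤ n → k - 1 ≤ x.1 n k := by
    intro d
    induction d with
    | zero =>
      intro n k hn hk hkn
      obtain rfl : n = N + 1 := by omega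
      clear hn
      induction k with
      | zero => omega
      | succ k ih =>
        rcases Nat.eq_zero_or_pos k with rfl | hk0
        · simp
        · have h1 := ih hk0 (by omega)
          have h2 := x.2.strict (N + 1) k hk0 hkn le_rfl
          omega
    | succ d ih =>
      intro n k hn hk hkn
      exact (ih (n + 1) k (by omega) hk (by omega)).trans
        (x.2.interlace n k hk hkn (by omega)).1
  have htop : N < x.1 (N + 1) (N + 1) := by
    by_contra hcon
    refine hx (GT.ext' fun n k h1 h2 h3 => ?_)
    have h4 := hlow (N + 1 - n) n k (by omega) h1 h2
    have h5 : ∀ d n k, n + d = N + 1 → 1 ≤ k → k ≤ n → x.1 n k ≤ k - 1 := by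
      intro d
      induction d with
      | zero =>
        intro n k hn hk hkn
        obtain rfl : n = N + 1 := by omega
        clear hn
        have : ∀ i k, k + i = N + 1 → 1 ≤ k → x.1 (N + 1) k + i ≤ N := by
          intro i
          induction i with
          | zero =>
            intro k hk _
            obtain rfl : k = N + 1 := by omega
            omega
          | succ i ih =>
            intro k hk hk1
            have h6 := ih (k + 1) (by omega) (by omega)
            have h7 := x.2.strict (N + 1) k hk1 (by omega) le_rfl
            omega
        have := this (N + 1 - k) k (by omega) hk
        omega
      | succ d ih =>
        intro n k hn hk hkn
        have h6 := ih (n + 1) (k + 1) (by omega) (by omega) (by omega)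
        have h7 := (x.2.interlace n k hk hkn (by omega)).2
        omega
    have h6 := h5 (N + 1 - n) n k (by omega) h1 h2
    have h7 : (densePacked (N + 1)).1 n k = k - 1 := if_pos ⟨h1, h2, h3⟩
    rw [h7]; omega
  rw [gtDensity, rowDet, Matrix.det_eq_zero_of_column_eq_zero (Fin.last N), mul_zero]
  intro i
  rw [Matrix.of_apply, show ((N + 1 : ℕ) : ℤ) - 1 - i = ((N - i : ℕ) : ℤ) by
    have := i.2; omega]
  exact birthFun_time_zero h _ _ (by rw [Fin.val_last]; omega)

/-- The value at the packed pattern is not computed: it carries all the mass, and the total mass is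
one. -/
theorem gtDensity_zero (h : UniformlyBounded lam) (x : GT N) :
    gtDensity lam N 0 x = ((densePacked N).ind x : ℂ) := by
  by_cases hx : x = densePacked N
  · subst hx
    have h1 : ∀ᶠ R in atTop, gtDensity lam N 0 (densePacked N) =
        ∑ x ∈ gtFin N R, gtDensity lam N 0 x := by
      obtain ⟨R, hR⟩ := exists_mem_gtFin (densePacked N)
      filter_upwards [eventually_ge_atTop R] with R' hR'
      rw [Finset.sum_eq_single_of_mem _ (gtFin_mono hR' hR)]
      intro x _ hx
      exact gtDensity_zero_of_ne h hx
    have h2 := tendsto_nhds_unique (tendsto_const_nhds.congr' h1) (tendsto_sum_gtDensity h N 0)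
    rw [h2, GT.ind, if_pos rfl, Complex.ofReal_one]
  · rw [gtDensity_zero_of_ne h hx, GT.ind, if_neg hx, Complex.ofReal_zero]

end

/-! ### Uniqueness for the forward equation -/

section
variable {lam : ℕ → ℝ} {N : ℕ}

instance : DiscreteMeasurableSpace (GT N) := ⟨fun _ => trivial⟩

/-- The only solution of the linear Volterra equation `w = c ∫ w` is zero. -/
theorem eq_zero_of_eq_integral {w : ℝ → ℝ} {c : ℝ}
    (hw : ∀ t, 0 ≤ t → IntervalIntegrable w volume 0 t)
    (h : ∀ t, 0 ≤ t → w t = ∫ s in (0 : ℝ)..t, c * w s) {t : ℝ} (ht : 0 ≤ t) : w t = 0 := by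
  have hcont : ContinuousOn w (Set.Icc 0 t) := by
    have h1 : ContinuousOn (fun r => ∫ s in (0 : ℝ)..r, c * w s) (Set.uIcc 0 t) :=
      intervalIntegral.continuousOn_primitive_interval
        (((intervalIntegrable_iff' (by simp)).1 (hw t ht)).const_mul c)
    rw [Set.uIcc_of_le ht] at h1
    exact h1.congr fun s hs => h s hs.1
  have hderiv : ∀ s ∈ Set.Ico 0 t, HasDerivWithinAt w (c * w s) (Set.Ici s) s := by
    intro s hs
    have hcs : ContinuousWithinAt (fun r => c * w r) (Set.Ioi s) s := by
      have h1 := (hcont.const_mul c) s ⟨hs.1, hs.2.le⟩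
      refine h1.mono_of_mem_nhdsWithin ?_
      filter_upwards [Ioc_mem_nhdsGT hs.2] with r hr using ⟨hs.1.trans hr.1.le, hr.2⟩
    have h1 : HasDerivWithinAt (fun r => ∫ s in (0 : ℝ)..r, c * w s) (c * w s) (Set.Ici s) s := by
      refine intervalIntegral.integral_hasDerivWithinAt_right ((hw s hs.1).const_mul c) ?_ hcs
      refine ⟨Set.Ioc s t, Ioc_mem_nhdsGT hs.2, ?_⟩
      have h2 := (hw t ht).const_mul c
      rw [intervalIntegrable_iff_integrableOn_Ioc_of_le ht] at h2
      exact (h2.mono_set (Set.Ioc_subset_Ioc_left hs.1)).aestronglyMeasurable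
    exact h1.congr (fun r hr => h r (hs.1.trans hr)) (h s hs.1)
  have h2 := norm_le_gronwallBound_of_norm_deriv_right_le (δ := 0) (K := |c|) (ε := 0) hcont hderiv
    (by rw [h 0 le_rfl]; simp) (fun s _ => by rw [norm_mul]; simp) t ⟨ht, le_rfl⟩
  rw [gronwallBound_ε0_δ0] at h2
  exact norm_le_zero_iff.1 h2

/-- Strong induction on the sum of the coordinates: only strictly smaller patterns feed `x`, and
they already carry zero, which leaves a scalar Volterra equation. -/
theorem eq_zero_of_forward {w : ℝ → GT N → ℝ}
    (hw : ∀ x t, 0 ≤ t → IntervalIntegrable (fun s => w s x) volume 0 t)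
    (h : ∀ x R, x ∈ gtFin N R → ∀ t, 0 ≤ t →
      w t x = ∫ s in (0 : ℝ)..t, ∑ y ∈ gtFin N R, generator lam N x.ind y * w s y)
    (x : GT N) {t : ℝ} (ht : 0 ≤ t) : w t x = 0 := by
  induction hn : x.size using Nat.strong_induction_on generalizing x t with
  | _ n ih =>
    obtain ⟨R, hR⟩ := exists_mem_gtFin x
    refine eq_zero_of_eq_integral (c := generator lam N x.ind x) (hw x) (fun t ht => ?_) ht
    rw [h x R hR t ht]
    refine intervalIntegral.integral_congr fun s hs => ?_
    rw [Set.uIcc_of_le ht] at hs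
    refine Finset.sum_eq_single_of_mem x hR fun y _ hy => ?_
    by_cases hyx : x.size ≤ y.size
    · rw [generator_ind_eq_zero hy hyx, zero_mul]
    · rw [ih y.size (by omega) y hs.1 rfl, mul_zero]

theorem GT.ind_eq_indicator (x : GT N) : x.ind = Set.indicator {x} 1 := by
  ext y
  by_cases h : y = x
  · simp [GT.ind, h]
  · simp [GT.ind, h]

theorem integral_ind (ν : Measure (GT N)) (x : GT N) : ∫ y, x.ind y ∂ν = ν.real {x} := by
  rw [GT.ind_eq_indicator]
  exact integral_indicator_one (MeasurableSet.singleton x)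

theorem generator_ind_eq_zero_of_notMem {x y : GT N} {R : ℕ} (hx : x ∈ gtFin N R)
    (hy : y ∉ gtFin N R) : generator lam N x.ind y = 0 := by
  rw [generator_ind_of_ne x y fun h => hy (h ▸ hx)]
  refine Finset.sum_eq_zero fun p _ => ?_
  rw [GT.ind, if_neg fun h => hy (mem_gtFin_of_ring hx h), mul_zero]

theorem integral_eq_sum_of_support {ν : Measure (GT N)} [IsFiniteMeasure ν] {f : GT N → ℝ}
    {S : Finset (GT N)} (hf : ∀ y ∉ S, f y = 0) : ∫ y, f y ∂ν = ∑ y ∈ S, f y * ν.real {y} := by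
  have h1 : f = fun y => ∑ x ∈ S, f x * x.ind y := by
    classical
    ext y
    simp only [GT.ind, mul_ite, mul_one, mul_zero, Finset.sum_ite_eq]
    split_ifs with h
    · rfl
    · exact hf y h
  conv_lhs => rw [h1]
  rw [integral_finsetSum]
  · exact Finset.sum_congr rfl fun x _ => by rw [integral_const_mul, integral_ind]
  · intro x _
    refine Integrable.const_mul ?_ _
    rw [GT.ind_eq_indicator]
    exact (integrable_const 1).indicator (MeasurableSet.singleton x)

/-- A family of probability measures on `GT N` which solves the forward equation of the push-block
dynamics from the densely packed pattern. -/
structure IsForwardSolution (lam : ℕ → ℝ) (N : ℕ) (ν : ℝ≥0 → Measure (GT N)) : Prop where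
  prob : ∀ t, IsProbabilityMeasure (ν t)
  meas : ∀ f : GT N → ℝ, (∃ C, ∀ x, |f x| ≤ C) →
    Measurable fun s : ℝ => ∫ x, f x ∂(ν s.toNNReal)
  eq : ∀ f : GT N → ℝ, (∃ C, ∀ x, |f x| ≤ C) → ∀ t : ℝ≥0, ∫ x, f x ∂(ν t) =
    f (densePacked N) + ∫ s in (0 : ℝ)..t, ∫ x, generator lam N f x ∂(ν s.toNNReal)

theorem GT.abs_ind_le (x y : GT N) : |x.ind y| ≤ 1 := by
  rw [GT.ind]
  split_ifs <;> norm_num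

theorem IsForwardSolution.measurable_real {ν : ℝ≥0 → Measure (GT N)}
    (hν : IsForwardSolution lam N ν) (x : GT N) :
    Measurable fun s : ℝ => (ν s.toNNReal).real {x} := by
  simpa only [integral_ind] using hν.meas x.ind ⟨1, x.abs_ind_le⟩

theorem IsForwardSolution.intervalIntegrable_real {ν : ℝ≥0 → Measure (GT N)}
    (hν : IsForwardSolution lam N ν) (x : GT N) (a b : ℝ) :
    IntervalIntegrable (fun s : ℝ => (ν s.toNNReal).real {x}) volume a b := by
  refine (intervalIntegrable_const (c := (1 : ℝ))).mono_fun
    (hν.measurable_real x).aestronglyMeasurable (ae_of_all _ fun s => ?_)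
  have := hν.prob s.toNNReal
  simp [abs_of_nonneg]

theorem IsForwardSolution.intervalIntegrable_sum {ν : ℝ≥0 → Measure (GT N)}
    (hν : IsForwardSolution lam N ν) (S : Finset (GT N)) (g : GT N → ℝ) (a b : ℝ) :
    IntervalIntegrable (fun s : ℝ => ∑ y ∈ S, g y * (ν s.toNNReal).real {y}) volume a b := by
  have h1 := IntervalIntegrable.sum S fun y _ => (hν.intervalIntegrable_real y a b).const_mul (g y)
  simpa only [Finset.sum_fn] using h1

theorem IsForwardSolution.real_eq {ν : ℝ≥0 → Measure (GT N)} (hν : IsForwardSolution lam N ν)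
    {x : GT N} {R : ℕ} (hx : x ∈ gtFin N R) (t : ℝ≥0) :
    (ν t).real {x} = x.ind (densePacked N) + ∫ s in (0 : ℝ)..t,
      ∑ y ∈ gtFin N R, generator lam N x.ind y * (ν s.toNNReal).real {y} := by
  have h1 := hν.eq x.ind ⟨1, x.abs_ind_le⟩ t
  rw [integral_ind] at h1
  rw [h1]
  congr 1
  refine intervalIntegral.integral_congr fun s _ => ?_
  have := hν.prob s.toNNReal
  exact integral_eq_sum_of_support fun y hy => generator_ind_eq_zero_of_notMem hx hy

theorem IsForwardSolution.unique {ν ν' : ℝ≥0 → Measure (GT N)} (hν : IsForwardSolution lam N ν)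
    (hν' : IsForwardSolution lam N ν') (t : ℝ≥0) : ν t = ν' t := by
  have := hν.prob t
  have := hν'.prob t
  refine Measure.ext_of_singleton fun x => ?_
  rw [← measureReal_eq_measureReal_iff, ← sub_eq_zero]
  have h1 := eq_zero_of_forward (lam := lam) (N := N)
    (w := fun s x => (ν s.toNNReal).real {x} - (ν' s.toNNReal).real {x})
    (fun x t _ => (hν.intervalIntegrable_real x 0 t).sub (hν'.intervalIntegrable_real x 0 t))
    (fun x R hx t ht => ?_) x t.2
  · simpa using h1
  · lift t to ℝ≥0 using ht
    rw [Real.toNNReal_coe, hν.real_eq hx, hν'.real_eq hx, add_sub_add_left_eq_sub,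
      ← intervalIntegral.integral_sub]
    · refine intervalIntegral.integral_congr fun s _ => ?_
      rw [← Finset.sum_sub_distrib]
      exact Finset.sum_congr rfl fun y _ => by ring
    · exact hν.intervalIntegrable_sum _ _ _ _
    · exact hν'.intervalIntegrable_sum _ _ _ _

end

/-! ### The law of the finite patterns -/

section
variable {lam : ℕ → ℝ} {N : ℕ}

/-- The integrating factor `exp (-c t)` removes the diagonal coefficient; the remaining inflow comes
from smaller patterns with nonnegative rates, so the product is monotone in time. -/
theorem nonneg_of_hasDerivAt_forward (hl : UniformlyBounded lam) {w : ℝ → GT N → ℝ}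
    (hw : ∀ x R, x ∈ gtFin N R → ∀ t, HasDerivAt (fun t => w t x)
      (∑ y ∈ gtFin N R, generator lam N x.ind y * w t y) t)
    (h0 : ∀ x, 0 ≤ w 0 x) (x : GT N) {t : ℝ} (ht : 0 ≤ t) : 0 ≤ w t x := by
  induction hn : x.size using Nat.strong_induction_on generalizing x t with
  | _ n ih =>
    classical
    obtain ⟨R, hR⟩ := exists_mem_gtFin x
    set c := generator lam N x.ind x with hc
    have hd : ∀ s, HasDerivAt (fun s => Real.exp (-c * s) * w s x)
        (Real.exp (-c * s) * ∑ y ∈ (gtFin N R).erase x, generator lam N x.ind y * w s y) s := by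
      intro s
      have h1 : HasDerivAt (fun s => Real.exp (-c * s)) (Real.exp (-c * s) * (-c)) s := by
        simpa using ((hasDerivAt_id s).const_mul (-c)).exp
      refine (h1.mul (hw x R hR s)).congr_deriv ?_
      rw [← Finset.add_sum_erase _ _ hR, ← hc]
      ring
    have hmono : MonotoneOn (fun s => Real.exp (-c * s) * w s x) (Set.Ici 0) := by
      refine monotoneOn_of_deriv_nonneg (convex_Ici 0)
        (fun s _ => (hd s).continuousAt.continuousWithinAt)
        (fun s _ => (hd s).differentiableAt.differentiableWithinAt) fun s hs => ?_
      rw [interior_Ici, Set.mem_Ioi] at hs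
      rw [(hd s).deriv]
      refine mul_nonneg (Real.exp_pos _).le (Finset.sum_nonneg fun y hy => ?_)
      have hyx := (Finset.mem_erase.1 hy).1
      by_cases hsz : x.size ≤ y.size
      · rw [generator_ind_eq_zero hyx hsz, zero_mul]
      · exact mul_nonneg (generator_ind_nonneg hl hyx) (ih y.size (by omega) y hs.le rfl)
    have h1 := hmono (Set.mem_Ici.2 le_rfl) (Set.mem_Ici.2 ht) ht
    simp only [mul_zero, Real.exp_zero, one_mul] at h1
    exact nonneg_of_mul_nonneg_right ((h0 x).trans h1) (Real.exp_pos _)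

theorem hasDerivAt_re_gtDensity (h : UniformlyBounded lam) (x : GT N) {R : ℕ}
    (hx : x ∈ gtFin N R) (t : ℝ) : HasDerivAt (fun t => (gtDensity lam N t x).re)
      (∑ y ∈ gtFin N R, generator lam N x.ind y * (gtDensity lam N t y).re) t := by
  refine (Complex.reCLM.hasFDerivAt.comp_hasDerivAt t (hasDerivAt_gtDensity h x hx t)).congr_deriv
    ?_
  rw [map_sum]
  exact Finset.sum_congr rfl fun y _ => Complex.re_ofReal_mul _ _

theorem hasDerivAt_im_gtDensity (h : UniformlyBounded lam) (x : GT N) {R : ℕ}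
    (hx : x ∈ gtFin N R) (t : ℝ) : HasDerivAt (fun t => (gtDensity lam N t x).im)
      (∑ y ∈ gtFin N R, generator lam N x.ind y * (gtDensity lam N t y).im) t := by
  refine (Complex.imCLM.hasFDerivAt.comp_hasDerivAt t (hasDerivAt_gtDensity h x hx t)).congr_deriv
    ?_
  rw [map_sum]
  exact Finset.sum_congr rfl fun y _ => Complex.im_ofReal_mul _ _

theorem gtDensity_re_nonneg (h : UniformlyBounded lam) (x : GT N) {t : ℝ} (ht : 0 ≤ t) :
    0 ≤ (gtDensity lam N t x).re := by
  refine nonneg_of_hasDerivAt_forward h (w := fun t x => (gtDensity lam N t x).re)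
    (fun x R hx t => hasDerivAt_re_gtDensity h x hx t) (fun x => ?_) x ht
  rw [gtDensity_zero h, Complex.ofReal_re, GT.ind]
  split_ifs <;> norm_num

theorem gtDensity_im (h : UniformlyBounded lam) (x : GT N) {t : ℝ} (ht : 0 ≤ t) :
    (gtDensity lam N t x).im = 0 := by
  -- The imaginary part and its negative both solve the forward equation with zero initial value, so
  -- both are nonnegative.
  refine le_antisymm ?_ ?_
  · have := nonneg_of_hasDerivAt_forward h (w := fun t x => -(gtDensity lam N t x).im)
      (fun x R hx t => by
        refine (hasDerivAt_im_gtDensity h x hx t).neg.congr_deriv ?_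
        rw [← Finset.sum_neg_distrib]
        exact Finset.sum_congr rfl fun y _ => by ring)
      (fun x => by rw [gtDensity_zero h, Complex.ofReal_im, neg_zero]) x ht
    linarith
  · exact nonneg_of_hasDerivAt_forward h (w := fun t x => (gtDensity lam N t x).im)
      (fun x R hx t => hasDerivAt_im_gtDensity h x hx t)
      (fun x => by rw [gtDensity_zero h, Complex.ofReal_im]) x ht

theorem tendsto_gtFin (N : ℕ) : Tendsto (gtFin N) atTop atTop :=
  tendsto_atTop_finset_of_monotone (fun _ _ => gtFin_mono) exists_mem_gtFin

theorem hasSum_gtDensity_re (h : UniformlyBounded lam) (N : ℕ) {t : ℝ} (ht : 0 ≤ t) :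
    HasSum (fun x : GT N => (gtDensity lam N t x).re) 1 := by
  have h1 : Tendsto (fun R => ∑ x ∈ gtFin N R, (gtDensity lam N t x).re) atTop (𝓝 1) := by
    have := (Complex.continuous_re.tendsto 1).comp (tendsto_sum_gtDensity h N t)
    simpa [Function.comp_def] using this
  have hmono : Monotone fun R => ∑ x ∈ gtFin N R, (gtDensity lam N t x).re := fun R R' hR =>
    Finset.sum_le_sum_of_subset_of_nonneg (gtFin_mono hR) fun x _ _ => gtDensity_re_nonneg h x ht
  have h2 : Summable fun x : GT N => (gtDensity lam N t x).re := by
    refine summable_of_sum_le (c := 1) (fun x => gtDensity_re_nonneg h x ht) fun u => ?_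
    obtain ⟨R, hR⟩ := (tendsto_atTop.1 (tendsto_gtFin N) u).exists
    exact (Finset.sum_le_sum_of_subset_of_nonneg hR fun x _ _ => gtDensity_re_nonneg h x ht).trans
      (hmono.ge_of_tendsto h1 R)
  have h3 := h2.hasSum
  rwa [tendsto_nhds_unique (h3.comp (tendsto_gtFin N)) h1] at h3

/-- The law at time `t` of the push-block dynamics on `GT N`. -/
noncomputable def gtLaw (lam : ℕ → ℝ) (N : ℕ) (t : ℝ≥0) : Measure (GT N) :=
  Measure.sum fun x => ENNReal.ofReal (gtDensity lam N t x).re • Measure.dirac x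

theorem isProbabilityMeasure_gtLaw (h : UniformlyBounded lam) (N : ℕ) (t : ℝ≥0) :
    IsProbabilityMeasure (gtLaw lam N t) := by
  constructor
  have h1 := hasSum_gtDensity_re h N t.coe_nonneg
  simp only [gtLaw, Measure.sum_apply _ MeasurableSet.univ, Measure.smul_apply, measure_univ,
    smul_eq_mul, mul_one]
  rw [← ENNReal.ofReal_tsum_of_nonneg (fun x => gtDensity_re_nonneg h x t.coe_nonneg) h1.summable,
    h1.tsum_eq, ENNReal.ofReal_one]

theorem gtLaw_real_singleton (h : UniformlyBounded lam) (t : ℝ≥0) (x : GT N) :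
    (gtLaw lam N t).real {x} = (gtDensity lam N t x).re := by
  rw [measureReal_def, gtLaw, Measure.sum_apply _ (MeasurableSet.singleton x), tsum_eq_single x]
  · simp [gtDensity_re_nonneg h x t.coe_nonneg]
  · intro y hy
    simp [hy]

/-! ### From indicators to bounded test functions by truncation -/

theorem abs_integral_le_of_bounded {f : GT N → ℝ} {C : ℝ} (hf : ∀ x, |f x| ≤ C)
    (ν : Measure (GT N)) [IsProbabilityMeasure ν] : |∫ x, f x ∂ν| ≤ C := by
  simpa using norm_integral_le_of_norm_le_const (μ := ν) (f := f) (ae_of_all _ hf)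

theorem abs_generator_le (h : UniformlyBounded lam) {f : GT N → ℝ} {C : ℝ}
    (hf : ∀ x, |f x| ≤ C) (x : GT N) :
    |generator lam N f x| ≤ (gtIndex N).card • (rateSup lam * (C + C)) := by
  rw [generator_eq_sum_gtIndex]
  refine (Finset.abs_sum_le_sum_abs _ _).trans (Finset.sum_le_card_nsmul _ _ _ fun p _ => ?_)
  rw [abs_mul, abs_of_pos (h.pos _)]
  exact mul_le_mul (h.le_rateSup _) ((abs_sub _ _).trans (add_le_add (hf _) (hf _)))
    (abs_nonneg _) h.rateSup_pos.le

/-- The restriction of a function to the patterns below `R`. -/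
noncomputable def cutoff (f : GT N → ℝ) (R : ℕ) (y : GT N) : ℝ := ∑ x ∈ gtFin N R, f x * x.ind y

theorem cutoff_eq_ite [DecidableEq (GT N)] (f : GT N → ℝ) (R : ℕ) (y : GT N) :
    cutoff f R y = if y ∈ gtFin N R then f y else 0 := by
  rw [cutoff, ← Finset.sum_ite_eq (gtFin N R) y]
  refine Finset.sum_congr rfl fun x _ => ?_
  rw [GT.ind]
  split_ifs <;> simp

theorem abs_cutoff_le {f : GT N → ℝ} {C : ℝ} (hf : ∀ x, |f x| ≤ C) (R : ℕ) (y : GT N) :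
    |cutoff f R y| ≤ C := by
  classical
  rw [cutoff_eq_ite]
  split_ifs
  · exact hf y
  · rw [abs_zero]
    exact (abs_nonneg _).trans (hf y)

theorem tendsto_cutoff (f : GT N → ℝ) (y : GT N) : Tendsto (fun R => cutoff f R y) atTop
    (𝓝 (f y)) := by
  classical
  obtain ⟨R, hR⟩ := exists_mem_gtFin y
  refine tendsto_const_nhds.congr' ?_
  filter_upwards [eventually_ge_atTop R] with R' hR'
  rw [cutoff_eq_ite, if_pos (gtFin_mono hR' hR)]

theorem generator_cutoff (f : GT N → ℝ) (R : ℕ) (y : GT N) :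
    generator lam N (cutoff f R) y = ∑ x ∈ gtFin N R, f x * generator lam N x.ind y := by
  simp only [generator_eq_sum_gtIndex, cutoff, Finset.mul_sum, ← Finset.sum_sub_distrib]
  rw [Finset.sum_comm]
  exact Finset.sum_congr rfl fun x _ => Finset.sum_congr rfl fun p _ => by ring

theorem generator_cutoff_eq_zero (f : GT N → ℝ) {R : ℕ} {y : GT N} (hy : y ∉ gtFin N R) :
    generator lam N (cutoff f R) y = 0 := by
  rw [generator_cutoff]
  exact Finset.sum_eq_zero fun x hx => by rw [generator_ind_eq_zero_of_notMem hx hy, mul_zero]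

theorem tendsto_generator_cutoff (f : GT N → ℝ) (y : GT N) :
    Tendsto (fun R => generator lam N (cutoff f R) y) atTop (𝓝 (generator lam N f y)) := by
  simp only [generator_eq_sum_gtIndex]
  exact tendsto_finsetSum _ fun p _ =>
    ((tendsto_cutoff f _).sub (tendsto_cutoff f y)).const_mul _

theorem integral_cutoff_gtLaw (h : UniformlyBounded lam) (f : GT N → ℝ) (R : ℕ) (t : ℝ≥0) :
    ∫ x, cutoff f R x ∂(gtLaw lam N t) = ∑ x ∈ gtFin N R, f x * (gtDensity lam N t x).re := by
  classical
  have := isProbabilityMeasure_gtLaw h N t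
  rw [integral_eq_sum_of_support (S := gtFin N R) fun y hy => by rw [cutoff_eq_ite, if_neg hy]]
  refine Finset.sum_congr rfl fun x hx => ?_
  rw [cutoff_eq_ite, if_pos hx, gtLaw_real_singleton h]

theorem continuous_gtDensity_re (h : UniformlyBounded lam) (x : GT N) :
    Continuous fun t => (gtDensity lam N t x).re := by
  obtain ⟨R, hR⟩ := exists_mem_gtFin x
  exact continuous_iff_continuousAt.2 fun t => (hasDerivAt_re_gtDensity h x hR t).continuousAt

theorem integral_cutoff_gtLaw_eq (h : UniformlyBounded lam) (f : GT N → ℝ) (R : ℕ) (t : ℝ≥0) :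
    ∫ x, cutoff f R x ∂(gtLaw lam N t) = cutoff f R (densePacked N) + ∫ s in (0 : ℝ)..t,
      ∫ x, generator lam N (cutoff f R) x ∂(gtLaw lam N s.toNNReal) := by
  have h1 : ∀ s : ℝ, HasDerivAt (fun s => ∑ x ∈ gtFin N R, f x * (gtDensity lam N s x).re)
      (∑ y ∈ gtFin N R, generator lam N (cutoff f R) y * (gtDensity lam N s y).re) s := by
    intro s
    refine (HasDerivAt.fun_sum fun x hx =>
      (hasDerivAt_re_gtDensity h x hx s).const_mul (f x)).congr_deriv ?_
    simp only [generator_cutoff, Finset.mul_sum, Finset.sum_mul]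
    rw [Finset.sum_comm]
    exact Finset.sum_congr rfl fun x _ => Finset.sum_congr rfl fun p _ => by ring
  have h2 := intervalIntegral.integral_eq_sub_of_hasDerivAt (a := 0) (b := (t : ℝ))
    (fun s _ => h1 s) ((continuous_finsetSum _ fun y _ =>
      (continuous_gtDensity_re h y).const_mul _).intervalIntegrable _ _)
  have h3 : ∑ x ∈ gtFin N R, f x * (gtDensity lam N 0 x).re = cutoff f R (densePacked N) := by
    refine Finset.sum_congr rfl fun x _ => ?_
    rw [gtDensity_zero h, Complex.ofReal_re, GT.ind, GT.ind]
    by_cases hx : x = densePacked N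
    · simp [hx]
    · rw [if_neg hx, if_neg (Ne.symm hx)]
  rw [h3, ← integral_cutoff_gtLaw h] at h2
  rw [eq_comm, ← eq_sub_iff_add_eq', ← h2]
  refine intervalIntegral.integral_congr fun s hs => ?_
  rw [Set.uIcc_of_le t.coe_nonneg] at hs
  have := isProbabilityMeasure_gtLaw h N s.toNNReal
  refine (integral_eq_sum_of_support fun y hy => generator_cutoff_eq_zero f hy).trans ?_
  refine Finset.sum_congr rfl fun y _ => ?_
  rw [gtLaw_real_singleton h, Real.coe_toNNReal s hs.1]

theorem tendsto_integral_of_bounded {g : ℕ → GT N → ℝ} {f : GT N → ℝ} {C : ℝ}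
    (hg : ∀ R x, |g R x| ≤ C) (hlim : ∀ x, Tendsto (fun R => g R x) atTop (𝓝 (f x)))
    (ν : Measure (GT N)) [IsFiniteMeasure ν] :
    Tendsto (fun R => ∫ x, g R x ∂ν) atTop (𝓝 (∫ x, f x ∂ν)) :=
  tendsto_integral_of_dominated_convergence (fun _ => C)
    (fun _ => Measurable.of_discrete.aestronglyMeasurable) (integrable_const C)
    (fun R => ae_of_all _ (hg R)) (ae_of_all _ hlim)

/-- For a truncated test function the equation is a finite sum of density equations. Boundedness of
the generator permits dominated convergence when the truncation is removed. -/
theorem isForwardSolution_gtLaw (h : UniformlyBounded lam) (N : ℕ) :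
    IsForwardSolution lam N (gtLaw lam N) := by
  have hp := isProbabilityMeasure_gtLaw h N
  have hmeas : ∀ f : GT N → ℝ, (∃ C, ∀ x, |f x| ≤ C) →
      Measurable fun s : ℝ => ∫ x, f x ∂(gtLaw lam N s.toNNReal) := by
    rintro f ⟨C, hf⟩
    refine measurable_of_tendsto_metrizable (f := fun R (s : ℝ) =>
      ∫ x, cutoff f R x ∂(gtLaw lam N s.toNNReal)) (fun R => ?_)
      (tendsto_pi_nhds.2 fun s => tendsto_integral_of_bounded (abs_cutoff_le hf)
        (tendsto_cutoff f) _)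
    simp only [integral_cutoff_gtLaw h]
    refine Continuous.measurable (continuous_finsetSum _ fun x _ => Continuous.const_mul ?_ _)
    exact (continuous_gtDensity_re h x).comp (NNReal.continuous_coe.comp continuous_real_toNNReal)
  refine ⟨hp, hmeas, ?_⟩
  rintro f ⟨C, hf⟩ t
  have hK := fun R => abs_generator_le h (abs_cutoff_le hf R)
  have h1 := tendsto_integral_of_bounded (abs_cutoff_le hf) (tendsto_cutoff f) (gtLaw lam N t)
  simp only [integral_cutoff_gtLaw_eq h] at h1
  refine tendsto_nhds_unique h1 ((tendsto_cutoff f _).add ?_)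
  refine intervalIntegral.tendsto_integral_filter_of_dominated_convergence
    (fun _ => (gtIndex N).card • (rateSup lam * (C + C)))
    (Eventually.of_forall fun R => (hmeas _ ⟨_, hK R⟩).aestronglyMeasurable)
    (Eventually.of_forall fun R => ae_of_all _ fun s _ => abs_integral_le_of_bounded (hK R) _)
    intervalIntegrable_const (ae_of_all _ fun s _ =>
      tendsto_integral_of_bounded hK (tendsto_generator_cutoff f) _)

end

/-! ### Consistency of the finite laws -/

section
variable {lam : ℕ → ℝ} {N : ℕ}

theorem moves_res_iff (x : GT (N + 1)) {n k m j : ℕ} (hm : m ≤ N) :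
    Moves N x.res.1 n k m j ↔ Moves (N + 1) x.1 n k m j := by
  constructor
  · intro h
    induction h with
    | self => exact .self
    | @push m j h1 h2 h3 ih =>
      rw [GT.res_apply x (by omega), GT.res_apply x hm] at h3
      exact (ih (by omega)).push (by omega) h3
  · intro h
    induction h with
    | self => exact .self
    | @push m j h1 h2 h3 ih =>
      rw [← GT.res_apply x (by omega), ← GT.res_apply x hm] at h3
      exact (ih (by omega)).push (by omega) h3

theorem Moves.le {x : ℕ → ℕ → ℕ} {n k m j : ℕ} (h : Moves N x n k m j) : n ≤ m := by
  induction h with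
  | self => exact le_rfl
  | push _ _ _ ih => omega

theorem GT.ring_apply (x : GT N) {n k : ℕ} (h1 : 1 ≤ k) (h2 : k ≤ n) (h3 : n ≤ N)
    (hb : ¬ Blocked x.1 n k) (m j : ℕ) : (x.ring n k).1 m j = pushArray N x.1 n k m j := by
  have h : x.ring n k = ⟨pushArray N x.1 n k, isGT_pushArray x.2 h1 h2 h3 hb⟩ := by
    unfold GT.ring
    exact dif_pos ⟨⟨h1, h2, h3⟩, hb⟩
  rw [h]

theorem GT.res_ring (x : GT (N + 1)) {n k : ℕ} (h1 : 1 ≤ k) (h2 : k ≤ n) (h3 : n ≤ N) :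
    (x.ring n k).res = x.res.ring n k := by
  have hbb : Blocked x.res.1 n k ↔ Blocked x.1 n k := by
    rw [Blocked, Blocked, GT.res_apply x h3, GT.res_apply x (by omega)]
  by_cases hb : Blocked x.1 n k
  · rw [x.ring_of_blocked hb, x.res.ring_of_blocked (hbb.2 hb)]
  · refine GT.ext' fun m j _ _ hm => ?_
    rw [GT.res_apply _ hm, x.ring_apply h1 h2 (by omega) hb,
      x.res.ring_apply h1 h2 h3 fun h => hb (hbb.1 h)]
    rw [pushArray, pushArray, GT.res_apply x hm]
    by_cases hmv : Moves (N + 1) x.1 n k m j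
    · rw [if_pos hmv, if_pos ((moves_res_iff x hm).2 hmv)]
    · rw [if_neg hmv, if_neg fun h => hmv ((moves_res_iff x hm).1 h)]

theorem GT.res_ring_top (x : GT (N + 1)) {k : ℕ} (h1 : 1 ≤ k) (h2 : k ≤ N + 1) :
    (x.ring (N + 1) k).res = x.res := by
  by_cases hb : Blocked x.1 (N + 1) k
  · rw [x.ring_of_blocked hb]
  · refine GT.ext' fun m j _ _ hm => ?_
    rw [GT.res_apply _ hm, x.ring_apply h1 h2 le_rfl hb, GT.res_apply _ hm, pushArray,
      if_neg fun h => ?_]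
    have := h.le
    omega

/-- Blocking and pushing act only upwards, so the lower levels evolve autonomously and jumps on the
top level are invisible to them. -/
theorem generator_comp_res (f : GT N → ℝ) (x : GT (N + 1)) :
    generator lam (N + 1) (fun y => f y.res) x = generator lam N f x.res := by
  rw [generator, Finset.sum_Icc_succ_top (by omega), generator]
  have h0 : ∑ k ∈ Finset.Icc 1 (N + 1), lam (x.1 (N + 1) k) *
      (f (x.ring (N + 1) k).res - f x.res) = 0 := by
    refine Finset.sum_eq_zero fun k hk => ?_
    rw [Finset.mem_Icc] at hk
    rw [x.res_ring_top hk.1 hk.2, sub_self, mul_zero]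
  rw [h0, add_zero]
  refine Finset.sum_congr rfl fun n hn => Finset.sum_congr rfl fun k hk => ?_
  rw [Finset.mem_Icc] at hn hk
  rw [x.res_ring hk.1 hk.2 hn.2, GT.res_apply x hn.2]

theorem densePacked_res (N : ℕ) : (densePacked (N + 1)).res = densePacked N := by
  refine GT.ext' fun n k h1 h2 h3 => ?_
  rw [GT.res_apply _ h3]
  simp [densePacked, h1, h2, h3, show n ≤ N + 1 by omega]

theorem IsForwardSolution.map_res {ν : ℝ≥0 → Measure (GT (N + 1))}
    (hν : IsForwardSolution lam (N + 1) ν) :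
    IsForwardSolution lam N fun t => (ν t).map GT.res := by
  have hi : ∀ (f : GT N → ℝ) t, ∫ x, f x ∂((ν t).map GT.res) = ∫ x, f x.res ∂(ν t) := fun f t =>
    integral_map Measurable.of_discrete.aemeasurable Measurable.of_discrete.aestronglyMeasurable
  refine ⟨fun t => ?_, ?_, ?_⟩
  · have := hν.prob t
    exact Measure.isProbabilityMeasure_map Measurable.of_discrete.aemeasurable
  · rintro f ⟨C, hf⟩
    simp only [hi]
    exact hν.meas (fun x => f x.res) ⟨C, fun x => hf _⟩
  · rintro f ⟨C, hf⟩ t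
    simp only [hi, ← generator_comp_res f, ← densePacked_res N]
    exact hν.eq (fun x => f x.res) ⟨C, fun x => hf _⟩ t

theorem gtLaw_map_res (h : UniformlyBounded lam) (N : ℕ) (t : ℝ≥0) :
    (gtLaw lam (N + 1) t).map GT.res = gtLaw lam N t :=
  (isForwardSolution_gtLaw h (N + 1)).map_res.unique (isForwardSolution_gtLaw h N) t

end

/-! ### Projective limits -/

section

/-- A consistent sequence of probability measures is the sequence of marginals of a measure on
the compatible sequences. -/
theorem exists_measure_map_eval {X : ℕ → Type*} [∀ n, MeasurableSpace (X n)]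
    [∀ n, StandardBorelSpace (X n)] [∀ n, Nonempty (X n)] (ν : ∀ n, Measure (X n))
    [∀ n, IsProbabilityMeasure (ν n)] (r : ∀ n, X (n + 1) → X n) (hr : ∀ n, Measurable (r n))
    (hν : ∀ n, (ν (n + 1)).map (r n) = ν n) :
    ∃ P : Measure (∀ n, X n), IsProbabilityMeasure P ∧ (∀ n, P.map (fun x => x n) = ν n) ∧
      ∀ᵐ x ∂P, ∀ n, r n (x (n + 1)) = x n := by
  -- Ionescu-Tulcea with a Markov choice of kernels: the next coordinate is drawn from the
  -- conditional law under `ν (n + 1)` of a point given its image under `r n`.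
  let κ : (n : ℕ) → Kernel (Π i : Finset.Iic n, X i) (X (n + 1)) := fun n =>
    (condDistrib id (r n) (ν (n + 1))).comap (fun h => h ⟨n, Finset.mem_Iic.2 le_rfl⟩)
      (measurable_pi_apply _)
  have hκ : ∀ n, IsMarkovKernel (κ n) := fun n => Kernel.IsMarkovKernel.comap _ _
  set P := Kernel.trajMeasure (ν 0) κ with hP
  have hjoint : ∀ n, P.map (fun x => x n) = ν n →
      P.map (fun x => (x n, x (n + 1))) = (ν (n + 1)).map fun y => (r n y, y) := by
    intro n hn
    have h1 := Kernel.map_frestrictLe_trajMeasure_compProd_eq_map_trajMeasure (μ₀ := ν 0) (κ := κ)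
      (a := n)
    have h2 := congrArg (fun μ => μ.map (Prod.map
      (fun h : (Π i : Finset.Iic n, X i) => h ⟨n, Finset.mem_Iic.2 le_rfl⟩) id)) h1
    simp only at h2
    rw [Measure.map_map (by fun_prop) (by fun_prop)] at h2
    have h3 : (Prod.map (fun h : (Π i : Finset.Iic n, X i) => h ⟨n, Finset.mem_Iic.2 le_rfl⟩) id ∘
        fun x : Π n, X n => (Preorder.frestrictLe n x, x (n + 1))) = fun x => (x n, x (n + 1)) := rfl
    rw [h3] at h2
    have h4 := compProd_map_condDistrib (mβ := inferInstance) (X := r n) (Y := id) (μ := ν (n + 1))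
      measurable_id.aemeasurable
    simp only [id_eq] at h4
    rw [hP, ← h2, ← h4, hν, ← hn]
    ext s hs
    rw [Measure.map_apply (by fun_prop) hs, Measure.compProd_apply
      ((show Measurable _ by fun_prop : Measurable _) hs), Measure.compProd_apply hs,
      lintegral_map _ (by fun_prop), lintegral_map _ (by fun_prop)]
    · rfl
    · exact Kernel.measurable_kernel_prodMk_left hs
    · exact Kernel.measurable_kernel_prodMk_left ((show Measurable _ by fun_prop) hs)
  have hmarg : ∀ n, P.map (fun x => x n) = ν n := by
    intro n
    induction n with
    | zero =>
      have h1 : (fun x : Π n, X n => x 0) =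
        (fun h : (Π i : Finset.Iic 0, X i) => h ⟨0, Finset.mem_Iic.2 le_rfl⟩) ∘
          Preorder.frestrictLe 0 := rfl
      rw [h1, ← Measure.map_map (by fun_prop) (by fun_prop), hP, Kernel.trajMeasure,
        Measure.map_comp _ _ (by fun_prop), Kernel.traj_map_frestrictLe, Kernel.partialTraj_self,
        Measure.id_comp]
      exact (Measure.map_map (measurable_pi_apply _) (MeasurableEquiv.measurable _)).trans
        Measure.map_id
    | succ n ih =>
      have h1 := congrArg (fun μ => μ.map Prod.snd) (hjoint n ih)
      rw [Measure.map_map (by fun_prop) (by fun_prop),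
        Measure.map_map (by fun_prop) (by fun_prop)] at h1
      simpa [Function.comp_def] using h1
  refine ⟨P, inferInstance, hmarg, ae_all_iff.2 fun n => ?_⟩
  have h1 : ∀ᵐ p ∂(P.map fun x => (x n, x (n + 1))), r n p.2 = p.1 := by
    rw [hjoint n (hmarg n), ae_map_iff (by fun_prop)]
    · exact ae_of_all _ fun y => rfl
    · exact measurableSet_eq_fun (by fun_prop) (by fun_prop)
  exact ae_of_ae_map (by fun_prop) h1

end

/-! ### Measures on infinite patterns -/

section
variable {lam : ℕ → ℝ} {N : ℕ}

theorem GTInf.trunc_apply (x : GTInf) {n : ℕ} (h : n ≤ N) (k : ℕ) :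
    (x.trunc N).1 n k = x.1 n k := if_pos h

theorem GTInf.measurable_val : Measurable (Subtype.val : GTInf → ℕ → ℕ → ℕ) :=
  comap_measurable _

theorem GTInf.measurable_entry (n k : ℕ) : Measurable fun x : GTInf => x.1 n k :=
  (measurable_pi_apply k).comp ((measurable_pi_apply n).comp GTInf.measurable_val)

theorem GTInf.measurable_of_entry {α : Type*} {m : MeasurableSpace α} {g : α → GTInf}
    (h : ∀ n k, Measurable fun a => (g a).1 n k) : Measurable g :=
  measurable_comap_iff.2 (measurable_pi_lambda _ fun n => measurable_pi_lambda _ fun k => h n k)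

theorem GTInf.measurable_trunc (N : ℕ) : Measurable (GTInf.trunc N) := by
  refine measurable_to_countable' fun y => ?_
  have h1 : GTInf.trunc N ⁻¹' {y} = ⋂ p ∈ gtIndex N, {x : GTInf | x.1 p.1 p.2 = y.1 p.1 p.2} := by
    ext x
    simp only [Set.mem_preimage, Set.mem_singleton_iff, Set.mem_iInter]
    constructor
    · rintro rfl p hp
      exact (x.trunc_apply (mem_gtIndex.1 hp).2.2 _).symm
    · intro h
      refine GT.ext' fun n k h1 h2 h3 => ?_
      rw [x.trunc_apply h3]
      exact h (n, k) (mem_gtIndex.2 ⟨h1, h2, h3⟩)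
  rw [h1]
  exact Finset.measurableSet_biInter _ fun p _ =>
    GTInf.measurable_entry p.1 p.2 (MeasurableSet.singleton _)

theorem GTInf.trunc_eq_of_le {N' : ℕ} (h : N ≤ N') {x y : GTInf}
    (hxy : x.trunc N' = y.trunc N') : x.trunc N = y.trunc N := by
  refine GT.ext' fun n k h1 h2 h3 => ?_
  rw [x.trunc_apply h3, y.trunc_apply h3, ← x.trunc_apply (h3.trans h), hxy,
    y.trunc_apply (h3.trans h)]

/-- Two cylinder sets can thus be put on a common level, which makes them a π-system. -/
theorem GTInf.preimage_trunc_of_le {N' : ℕ} (h : N ≤ N') (S : Set (GT N)) :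
    ∃ S' : Set (GT N'), GTInf.trunc N ⁻¹' S = GTInf.trunc N' ⁻¹' S' := by
  refine ⟨Set.image (GTInf.trunc N') (GTInf.trunc N ⁻¹' S), ?_⟩
  refine subset_antisymm (Set.subset_preimage_image _ _) ?_
  rintro x ⟨y, hy, hxy⟩
  rw [Set.mem_preimage, ← GTInf.trunc_eq_of_le h hxy]
  exact hy

/-- A probability measure on `GTInf` is determined by its truncations. -/
theorem GTInf.measure_ext {P Q : Measure GTInf} [IsProbabilityMeasure P] [IsProbabilityMeasure Q]
    (h : ∀ N, P.map (GTInf.trunc N) = Q.map (GTInf.trunc N)) : P = Q := by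
  refine ext_of_generate_finite {A | ∃ N, ∃ S : Set (GT N), A = GTInf.trunc N ⁻¹' S} ?_ ?_ ?_
    (by simp)
  · refine le_antisymm ?_ ?_
    · intro A hA
      refine GTInf.measurable_of_entry (m := MeasurableSpace.generateFrom _) (g := id)
        (fun n k s _ => ?_) hA
      refine MeasurableSpace.measurableSet_generateFrom ⟨n, {y | y.1 n k ∈ s}, ?_⟩
      ext x
      simp only [Set.mem_preimage, Set.mem_ofPred_eq, GTInf.trunc_apply x (le_refl n), id_eq]
    · refine MeasurableSpace.generateFrom_le ?_
      rintro _ ⟨N, S, rfl⟩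
      exact GTInf.measurable_trunc N trivial
  · rintro _ ⟨N₁, S₁, rfl⟩ _ ⟨N₂, S₂, rfl⟩ _
    obtain ⟨S₁', h₁⟩ := GTInf.preimage_trunc_of_le (le_max_left N₁ N₂) S₁
    obtain ⟨S₂', h₂⟩ := GTInf.preimage_trunc_of_le (le_max_right N₁ N₂) S₂
    exact ⟨max N₁ N₂, S₁' ∩ S₂', by rw [h₁, h₂]; rfl⟩
  · rintro _ ⟨N, S, rfl⟩
    rw [← Measure.map_apply (GTInf.measurable_trunc N) trivial, h N,
      Measure.map_apply (GTInf.measurable_trunc N) trivial]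

/-- The densely packed infinite pattern. -/
def densePackedInf : GTInf :=
  ⟨fun n k => if 1 ≤ k ∧ k ≤ n then k - 1 else 0, by
    refine ⟨fun n k h => if_neg h, fun n k h1 h2 => ?_, fun n k h1 h2 => ?_⟩
    · rw [if_pos (by omega), if_pos (by omega)]; omega
    · rw [if_pos (by omega), if_pos (by omega), if_pos (by omega)]; omega⟩

theorem GT.apply_eq_of_compatible {x : ∀ n, GT n} (hx : ∀ n, (x (n + 1)).res = x n) {n m : ℕ}
    (h : n ≤ m) (k : ℕ) : (x m).1 n k = (x n).1 n k := by
  induction m, h using Nat.le_induction with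
  | base => rfl
  | succ m hm ih => rw [← ih, ← hx m, GT.res_apply _ hm]

theorem isGTInf_of_compatible {x : ∀ n, GT n} (hx : ∀ n, (x (n + 1)).res = x n) :
    IsGTInf fun n k => (x n).1 n k := by
  refine ⟨fun n k h => (x n).2.support n k fun h' => h ⟨h'.1, h'.2.1⟩,
    fun n k h1 h2 => (x n).2.strict n k h1 h2 le_rfl, fun n k h1 h2 => ?_⟩
  have := (x (n + 1)).2.interlace n k h1 h2 le_rfl
  rwa [GT.apply_eq_of_compatible hx (Nat.le_succ n)] at this

open Classical in
/-- The infinite pattern with a given compatible sequence of truncations. -/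
noncomputable def gtGlue (x : ∀ n, GT n) : GTInf :=
  if hx : ∀ n, (x (n + 1)).res = x n then ⟨fun n k => (x n).1 n k, isGTInf_of_compatible hx⟩
  else densePackedInf

theorem gtGlue_val_of_compatible {x : ∀ n, GT n} (hx : ∀ n, (x (n + 1)).res = x n) :
    (gtGlue x).1 = fun n k => (x n).1 n k := by
  have h : gtGlue x = ⟨fun n k => (x n).1 n k, isGTInf_of_compatible hx⟩ := by
    unfold gtGlue
    exact dif_pos hx
  rw [h]

theorem trunc_gtGlue {x : ∀ n, GT n} (hx : ∀ n, (x (n + 1)).res = x n) (N : ℕ) :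
    (gtGlue x).trunc N = x N := by
  refine GT.ext' fun n k h1 h2 h3 => ?_
  rw [GTInf.trunc_apply _ h3, gtGlue_val_of_compatible hx, GT.apply_eq_of_compatible hx h3]

theorem measurable_gtGlue : Measurable gtGlue := by
  classical
  refine GTInf.measurable_of_entry fun n k => ?_
  have h1 : (fun x => (gtGlue x).1 n k) = fun x : ∀ n, GT n =>
      if ∀ n, (x (n + 1)).res = x n then (x n).1 n k else densePackedInf.1 n k := by
    ext x
    by_cases hx : ∀ n, (x (n + 1)).res = x n
    · rw [if_pos hx, gtGlue_val_of_compatible hx]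
    · have h2 : gtGlue x = densePackedInf := by
        unfold gtGlue
        exact dif_neg hx
      rw [if_neg hx, h2]
  rw [h1]
  refine Measurable.ite ?_ ?_ measurable_const
  · rw [Set.ofPred_forall]
    refine MeasurableSet.iInter fun n => measurableSet_eq_fun ?_ (measurable_pi_apply n)
    exact (Measurable.of_discrete (f := GT.res (N := n))).comp (measurable_pi_apply (n + 1))
  · exact (Measurable.of_discrete (f := fun y : GT n => y.1 n k)).comp (measurable_pi_apply n)

theorem exists_gtLawInf (h : UniformlyBounded lam) (t : ℝ≥0) :
    ∃ P : Measure GTInf, IsProbabilityMeasure P ∧ ∀ N, P.map (GTInf.trunc N) = gtLaw lam N t := by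
  have hp := fun N => isProbabilityMeasure_gtLaw h N t
  have : ∀ N, Nonempty (GT N) := fun N => ⟨densePacked N⟩
  obtain ⟨P, hP, hmarg, hcomp⟩ := exists_measure_map_eval (fun N => gtLaw lam N t)
    (fun N => GT.res) (fun N => Measurable.of_discrete) fun N => gtLaw_map_res h N t
  refine ⟨P.map gtGlue, Measure.isProbabilityMeasure_map measurable_gtGlue.aemeasurable,
    fun N => ?_⟩
  rw [Measure.map_map (GTInf.measurable_trunc N) measurable_gtGlue, ← hmarg N]
  refine Measure.map_congr ?_
  filter_upwards [hcomp] with x hx using trunc_gtGlue hx N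

end

/-! ### Laws of push-block processes -/

section
variable {lam : ℕ → ℝ} {N : ℕ} {Ω : Type*} [mΩ : MeasurableSpace Ω]

/-- The smallest multiple of `1 / (n + 1)` to the right of `s`. -/
noncomputable def gridSucc (n : ℕ) (s : ℝ≥0) : ℝ≥0 := (⌊s * (n + 1)⌋₊ + 1) / (n + 1)

theorem lt_gridSucc (n : ℕ) (s : ℝ≥0) : s < gridSucc n s := by
  rw [gridSucc, lt_div_iff₀ (by positivity)]
  exact Nat.lt_floor_add_one _

theorem gridSucc_le (n : ℕ) (s : ℝ≥0) : gridSucc n s ≤ s + 1 / (n + 1) := by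
  rw [gridSucc, div_le_iff₀ (by positivity), add_mul, one_div, inv_mul_cancel₀ (by positivity)]
  gcongr
  exact Nat.floor_le (by positivity)

theorem tendsto_gridSucc (s : ℝ≥0) : Tendsto (fun n => gridSucc n s) atTop (𝓝[≥] s) := by
  refine tendsto_nhdsWithin_iff.2 ⟨?_, Eventually.of_forall fun n => (lt_gridSucc n s).le⟩
  refine tendsto_of_tendsto_of_tendsto_of_le_of_le tendsto_const_nhds ?_
    (fun n => (lt_gridSucc n s).le) fun n => gridSucc_le n s
  have h1 : Tendsto (fun n : ℕ => 1 / ((n : ℝ≥0) + 1)) atTop (𝓝 0) :=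
    tendsto_one_div_add_atTop_nhds_zero_nat
  simpa using h1.const_add s

/-- Sampling at the next grid point to the right is jointly measurable, and right-continuity into a
discrete space makes the samples eventually equal to the value. -/
theorem measurable_uncurry_of_right_constant {X : ℝ≥0 → Ω → GT N} (hX : ∀ t, Measurable (X t))
    (hr : ∀ ω t, ∀ᶠ s in 𝓝[≥] t, X s ω = X t ω) (f : GT N → ℝ) :
    Measurable fun p : ℝ≥0 × Ω => f (X p.1 p.2) := by
  refine measurable_of_tendsto_metrizable
    (f := fun n (p : ℝ≥0 × Ω) => f (X (gridSucc n p.1) p.2)) (fun n => ?_) ?_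
  · have h1 : Measurable fun p : ℕ × Ω => f (X ((p.1 + 1) / (n + 1)) p.2) :=
      measurable_from_prod_countable_right fun k =>
        (Measurable.of_discrete (f := f)).comp (hX ((k + 1) / (n + 1)))
    have h2 : Measurable fun p : ℝ≥0 × Ω => (⌊p.1 * (n + 1)⌋₊, p.2) :=
      (Nat.measurable_floor.comp (measurable_fst.mul_const _)).prodMk measurable_snd
    simpa only [gridSucc, Function.comp_def] using h1.comp h2
  · refine tendsto_pi_nhds.2 fun p => tendsto_const_nhds.congr' ?_
    filter_upwards [(tendsto_gridSucc p.1).eventually (hr p.2 p.1)] with n hn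
    rw [hn]

/-- Take expectations in the martingale property between times `0` and `t`, and exchange the
expectation with the time integral by Fubini. -/
theorem IsPushBlockProcess.isForwardSolution (h : UniformlyBounded lam) {μ : Measure Ω}
    [IsProbabilityMeasure μ] {ℱ : Filtration ℝ≥0 mΩ} {X : ℝ≥0 → Ω → GT N}
    (hX : IsPushBlockProcess lam N μ ℱ X) :
    IsForwardSolution lam N fun t => μ.map (X t) := by
  have hm : ∀ t, Measurable (X t) := fun t => (hX.adapted t).mono (ℱ.le t) le_rfl
  have hi : ∀ (f : GT N → ℝ) t, ∫ x, f x ∂(μ.map (X t)) = ∫ ω, f (X t ω) ∂μ := fun f t =>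
    integral_map (hm t).aemeasurable Measurable.of_discrete.aestronglyMeasurable
  have hj : ∀ f : GT N → ℝ, Measurable fun p : ℝ × Ω => f (X p.1.toNNReal p.2) := fun f =>
    (measurable_uncurry_of_right_constant hm hX.right_continuous f).comp
      ((measurable_real_toNNReal.comp measurable_fst).prodMk measurable_snd)
  refine ⟨fun t => Measure.isProbabilityMeasure_map (hm t).aemeasurable, ?_, ?_⟩
  · rintro f -
    simp only [hi]
    exact ((hj f).stronglyMeasurable.integral_prod_right' (ν := μ)).measurable
  · rintro f ⟨C, hf⟩ t
    simp only [hi]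
    have : IsFiniteMeasure (volume.restrict (Set.uIoc 0 (t : ℝ))) :=
      ⟨by rw [Measure.restrict_apply_univ, Set.uIoc_of_le t.coe_nonneg]; exact measure_Ioc_lt_top⟩
    have hgi : Integrable (Function.uncurry fun (s : ℝ) ω => generator lam N f (X s.toNNReal ω))
        ((volume.restrict (Set.uIoc 0 (t : ℝ))).prod μ) :=
      Integrable.of_bound (hj (generator lam N f)).aestronglyMeasurable _
        (ae_of_all _ fun p => abs_generator_le h hf _)
    have h1 := (hX.martingale f ⟨C, hf⟩).setIntegral_eq (zero_le (a := t)) MeasurableSet.univ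
    rw [setIntegral_univ, setIntegral_univ] at h1
    have h2 : ∫ ω, f (X t ω) ∂μ - ∫ ω, (∫ s in (0 : ℝ)..t, generator lam N f (X s.toNNReal ω)) ∂μ =
        f (densePacked N) := by
      rw [← integral_sub, ← h1]
      · have h3 : ∀ᵐ ω ∂μ, f (X 0 ω) - ∫ s in (0 : ℝ)..((0 : ℝ≥0) : ℝ),
            generator lam N f (X s.toNNReal ω) = f (densePacked N) := by
          filter_upwards [hX.start] with ω hω
          simp [hω]
        rw [integral_congr_ae h3]
        simp
      · exact Integrable.of_bound (Measurable.of_discrete.comp (hm t)).aestronglyMeasurable C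
          (ae_of_all _ fun ω => hf _)
      · have h3 := hgi.integral_prod_right
        rw [Set.uIoc_of_le t.coe_nonneg] at h3
        simpa only [intervalIntegral.integral_of_le t.coe_nonneg, Function.uncurry_apply_pair] using h3
    rw [intervalIntegral_integral_swap hgi, ← h2]
    ring

theorem IsPushBlockProcess.map_eq_gtLaw (h : UniformlyBounded lam) {μ : Measure Ω}
    [IsProbabilityMeasure μ] {ℱ : Filtration ℝ≥0 mΩ} {X : ℝ≥0 → Ω → GT N}
    (hX : IsPushBlockProcess lam N μ ℱ X) (t : ℝ≥0) : μ.map (X t) = gtLaw lam N t :=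
  (hX.isForwardSolution h).unique (isForwardSolution_gtLaw h N) t

theorem IsPushBlockProcessInf.map_eq (h : UniformlyBounded lam) {μ : Measure Ω}
    [IsProbabilityMeasure μ] {ℱ : Filtration ℝ≥0 mΩ} {X : ℝ≥0 → Ω → GTInf}
    (hX : IsPushBlockProcessInf lam μ ℱ X) {t : ℝ≥0} {P : Measure GTInf} [IsProbabilityMeasure P]
    (hP : ∀ N, P.map (GTInf.trunc N) = gtLaw lam N t) : μ.map (X t) = P := by
  have hm : Measurable (X t) := by
    refine GTInf.measurable_of_entry fun n k => ?_
    have h1 := ((hX n).adapted t).mono (ℱ.le t) le_rfl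
    have h2 := (Measurable.of_discrete (f := fun y : GT n => y.1 n k)).comp h1
    simpa only [Function.comp_def, GTInf.trunc_apply _ (le_refl n)] using h2
  have := Measure.isProbabilityMeasure_map (μ := μ) hm.aemeasurable
  refine GTInf.measure_ext fun N => ?_
  rw [hP N, Measure.map_map (GTInf.measurable_trunc N) hm]
  exact (hX N).map_eq_gtLaw h t

end

/-! ### The correlation functions -/

section
variable {lam : ℕ → ℝ} {N : ℕ}

/-- The particles of a finite pattern. -/
def GT.points (x : GT N) : Finset (ℕ × ℕ) := (gtIndex N).image fun p => (p.1, x.1 p.1 p.2)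

theorem GTInf.mem_particles_iff (x : GTInf) {v : ℕ × ℕ} (h : v.1 ≤ N) :
    v ∈ x.particles ↔ v ∈ (x.trunc N).points := by
  simp only [GTInf.particles, GT.points, Set.mem_ofPred_eq, Finset.mem_image, mem_gtIndex]
  constructor
  · rintro ⟨k, h1, h2, h3⟩
    exact ⟨(v.1, k), ⟨h1, h2, h⟩, by rw [GTInf.trunc_apply x h, h3]⟩
  · rintro ⟨p, ⟨h1, h2, h3⟩, rfl⟩
    exact ⟨p.2, h1, h2, (x.trunc_apply h3 p.2).symm⟩

theorem GT.strictMonoOn_row (x : GT N) {n : ℕ} (hn : n ≤ N) {k d : ℕ} (h1 : 1 ≤ k)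
    (h2 : k + d + 1 ≤ n) : x.1 n k < x.1 n (k + d + 1) := by
  induction d with
  | zero => exact x.2.strict n k h1 h2 hn
  | succ d ih => exact (ih (by omega)).trans (x.2.strict n (k + d + 1) (by omega) h2 hn)

theorem GT.injOn_points (x : GT N) :
    Set.InjOn (fun p : ℕ × ℕ => (p.1, x.1 p.1 p.2)) (gtIndex N : Set (ℕ × ℕ)) := by
  rintro ⟨n, k⟩ hp ⟨n', k'⟩ hq h
  simp only [Finset.mem_coe, mem_gtIndex] at hp hq
  simp only [Prod.mk.injEq] at h
  obtain ⟨rfl, h⟩ := h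
  rcases lt_trichotomy k k' with hk | rfl | hk
  · obtain ⟨d, rfl⟩ := Nat.exists_eq_add_of_lt hk
    exact absurd h (x.strictMonoOn_row hp.2.2 hp.1 hq.2.1).ne
  · rfl
  · obtain ⟨d, rfl⟩ := Nat.exists_eq_add_of_lt hk
    exact absurd h (x.strictMonoOn_row hp.2.2 hq.1 hp.2.1).ne'

/-- Particles occupy distinct sites and the `z i` are distinct, so both products are `1 + s` to the
number of common points. -/
theorem GT.prod_tilt_eq (x : GT N) {m : ℕ} {z : Fin m → ℕ × ℕ} (hz : Function.Injective z)
    (s : ℂ) : ∏ p ∈ gtIndex N, (1 + s * ∑ i, if z i = (p.1, x.1 p.1 p.2) then 1 else 0) =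
      ∏ i, (1 + s * if z i ∈ x.points then 1 else 0) := by
  classical
  have h1 : ∀ v, (∑ i, if z i = v then (1 : ℂ) else 0) =
      if v ∈ Finset.univ.image z then 1 else 0 := by
    intro v
    split_ifs with hv
    · obtain ⟨i, -, rfl⟩ := Finset.mem_image.1 hv
      simp [hz.eq_iff]
    · refine Finset.sum_eq_zero fun i _ => if_neg fun h => hv ?_
      exact Finset.mem_image.2 ⟨i, Finset.mem_univ i, h⟩
  have h2 : ∀ A B : Finset (ℕ × ℕ), ∏ v ∈ A, (1 + s * if v ∈ B then 1 else 0) =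
      (1 + s) ^ (A ∩ B).card := by
    intro A B
    rw [← Finset.prod_const, ← Finset.filter_mem_eq_inter, Finset.prod_filter]
    refine Finset.prod_congr rfl fun v _ => ?_
    split_ifs <;> simp
  have h3 := Finset.prod_image (f := fun v : ℕ × ℕ => 1 + s * ∑ i, if z i = v then (1 : ℂ) else 0)
    x.injOn_points
  rw [← h3, ← GT.points]
  simp only [h1]
  rw [h2, Finset.inter_comm, ← h2, Finset.prod_image hz.injOn]

/-- The regularised indicator of the event that all points `z i` are occupied. -/
noncomputable def occupation {m : ℕ} (z : Fin m → ℕ × ℕ) (ε : ℝ) (x : GT N) : ℝ :=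
  ∏ i, (ε + if z i ∈ x.points then 1 else 0)

theorem abs_occupation_le {m : ℕ} (z : Fin m → ℕ × ℕ) {ε : ℝ} (h0 : 0 ≤ ε) (h1 : ε ≤ 1)
    (x : GT N) : |occupation z ε x| ≤ 2 ^ m := by
  rw [occupation, Finset.abs_prod]
  refine (Finset.prod_le_prod (g := fun _ => (2 : ℝ)) (fun i _ => abs_nonneg _) fun i _ => ?_).trans
    (by simp)
  rw [abs_of_nonneg (by split_ifs <;> linarith)]
  split_ifs <;> linarith

/-- The generating function at `s = ε⁻¹`, multiplied by `ε ^ m`. On the determinant side this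
replaces `1 + ε⁻¹ K` by `ε + K`, which is continuous at `ε = 0`. -/
theorem integral_occupation (h : UniformlyBounded lam) (t : ℝ≥0) {m : ℕ} {z : Fin m → ℕ × ℕ}
    (hz : Function.Injective z) (hN : ∀ i, (z i).1 ≤ N) {C C₀ : ℝ → ℂ}
    (hC : AdmissibleContours lam C C₀) {ε : ℝ} (h0 : 0 < ε) (h1 : ε ≤ 1) :
    ((∫ x, occupation z ε x ∂(gtLaw lam N t) : ℝ) : ℂ) =
      ((ε : ℂ) • 1 + Matrix.of fun i j => corrKernel lam C C₀ t (z i) (z j)).det := by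
  have := isProbabilityMeasure_gtLaw h N t
  have hε : (ε : ℂ) ≠ 0 := Complex.ofReal_ne_zero.2 h0.ne'
  have hb := abs_occupation_le (N := N) z h0.le h1
  have h2 := tendsto_integral_of_bounded (abs_cutoff_le hb) (tendsto_cutoff (occupation z ε))
    (gtLaw lam N t)
  simp only [integral_cutoff_gtLaw h] at h2
  have h3 := (Complex.continuous_ofReal.tendsto _).comp h2
  have h4 := (tendsto_sum_gtDensity_mul h t (ε : ℂ)⁻¹ z hN hC).const_mul ((ε : ℂ) ^ m)
  refine tendsto_nhds_unique h3 ?_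
  rw [show ((ε : ℂ) • 1 + Matrix.of fun i j => corrKernel lam C C₀ t (z i) (z j)) = (ε : ℂ) •
    (1 + (ε : ℂ)⁻¹ • Matrix.of fun i j => corrKernel lam C C₀ t (z i) (z j)) by
      rw [smul_add, smul_inv_smul₀ hε], Matrix.det_smul, Fintype.card_fin]
  refine h4.congr fun R => ?_
  rw [Function.comp_apply, Complex.ofReal_sum, Finset.mul_sum]
  refine Finset.sum_congr rfl fun x _ => ?_
  rw [x.prod_tilt_eq hz, Complex.ofReal_mul, occupation, Complex.ofReal_prod,
    show ((gtDensity lam N t x).re : ℂ) = gtDensity lam N t x from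
      Complex.ext rfl (by simp [gtDensity_im h x t.coe_nonneg])]
  have h5 : (ε : ℂ) ^ m = ∏ _i : Fin m, (ε : ℂ) := by simp
  rw [mul_left_comm, h5, ← Finset.prod_mul_distrib, mul_comm]
  congr 1
  refine Finset.prod_congr rfl fun i _ => ?_
  split_ifs <;> push_cast <;> field_simp

theorem gtLaw_real_points (h : UniformlyBounded lam) (t : ℝ≥0) {m : ℕ} {z : Fin m → ℕ × ℕ}
    (hz : Function.Injective z) (hN : ∀ i, (z i).1 ≤ N) {C C₀ : ℝ → ℂ}
    (hC : AdmissibleContours lam C C₀) :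
    (((gtLaw lam N t).real {x | ∀ i, z i ∈ x.points} : ℝ) : ℂ) =
      (Matrix.of fun i j => corrKernel lam C C₀ t (z i) (z j)).det := by
  have := isProbabilityMeasure_gtLaw h N t
  have hε : Tendsto (fun n : ℕ => 1 / ((n : ℝ) + 1)) atTop (𝓝 0) :=
    tendsto_one_div_add_atTop_nhds_zero_nat
  have hε0 : ∀ n : ℕ, 0 < 1 / ((n : ℝ) + 1) := fun n => by positivity
  have hε1 : ∀ n : ℕ, 1 / ((n : ℝ) + 1) ≤ 1 := fun n => by
    rw [div_le_one (by positivity)]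
    linarith [n.cast_nonneg (α := ℝ)]
  have h1 := tendsto_integral_of_bounded (f := occupation z 0)
    (fun n => abs_occupation_le (N := N) z (hε0 n).le (hε1 n))
    (fun x => tendsto_finsetProd _ fun i _ => hε.add_const _) (gtLaw lam N t)
  have h2 : ∫ x, occupation z 0 x ∂(gtLaw lam N t) =
      (gtLaw lam N t).real {x | ∀ i, z i ∈ x.points} := by
    rw [← integral_indicator_one (MeasurableSet.of_discrete)]
    refine integral_congr_ae (ae_of_all _ fun x => ?_)
    simp only [occupation, zero_add]
    by_cases hx : ∀ i, z i ∈ x.points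
    · rw [Set.indicator_of_mem (by exact hx)]
      simp [hx]
    · rw [Set.indicator_of_notMem (by exact hx)]
      push Not at hx
      obtain ⟨i, hi⟩ := hx
      exact Finset.prod_eq_zero (Finset.mem_univ i) (if_neg hi)
  rw [h2] at h1
  have h3 := (Complex.continuous_ofReal.tendsto _).comp h1
  refine tendsto_nhds_unique h3 ?_
  simp only [Function.comp_def, integral_occupation h t hz hN hC (hε0 _) (hε1 _)]
  have h4 : Continuous fun e : ℝ =>
      ((e : ℂ) • 1 + Matrix.of fun i j => corrKernel lam C C₀ t (z i) (z j)).det := by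
    refine Continuous.matrix_det ?_
    exact (Complex.continuous_ofReal.smul continuous_const).add continuous_const
  have h5 := (h4.tendsto 0).comp hε
  simpa only [Function.comp_def, Complex.ofReal_zero, zero_smul, zero_add] using h5

end

theorem mainTheorem1 (lam : ℕ → ℝ) (hlam : UniformlyBounded lam) :
    ∃ P : ℝ≥0 → Measure GTInf,
      (∀ t, IsProbabilityMeasure (P t)) ∧
      SolvesForwardEquation lam P ∧
      (∀ (Ω : Type*) [mΩ : MeasurableSpace Ω] (μ : Measure Ω) [IsProbabilityMeasure μ]
        (ℱ : Filtration ℝ≥0 mΩ),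
        (∀ (N : ℕ) (X : ℝ≥0 → Ω → GT N), IsPushBlockProcess lam N μ ℱ X →
          ∀ t, μ.map (X t) = (P t).map (GTInf.trunc N)) ∧
        (∀ X : ℝ≥0 → Ω → GTInf, IsPushBlockProcessInf lam μ ℱ X → ∀ t, μ.map (X t) = P t)) ∧
      ∀ C C₀ : ℝ → ℂ, AdmissibleContours lam C C₀ →
        ∀ (t : ℝ≥0) (k : ℕ) (z : Fin k → ℕ × ℕ), Function.Injective z → (∀ i, 1 ≤ (z i).1) →
          (((P t).real {x | ∀ i, z i ∈ x.particles} : ℝ) : ℂ) =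
            (Matrix.of fun i j => corrKernel lam C C₀ t (z i) (z j)).det := by
  choose P hP hmap using exists_gtLawInf hlam
  have hi : ∀ (N : ℕ) (f : GT N → ℝ) t, ∫ x, f (x.trunc N) ∂(P t) = ∫ x, f x ∂(gtLaw lam N t) := by
    intro N f t
    rw [← hmap t N]
    exact (integral_map (GTInf.measurable_trunc N).aemeasurable
      Measurable.of_discrete.aestronglyMeasurable).symm
  refine ⟨P, hP, fun N f hf t => ?_, fun Ω _ μ _ ℱ => ⟨fun N X hX t => ?_, fun X hX t => ?_⟩,
    fun C C₀ hC t k z hz _ => ?_⟩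
  · simp only [hi]
    exact (isForwardSolution_gtLaw hlam N).eq f hf t
  · rw [hmap t N]
    exact hX.map_eq_gtLaw hlam t
  · have := hP t
    exact hX.map_eq hlam (hmap t)
  -- The event only depends on the levels up to the highest one among the points, so the finite law
  -- on that many levels decides.
  · have hN : ∀ i, (z i).1 ≤ Finset.univ.sup fun i => (z i).1 := fun i =>
      Finset.le_sup (f := fun i => (z i).1) (Finset.mem_univ i)
    rw [← gtLaw_real_points hlam t hz hN hC, ← hmap t,
      map_measureReal_apply (GTInf.measurable_trunc _) MeasurableSet.of_discrete]
    congr 2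
    ext x
    exact forall_congr' fun i => x.mem_particles_iff (hN i)
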